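/- **Theorem.** Let $d\ge 2$ be an integer, let $\alpha,\widetilde\Psi\in\mathbb R$, and let $A$ be the Aharonov–Bohm type vector potential, defined for $x\in\mathbb R^d$ with $(x_{d-1},x_d)\neq(0,0)$ by $$A(x)=\widetilde\Psi\Big(0,\dots,0,\,-\frac{x_d}{x_{d-1}^2+x_d^2},\,\frac{x_{d-1}}{x_{d-1}^2+x_d^2}\Big).$$ Write $\nabla_A=\nabla-iA$ and $\Delta_A=\nabla_A\cdot\nabla_A=\sum_{j=1}^d(\partial_j-iA_j)^2$. Put $$\mathbb Z'=\{m\in\mathbb Z:\ m\le 2-d-\widetilde\Psi\ \text{ or }\ m\ge-\widetilde\Psi\},\qquad \lambda_m=(m+\widetilde\Psi)(m+\widetilde\Psi+d-2),$$ and define $$C_{\mathrm{AB}}(d,\alpha)=\begin{cases}\displaystyle\min_{m\in\mathbb Z'}\frac{\big(4\lambda_m+(d-4-\alpha)(d+\alpha)\big)^2}{4\big(4\lambda_m+(d-4-\alpha)^2\big)},&\text{if } d-\alpha-4\ne0,\\[3mm]\displaystyle\min\Big((d-2)^2,\ \min\big\{\lambda_m:\ m\in\mathbb Z',\ m+\widetilde\Psi\ne0,\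 m+\widetilde\Psi\ne2-d\big\}\Big),&\text{if } d-\alpha-4=0.\end{cases}$$ These minima are attained, and for every complex-valued $\psi\in C_0^\infty(\mathbb R^d\setminus\{0\})$, $$\int_{\mathbb R^d}\frac{|\Delta_A\psi(x)|^2}{|x|^\alpha}\,dx\ \ge\ C_{\mathrm{AB}}(d,\alpha)\int_{\mathbb R^d}\frac{|\nabla_A\psi(x)|^2}{|x|^{\alpha+2}}\,dx,$$ where both integrals are taken in $[0,+\infty]$ and $0\cdot\infty=0$. -/

import Mathlib

open scoped ContDiff ENNReal

namespace AharonovBohm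

/-- The Aharonov-Bohm type vector potential with flux `Ψ` on `ℝ^d`, `d ≥ 2`:
`A(x) = Ψ (0, …, 0, -x_d / (x_{d-1}² + x_d²), x_{d-1} / (x_{d-1}² + x_d²))`.
Coordinates are numbered from `0`, so `x_{d-1}` and `x_d` are the coordinates `d - 2` and `d - 1`.
The value on the null set `x_{d-1} = x_d = 0` is irrelevant. -/
noncomputable def potential (d : ℕ) (hd : 2 ≤ d) (Ψ : ℝ) (x : EuclideanSpace ℝ (Fin d)) :
    EuclideanSpace ℝ (Fin d) :=
  WithLp.toLp 2 fun j =>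
    if (j : ℕ) = d - 2 then
      Ψ * (-(x ⟨d - 1, by omega⟩) / ((x ⟨d - 2, by omega⟩) ^ 2 + (x ⟨d - 1, by omega⟩) ^ 2))
    else if (j : ℕ) = d - 1 then
      Ψ * (x ⟨d - 2, by omega⟩ / ((x ⟨d - 2, by omega⟩) ^ 2 + (x ⟨d - 1, by omega⟩) ^ 2))
    else 0

/-- The `j`-th magnetic derivative `∂_j f - i A_j f`. -/
noncomputable def magDeriv {d : ℕ} (A : EuclideanSpace ℝ (Fin d) → EuclideanSpace ℝ (Fin d))
    (j : Fin d) (f : EuclideanSpace ℝ (Fin d) → ℂ) (x : EuclideanSpace ℝ (Fin d)) : ℂ :=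
  fderiv ℝ f x (EuclideanSpace.single j 1) - Complex.I * (A x j : ℂ) * f x

/-- The magnetic gradient `∇_A f = ∇ f - i A f`. -/
noncomputable def magGradient {d : ℕ} (A : EuclideanSpace ℝ (Fin d) → EuclideanSpace ℝ (Fin d))
    (f : EuclideanSpace ℝ (Fin d) → ℂ) (x : EuclideanSpace ℝ (Fin d)) :
    EuclideanSpace ℂ (Fin d) :=
  WithLp.toLp 2 fun j => magDeriv A j f x

/-- The magnetic Laplacian `Δ_A f = ∇_A · ∇_A f = ∑_j (∂_j - i A_j)² f`. -/
noncomputable def magLaplacian {d : ℕ} (A : EuclideanSpace ℝ (Fin d) → EuclideanSpace ℝ (Fin d))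
    (f : EuclideanSpace ℝ (Fin d) → ℂ) (x : EuclideanSpace ℝ (Fin d)) : ℂ :=
  ∑ j, magDeriv A j (magDeriv A j f) x

/-- The index set `ℤ' = {m ∈ ℤ : m ≤ 2 - d - Ψ or m ≥ -Ψ}`. -/
def indexSet (d : ℕ) (Ψ : ℝ) : Set ℤ :=
  {m : ℤ | (m : ℝ) ≤ 2 - d - Ψ ∨ -Ψ ≤ (m : ℝ)}

/-- The number `(m + Ψ) (m + Ψ + d - 2)`. -/
noncomputable def eigenvalue (d : ℕ) (Ψ : ℝ) (m : ℤ) : ℝ :=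
  (m + Ψ) * (m + Ψ + d - 2)

/-- With `μ = (m + Ψ) (m + Ψ + d - 2)`, the quotient
`(4 μ + (d - 4 - α) (d + α))² / (4 (4 μ + (d - 4 - α)²))`. -/
noncomputable def ratio (d : ℕ) (α Ψ : ℝ) (m : ℤ) : ℝ :=
  (4 * eigenvalue d Ψ m + (d - 4 - α) * (d + α)) ^ 2 /
    (4 * (4 * eigenvalue d Ψ m + (d - 4 - α) ^ 2))

/-- The quotients over which the minimum is taken when `d - α - 4 ≠ 0`. -/
def ratioSet (d : ℕ) (α Ψ : ℝ) : Set ℝ :=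
  ratio d α Ψ '' indexSet d Ψ

/-- The numbers `(m + Ψ) (m + Ψ + d - 2)` with `m ∈ ℤ'` and `m + Ψ ∉ {0, 2 - d}`, over which the
minimum is taken when `d - α - 4 = 0`. -/
def nonzeroEigenvalueSet (d : ℕ) (Ψ : ℝ) : Set ℝ :=
  eigenvalue d Ψ '' {m : ℤ | m ∈ indexSet d Ψ ∧ (m : ℝ) + Ψ ≠ 0 ∧ (m : ℝ) + Ψ ≠ 2 - d}

/-- The constant `C_AB(d, α)`. The infima are minima; this is part of the theorem. -/
noncomputable def constant (d : ℕ) (α Ψ : ℝ) : ℝ :=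
  if (d : ℝ) - α - 4 ≠ 0 then sInf (ratioSet d α Ψ)
  else min (((d : ℝ) - 2) ^ 2) (sInf (nonzeroEigenvalueSet d Ψ))

end AharonovBohm

open scoped ContDiff ENNReal

namespace AharonovBohm

open MeasureTheory Filter Topology

/-! In logarithmic polar coordinates x = e^t w, with w on the unit sphere, |x|² Δ_A becomes ∂_t² + D
∂_t - Λ, where D = d - 2 and Λ ≥ 0 is a magnetic Laplacian on the sphere. If f(t) is the coefficient
of ψ along an eigenfunction of Λ with eigenvalue μ, that of |x|² Δ_A ψ is f'' + D f' - μ f, and the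
weight |x|^{-α} together with the volume element contributes e^{-2γt} with γ = (4 + α - d)/2. Put g
= e^{-γt} f, b = 2γ + D, c = μ - γ(γ + D). Integration by parts turns the left side into ∫ |g''|² +
(b² + 2c)|g'|² + c²|g|² and the gradient side into ∫ |g'|² + (μ + γ²)|g|²
(`one_dimensional_inequality`, `weighted_inequality`). Hence a constant C works once C ≤ b² + 2c and
C(μ + γ²) ≤ c² for every eigenvalue. The quotient c²/(μ + γ²) is the one minimised in the definition
of the constant. When μ + γ² > 0 the second condition implies the first, because (b² + 2c)(μ + γ²) -
c² = (μ + γ²)² + b²μ. When γ = 0 the eigenvalue μ = 0 leaves only C ≤ D² (`admissible_constant`).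

The gradient itself is never expanded on the sphere. Since Δ|ψ|² = 2|∇_A ψ|² + 2 Re(conj ψ Δ_A ψ),
its weighted norm is expressed by |ψ|² and Re(conj ψ Δ_A ψ) (`integral_norm_magGradient_sq`), so
only scalar products on spheres occur.

The spectrum of Λ comes from explicit functions. Around the axis, r^|m - Ψ| e^{imθ} is annihilated
by Δ_A. Multiplied by powers of r² and of linear forms X along the axis it gives homogeneous
functions of degree κ, and Δ_A sends them to combinations of such functions of degree κ - 2. On
suitable finite families Λ is therefore triangular with diagonal entries κ(κ + d - 2), and it is
symmetric, so it can be diagonalised with eigenvalues among these entries (`exists_eigenbasis`).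
Restricted to the sphere, the family is complete in L² (`eq_zero_of_inner_indexedVec`).

The difficulty is the axis, where A is singular while ψ need not vanish, so that Δ_A ψ need not be
square integrable. If the left side is infinite there is nothing to prove. Otherwise Green's formula
holds against the explicit functions, by a logarithmic cutoff around the axis
(`integral_magLaplacian_mul_conj_separated`). It yields the radial equation for the coefficients
(`inner_logLap`) and, applied to two explicit functions, the symmetry of Λ. Bessel's inequality and
a limit over finite families finish the proof (`slice_inequality`). -/

/-- Euclidean space of dimension `d`. -/
abbrev Space (d : ℕ) : Type := EuclideanSpace ℝ (Fin d)

/-! ### Leibniz and chain rules for magnetic derivatives -/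

section Calculus

variable {d : ℕ} {A : Space d → Space d} {f g u v : Space d → ℂ} {x : Space d}

/-- The `j`-th partial derivative. -/
noncomputable def partialDeriv (j : Fin d) (f : Space d → ℂ) (x : Space d) : ℂ :=
  fderiv ℝ f x (EuclideanSpace.single j 1)

/-- The Laplacian as the sum of the pure second partial derivatives. -/
noncomputable def laplacian (f : Space d → ℂ) (x : Space d) : ℂ :=
  ∑ j, partialDeriv j (partialDeriv j f) x

/-- The carré du champ `∑ j, ∂_j f · (∂_j - i A_j) u`. -/
noncomputable def gradInner (A : Space d → Space d) (f u : Space d → ℂ) (x : Space d) : ℂ :=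
  ∑ j, partialDeriv j f x * magDeriv A j u x

theorem magDeriv_eq (j : Fin d) : magDeriv A j u x =
    partialDeriv j u x - Complex.I * (A x j : ℂ) * u x := rfl

theorem magDeriv_zero (j : Fin d) : magDeriv (0 : Space d → Space d) j u = partialDeriv j u := by
  ext x; simp [magDeriv_eq]

theorem magLaplacian_zero : magLaplacian (0 : Space d → Space d) u = laplacian u := by
  ext x; simp [magLaplacian, laplacian, magDeriv_zero]

theorem partialDeriv_congr (h : f =ᶠ[𝓝 x] g) (j : Fin d) :
    partialDeriv j f x = partialDeriv j g x := by
  simp [partialDeriv, h.fderiv_eq]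

theorem magDeriv_congr (h : u =ᶠ[𝓝 x] v) (j : Fin d) : magDeriv A j u x = magDeriv A j v x := by
  simp [magDeriv_eq, partialDeriv_congr h j, h.eq_of_nhds]

theorem magDeriv_add (hu : DifferentiableAt ℝ u x) (hv : DifferentiableAt ℝ v x) (j : Fin d) :
    magDeriv A j (fun y => u y + v y) x = magDeriv A j u x + magDeriv A j v x := by
  simp only [magDeriv_eq, partialDeriv]
  rw [fderiv_fun_add hu hv]; simp; ring

theorem partialDeriv_mul (hf : DifferentiableAt ℝ f x) (hu : DifferentiableAt ℝ u x) (j : Fin d) :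
    partialDeriv j (fun y => f y * u y) x =
      partialDeriv j f x * u x + f x * partialDeriv j u x := by
  simp only [partialDeriv]
  rw [fderiv_fun_mul hf hu]; simp; ring

theorem magDeriv_mul (hf : DifferentiableAt ℝ f x) (hu : DifferentiableAt ℝ u x) (j : Fin d) :
    magDeriv A j (fun y => f y * u y) x =
      partialDeriv j f x * u x + f x * magDeriv A j u x := by
  simp only [magDeriv_eq, partialDeriv_mul hf hu]; ring

theorem contDiffAt_partialDeriv {n m : WithTop ℕ∞} (hf : ContDiffAt ℝ n f x) (h : m + 1 ≤ n)
    (j : Fin d) : ContDiffAt ℝ m (partialDeriv j f) x :=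
  (hf.fderiv_right h).clm_apply contDiffAt_const

theorem contDiffAt_magDeriv {n m : WithTop ℕ∞} (hA : ContDiffAt ℝ m A x)
    (hf : ContDiffAt ℝ n f x) (h : m + 1 ≤ n) (j : Fin d) :
    ContDiffAt ℝ m (magDeriv A j f) x := by
  have h1 : ContDiffAt ℝ m f x := hf.of_le (le_trans le_self_add h)
  have h2 : ContDiffAt ℝ m (fun y => A y j) x := contDiffAt_piLp_apply (p := 2) |>.comp x hA
  have h3 : ContDiffAt ℝ m (fun y => (A y j : ℂ)) x :=
    Complex.ofRealCLM.contDiff.contDiffAt.comp x h2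
  exact (contDiffAt_partialDeriv hf h j).sub ((contDiffAt_const.mul h3).mul h1)

theorem eventually_contDiffAt_two (hf : ContDiffAt ℝ 2 f x) : ∀ᶠ y in 𝓝 x, ContDiffAt ℝ 2 f y :=
  hf.eventually (by simp)

/-- The connection acts on one factor of a product while the other is differentiated plainly. Every
special function below can thus be built from scalar factors and a single magnetic factor. -/
theorem magLaplacian_mul (hA : ContDiffAt ℝ 1 A x) (hf : ContDiffAt ℝ 2 f x)
    (hu : ContDiffAt ℝ 2 u x) :
    magLaplacian A (fun y => f y * u y) x =
      f x * magLaplacian A u x + 2 * gradInner A f u x + laplacian f x * u x := by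
  have hd : ∀ {w : Space d → ℂ} {y}, ContDiffAt ℝ 2 w y → DifferentiableAt ℝ w y :=
    fun h => h.differentiableAt (by simp)
  have key : ∀ j, magDeriv A j (magDeriv A j (fun y => f y * u y)) x =
      f x * magDeriv A j (magDeriv A j u) x + 2 * (partialDeriv j f x * magDeriv A j u x)
        + partialDeriv j (partialDeriv j f) x * u x := by
    intro j
    have h1 : magDeriv A j (fun y => f y * u y) =ᶠ[𝓝 x]
        fun y => partialDeriv j f y * u y + f y * magDeriv A j u y := by
      filter_upwards [eventually_contDiffAt_two hf, eventually_contDiffAt_two hu] with y h1 h2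
      exact magDeriv_mul (hd h1) (hd h2) j
    have hpf : DifferentiableAt ℝ (partialDeriv j f) x :=
      (contDiffAt_partialDeriv (m := 1) hf (by norm_num) j).differentiableAt (by simp)
    have hmu : DifferentiableAt ℝ (magDeriv A j u) x :=
      (contDiffAt_magDeriv (m := 1) hA hu (by norm_num) j).differentiableAt (by simp)
    rw [magDeriv_congr h1, magDeriv_add (u := fun y => partialDeriv j f y * u y)
        (v := fun y => f y * magDeriv A j u y) (hpf.mul (hd hu)) ((hd hf).mul hmu),
      magDeriv_mul hpf (hd hu), magDeriv_mul (hd hf) hmu]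
    ring
  simp only [magLaplacian, key, gradInner, laplacian, Finset.sum_add_distrib, Finset.mul_sum,
    Finset.sum_mul]

theorem laplacian_mul (hf : ContDiffAt ℝ 2 f x) (hg : ContDiffAt ℝ 2 g x) :
    laplacian (fun y => f y * g y) x =
      f x * laplacian g x + 2 * gradInner 0 f g x + laplacian f x * g x := by
  rw [← magLaplacian_zero, magLaplacian_mul (A := 0) (contDiffAt_const (c := (0 : Space d))) hf hg, magLaplacian_zero]

theorem gradInner_mul_left (hf : DifferentiableAt ℝ f x) (hg : DifferentiableAt ℝ g x) :
    gradInner A (fun y => f y * g y) u x =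
      f x * gradInner A g u x + g x * gradInner A f u x := by
  simp only [gradInner, partialDeriv_mul hf hg, Finset.mul_sum, ← Finset.sum_add_distrib]
  exact Finset.sum_congr rfl fun j _ => by ring

theorem gradInner_mul_right (hf : DifferentiableAt ℝ f x) (hu : DifferentiableAt ℝ u x) :
    gradInner A g (fun y => f y * u y) x =
      f x * gradInner A g u x + gradInner 0 g f x * u x := by
  simp only [gradInner, magDeriv_mul hf hu, Finset.mul_sum, ← Finset.sum_add_distrib,
    Finset.sum_mul, magDeriv_zero]
  exact Finset.sum_congr rfl fun j _ => by ring

theorem gradInner_zero_comm : gradInner (0 : Space d → Space d) f g x = gradInner 0 g f x := by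
  simp only [gradInner, magDeriv_zero, mul_comm]

theorem partialDeriv_comp {β : ℝ → ℝ} {τ : Space d → ℝ} (hβ : DifferentiableAt ℝ β (τ x))
    (hτ : DifferentiableAt ℝ τ x) (j : Fin d) :
    partialDeriv j (fun y => ((β (τ y) : ℝ) : ℂ)) x =
      ((deriv β (τ x) : ℝ) : ℂ) * partialDeriv j (fun y => (τ y : ℂ)) x := by
  have h1 : HasFDerivAt (fun y => (τ y : ℂ)) (Complex.ofRealCLM.comp (fderiv ℝ τ x)) x :=
    Complex.ofRealCLM.hasFDerivAt.comp x hτ.hasFDerivAt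
  have h2 : HasFDerivAt (fun y => ((β (τ y) : ℝ) : ℂ))
      (Complex.ofRealCLM.comp (deriv β (τ x) • fderiv ℝ τ x)) x :=
    Complex.ofRealCLM.hasFDerivAt.comp x (hβ.hasDerivAt.comp_hasFDerivAt x hτ.hasFDerivAt)
  simp [partialDeriv, h1.fderiv, h2.fderiv]

theorem gradInner_comp {β : ℝ → ℝ} {τ : Space d → ℝ} (hβ : DifferentiableAt ℝ β (τ x))
    (hτ : DifferentiableAt ℝ τ x) :
    gradInner A (fun y => ((β (τ y) : ℝ) : ℂ)) u x =
      ((deriv β (τ x) : ℝ) : ℂ) * gradInner A (fun y => (τ y : ℂ)) u x := by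
  simp only [gradInner, partialDeriv_comp hβ hτ, Finset.mul_sum, mul_assoc]

theorem contDiffAt_ofReal {τ : Space d → ℝ} {n : WithTop ℕ∞} (hτ : ContDiffAt ℝ n τ x) :
    ContDiffAt ℝ n (fun y => (τ y : ℂ)) x :=
  Complex.ofRealCLM.contDiff.contDiffAt.comp x hτ

theorem laplacian_comp {β : ℝ → ℝ} {τ : Space d → ℝ} (hβ : ContDiffAt ℝ 2 β (τ x))
    (hτ : ContDiffAt ℝ 2 τ x) :
    laplacian (fun y => ((β (τ y) : ℝ) : ℂ)) x =
      ((deriv (deriv β) (τ x) : ℝ) : ℂ) * gradInner 0 (fun y => (τ y : ℂ)) (fun y => (τ y : ℂ)) x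
        + ((deriv β (τ x) : ℝ) : ℂ) * laplacian (fun y => (τ y : ℂ)) x := by
  have hβ' : ContDiffAt ℝ 1 (deriv β) (τ x) := by
    have := (hβ.fderiv_right (m := 1) (by norm_num)).clm_apply (contDiffAt_const (c := (1 : ℝ)))
    exact this
  have key : ∀ j, partialDeriv j (partialDeriv j (fun y => ((β (τ y) : ℝ) : ℂ))) x =
      ((deriv (deriv β) (τ x) : ℝ) : ℂ) * (partialDeriv j (fun y => (τ y : ℂ)) x *
        partialDeriv j (fun y => (τ y : ℂ)) x)
        + ((deriv β (τ x) : ℝ) : ℂ) * partialDeriv j (partialDeriv j (fun y => (τ y : ℂ))) x := by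
    intro j
    have h1 : partialDeriv j (fun y => ((β (τ y) : ℝ) : ℂ)) =ᶠ[𝓝 x]
        fun y => ((deriv β (τ y) : ℝ) : ℂ) * partialDeriv j (fun y => (τ y : ℂ)) y := by
      filter_upwards [hτ.eventually (by simp),
        hτ.continuousAt.eventually (hβ.eventually (by simp))] with y h1 h2
      exact partialDeriv_comp (h2.differentiableAt (by simp)) (h1.differentiableAt (by simp)) j
    have hb := hβ'.differentiableAt (by simp)
    have ht := hτ.differentiableAt (by simp)
    have h3 : DifferentiableAt ℝ (fun y => ((deriv β (τ y) : ℝ) : ℂ)) x :=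
      Complex.ofRealCLM.differentiableAt.comp x (hb.comp x ht)
    have h4 : DifferentiableAt ℝ (partialDeriv j (fun y => (τ y : ℂ))) x :=
      (contDiffAt_partialDeriv (m := 1) (contDiffAt_ofReal hτ) (by norm_num) j).differentiableAt
        (by simp)
    rw [partialDeriv_congr h1, partialDeriv_mul h3 h4, partialDeriv_comp hb ht]
    ring
  simp only [laplacian, key, gradInner, Finset.sum_add_distrib, Finset.mul_sum, magDeriv_zero]

end Calculus

end AharonovBohm

namespace AharonovBohm

open MeasureTheory Filter Topology

/-! ### Derivatives of linear forms, |x|² and the squared distance to the axis -/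

section Coordinates

variable {d : ℕ}

/-- The index of the coordinate `x_{d-1}`. -/
def idxP (hd : 2 ≤ d) : Fin d := ⟨d - 2, by omega⟩

/-- The index of the coordinate `x_d`. -/
def idxQ (hd : 2 ≤ d) : Fin d := ⟨d - 1, by omega⟩

theorem idxP_ne_idxQ (hd : 2 ≤ d) : idxP hd ≠ idxQ hd := by
  simp only [idxP, idxQ, ne_eq, Fin.mk.injEq]; omega

/-- The square of the distance to the singular axis. -/
def axisSq (hd : 2 ≤ d) (x : Space d) : ℝ := x (idxP hd) ^ 2 + x (idxQ hd) ^ 2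

/-- The complex coordinate in the plane orthogonal to the singular axis. -/
noncomputable def planeCoord (hd : 2 ≤ d) (x : Space d) : ℂ :=
  (x (idxP hd) : ℂ) + Complex.I * (x (idxQ hd) : ℂ)

/-- The complement of the singular axis. -/
def offAxis (hd : 2 ≤ d) : Set (Space d) := {x | axisSq hd x ≠ 0}

/-- A linear form. -/
def linForm (c : Fin d → ℝ) (x : Space d) : ℝ := ∑ l, c l * x l

theorem axisSq_nonneg (hd : 2 ≤ d) (x : Space d) : 0 ≤ axisSq hd x := by
  unfold axisSq; positivity

theorem axisSq_pos {hd : 2 ≤ d} {x : Space d} (hx : x ∈ offAxis hd) : 0 < axisSq hd x :=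
  lt_of_le_of_ne (axisSq_nonneg hd x) (Ne.symm hx)

theorem normSq_planeCoord (hd : 2 ≤ d) (x : Space d) :
    Complex.normSq (planeCoord hd x) = axisSq hd x := by
  simp [planeCoord, axisSq, Complex.normSq_apply]; ring

theorem norm_planeCoord_sq (hd : 2 ≤ d) (x : Space d) : ‖planeCoord hd x‖ ^ 2 = axisSq hd x := by
  rw [← normSq_planeCoord, Complex.normSq_eq_norm_sq]

theorem planeCoord_ne_zero {hd : 2 ≤ d} {x : Space d} (hx : x ∈ offAxis hd) :
    planeCoord hd x ≠ 0 := by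
  intro h; apply hx; rw [← normSq_planeCoord, h]; simp

theorem contDiff_coord (j : Fin d) {n : WithTop ℕ∞} : ContDiff ℝ n (fun x : Space d => x j) :=
  contDiff_piLp_apply (p := 2)

theorem contDiff_axisSq (hd : 2 ≤ d) {n : WithTop ℕ∞} : ContDiff ℝ n (axisSq hd) :=
  ((contDiff_coord _).pow 2).add ((contDiff_coord _).pow 2)

theorem contDiff_ofReal_coord (j : Fin d) {n : WithTop ℕ∞} :
    ContDiff ℝ n (fun x : Space d => (x j : ℂ)) :=
  Complex.ofRealCLM.contDiff.comp (contDiff_coord j)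

theorem contDiff_planeCoord (hd : 2 ≤ d) {n : WithTop ℕ∞} : ContDiff ℝ n (planeCoord hd) :=
  (contDiff_ofReal_coord _).add (contDiff_const.mul (contDiff_ofReal_coord _))

theorem contDiff_linForm (c : Fin d → ℝ) {n : WithTop ℕ∞} : ContDiff ℝ n (linForm c) :=
  ContDiff.sum fun l _ => contDiff_const.mul (contDiff_coord l)

theorem isOpen_offAxis (hd : 2 ≤ d) : IsOpen (offAxis hd) :=
  isOpen_ne_fun (contDiff_axisSq hd (n := 0)).continuous continuous_const

theorem sum_eq_add_of_axis (hd : 2 ≤ d) {F : Fin d → ℂ}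
    (h : ∀ j, j ≠ idxP hd → j ≠ idxQ hd → F j = 0) : ∑ j, F j = F (idxP hd) + F (idxQ hd) :=
  Finset.sum_eq_add_of_mem _ _ (Finset.mem_univ _) (Finset.mem_univ _) (idxP_ne_idxQ hd)
    fun j _ hj => h j hj.1 hj.2

theorem partialDeriv_coord (j k : Fin d) (x : Space d) :
    partialDeriv j (fun y : Space d => (y k : ℂ)) x = if j = k then 1 else 0 := by
  have h : HasFDerivAt (fun y : Space d => (y k : ℂ))
      (Complex.ofRealCLM.comp (EuclideanSpace.proj k : Space d →L[ℝ] ℝ)) x :=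
    (Complex.ofRealCLM.comp (EuclideanSpace.proj k : Space d →L[ℝ] ℝ)).hasFDerivAt
  simp only [partialDeriv, h.fderiv]
  simp [eq_comm]
  split_ifs <;> simp

theorem partialDeriv_const (j : Fin d) (c : ℂ) (x : Space d) :
    partialDeriv j (fun _ => c) x = 0 := by
  simp [partialDeriv]

theorem partialDeriv_sum {ι : Type*} (s : Finset ι) {F : ι → Space d → ℂ} {x : Space d}
    (h : ∀ i ∈ s, DifferentiableAt ℝ (F i) x) (j : Fin d) :
    partialDeriv j (fun y => ∑ i ∈ s, F i y) x = ∑ i ∈ s, partialDeriv j (F i) x := by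
  simp only [partialDeriv]
  rw [fderiv_fun_sum h]; simp

theorem partialDeriv_const_mul (j : Fin d) (c : ℂ) {f : Space d → ℂ} {x : Space d}
    (hf : DifferentiableAt ℝ f x) :
    partialDeriv j (fun y => c * f y) x = c * partialDeriv j f x := by
  rw [partialDeriv_mul (differentiableAt_const c) hf, partialDeriv_const]; simp

theorem differentiableAt_coord (k : Fin d) (x : Space d) :
    DifferentiableAt ℝ (fun y : Space d => (y k : ℂ)) x :=
  (contDiff_ofReal_coord k (n := 1)).differentiable (by simp) x

theorem partialDeriv_coord_sq (j k : Fin d) (x : Space d) :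
    partialDeriv j (fun y : Space d => (y k : ℂ) ^ 2) x = if j = k then 2 * (x k : ℂ) else 0 := by
  simp only [sq]
  rw [partialDeriv_mul (differentiableAt_coord k x) (differentiableAt_coord k x),
    partialDeriv_coord]
  split_ifs <;> ring

theorem partialDeriv_linForm (c : Fin d → ℝ) (j : Fin d) :
    partialDeriv j (fun y => (linForm c y : ℂ)) = fun _ => (c j : ℂ) := by
  ext x
  simp only [linForm, Complex.ofReal_sum, Complex.ofReal_mul]
  rw [partialDeriv_sum _ fun i _ => (differentiableAt_coord i x).const_mul _]
  simp [partialDeriv_const_mul _ _ (differentiableAt_coord _ x), partialDeriv_coord]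

theorem partialDeriv_normSq (j : Fin d) :
    partialDeriv j (fun y : Space d => ((‖y‖ ^ 2 : ℝ) : ℂ)) = fun x => 2 * (x j : ℂ) := by
  ext x
  simp only [EuclideanSpace.real_norm_sq_eq, Complex.ofReal_sum, Complex.ofReal_pow]
  rw [partialDeriv_sum _ fun i _ => (differentiableAt_coord i x).fun_pow 2]
  simp [partialDeriv_coord_sq]

theorem partialDeriv_axisSq (hd : 2 ≤ d) (j : Fin d) :
    partialDeriv j (fun y => (axisSq hd y : ℂ)) =
      fun x => if j = idxP hd ∨ j = idxQ hd then 2 * (x j : ℂ) else 0 := by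
  ext x
  have h : (fun y : Space d => (axisSq hd y : ℂ)) = fun y : Space d =>
      ∑ k ∈ {idxP hd, idxQ hd}, (y k : ℂ) ^ 2 := by
    ext y; rw [Finset.sum_pair (idxP_ne_idxQ hd)]; simp [axisSq]
  rw [h, partialDeriv_sum _ fun i _ => (differentiableAt_coord i x).fun_pow 2]
  simp [partialDeriv_coord_sq]

theorem laplacian_linForm (c : Fin d → ℝ) (x : Space d) :
    laplacian (fun y => (linForm c y : ℂ)) x = 0 := by
  simp [laplacian, partialDeriv_linForm, partialDeriv_const]

theorem laplacian_normSq (x : Space d) :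
    laplacian (fun y : Space d => ((‖y‖ ^ 2 : ℝ) : ℂ)) x = 2 * d := by
  simp only [laplacian, partialDeriv_normSq,
    partialDeriv_const_mul _ _ (differentiableAt_coord _ x), partialDeriv_coord]
  simp [mul_comm]

theorem laplacian_axisSq (hd : 2 ≤ d) (x : Space d) :
    laplacian (fun y => (axisSq hd y : ℂ)) x = 4 := by
  simp only [laplacian, partialDeriv_axisSq]
  rw [sum_eq_add_of_axis hd]
  · simp [partialDeriv_const_mul _ _ (differentiableAt_coord _ x), partialDeriv_coord]; norm_num
  · intro j h1 h2; simp [h1, h2, partialDeriv_const]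

theorem gradInner_linForm_linForm (c : Fin d → ℝ) (x : Space d) :
    gradInner 0 (fun y => (linForm c y : ℂ)) (fun y => (linForm c y : ℂ)) x =
      ((∑ l, c l ^ 2 : ℝ) : ℂ) := by
  simp [gradInner, magDeriv_zero, partialDeriv_linForm, sq]

theorem gradInner_linForm_normSq (c : Fin d → ℝ) (x : Space d) :
    gradInner 0 (fun y => (linForm c y : ℂ)) (fun y => ((‖y‖ ^ 2 : ℝ) : ℂ)) x =
      2 * (linForm c x : ℂ) := by
  simp only [gradInner, magDeriv_zero, partialDeriv_linForm, partialDeriv_normSq]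
  simp only [linForm, Complex.ofReal_sum, Finset.mul_sum]
  exact Finset.sum_congr rfl fun j _ => by push_cast; ring

theorem gradInner_linForm_axisSq (hd : 2 ≤ d) {c : Fin d → ℝ} (hP : c (idxP hd) = 0)
    (hQ : c (idxQ hd) = 0) (x : Space d) :
    gradInner 0 (fun y => (linForm c y : ℂ)) (fun y => (axisSq hd y : ℂ)) x = 0 := by
  simp only [gradInner, magDeriv_zero, partialDeriv_linForm, partialDeriv_axisSq]
  rw [sum_eq_add_of_axis hd]
  · simp [hP, hQ]
  · intro j h1 h2; simp [h1, h2]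

theorem gradInner_normSq_normSq (x : Space d) :
    gradInner 0 (fun y => ((‖y‖ ^ 2 : ℝ) : ℂ)) (fun y => ((‖y‖ ^ 2 : ℝ) : ℂ)) x =
      4 * ((‖x‖ ^ 2 : ℝ) : ℂ) := by
  simp only [gradInner, magDeriv_zero, partialDeriv_normSq]
  simp only [EuclideanSpace.real_norm_sq_eq, Complex.ofReal_sum, Finset.mul_sum]
  exact Finset.sum_congr rfl fun j _ => by push_cast; ring

theorem gradInner_axisSq_axisSq (hd : 2 ≤ d) (x : Space d) :
    gradInner 0 (fun y => (axisSq hd y : ℂ)) (fun y => (axisSq hd y : ℂ)) x =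
      4 * (axisSq hd x : ℂ) := by
  simp only [gradInner, magDeriv_zero, partialDeriv_axisSq]
  rw [sum_eq_add_of_axis hd]
  · simp [axisSq]; ring
  · intro j h1 h2; simp [h1, h2]

theorem gradInner_axisSq_normSq (hd : 2 ≤ d) (x : Space d) :
    gradInner 0 (fun y => (axisSq hd y : ℂ)) (fun y => ((‖y‖ ^ 2 : ℝ) : ℂ)) x =
      4 * (axisSq hd x : ℂ) := by
  simp only [gradInner, magDeriv_zero, partialDeriv_axisSq, partialDeriv_normSq]
  rw [sum_eq_add_of_axis hd]
  · simp [axisSq]; ring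
  · intro j h1 h2; simp [h1, h2]

end Coordinates

/-! ### The A-harmonic functions around the axis -/

section AngularFactor

variable {d : ℕ}

theorem potential_apply (hd : 2 ≤ d) (Ψ : ℝ) (x : Space d) (j : Fin d) :
    potential d hd Ψ x j = if j = idxP hd then Ψ * (-(x (idxQ hd)) / axisSq hd x)
      else if j = idxQ hd then Ψ * (x (idxP hd) / axisSq hd x) else 0 := by
  simp only [potential, axisSq, Fin.ext_iff, idxP, idxQ]

theorem contDiffAt_potential (hd : 2 ≤ d) (Ψ : ℝ) {x : Space d} (hx : x ∈ offAxis hd)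
    {n : WithTop ℕ∞} : ContDiffAt ℝ n (potential d hd Ψ) x := by
  rw [contDiffAt_piLp 2]
  intro j
  simp only [potential_apply]
  have hx' : axisSq hd x ≠ 0 := hx
  split_ifs
  · exact contDiffAt_const.mul
      (((contDiff_coord _).contDiffAt.neg).div (contDiff_axisSq hd).contDiffAt hx')
  · exact contDiffAt_const.mul
      (((contDiff_coord _).contDiffAt).div (contDiff_axisSq hd).contDiffAt hx')
  · exact contDiffAt_const

/-- The function `r^|m - Ψ| e^{imθ}` in polar coordinates `(r, θ)` around the axis. -/
noncomputable def angular (hd : 2 ≤ d) (Ψ : ℝ) (m : ℤ) (x : Space d) : ℂ :=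
  ((axisSq hd x ^ ((|m - Ψ| - m) / 2) : ℝ) : ℂ) * planeCoord hd x ^ m

variable {hd : 2 ≤ d} {Ψ : ℝ} {m : ℤ} {x : Space d}

theorem contDiffAt_planeCoord_zpow (hx : x ∈ offAxis hd) {n : WithTop ℕ∞} :
    ContDiffAt ℝ n (fun y => planeCoord hd y ^ m) x := by
  have h : AnalyticAt ℂ (fun w : ℂ => w ^ m) (planeCoord hd x) :=
    analyticAt_id.zpow (planeCoord_ne_zero hx)
  have h2 : ContDiffAt ℝ n (fun w : ℂ => w ^ m) (planeCoord hd x) :=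
    (h.contDiffAt (n := n)).restrict_scalars ℝ
  exact h2.comp x (contDiff_planeCoord hd).contDiffAt

theorem contDiffAt_axisSq_rpow (hx : x ∈ offAxis hd) (s : ℝ) {n : WithTop ℕ∞} :
    ContDiffAt ℝ n (fun y => axisSq hd y ^ s) x :=
  (contDiff_axisSq hd).contDiffAt.rpow_const_of_ne hx

theorem contDiffAt_angular (hx : x ∈ offAxis hd) {n : WithTop ℕ∞} :
    ContDiffAt ℝ n (angular hd Ψ m) x :=
  (contDiffAt_ofReal (contDiffAt_axisSq_rpow hx _)).mul (contDiffAt_planeCoord_zpow hx)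

theorem norm_angular (hx : x ∈ offAxis hd) :
    ‖angular hd Ψ m x‖ = axisSq hd x ^ (|m - Ψ| / 2) := by
  have hp := axisSq_pos hx
  have h1 : ‖planeCoord hd x‖ = axisSq hd x ^ (1 / 2 : ℝ) := by
    rw [← Real.sqrt_eq_rpow, ← norm_planeCoord_sq, Real.sqrt_sq (norm_nonneg _)]
  rw [angular, norm_mul, norm_zpow, h1, Complex.norm_real, Real.norm_of_nonneg (by positivity),
    ← Real.rpow_intCast, ← Real.rpow_mul hp.le, ← Real.rpow_add hp]
  congr 1; ring

theorem partialDeriv_planeCoord (j : Fin d) : partialDeriv j (planeCoord hd) x =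
    if j = idxP hd then 1 else if j = idxQ hd then Complex.I else 0 := by
  have : planeCoord hd = fun y : Space d =>
      (fun y : Space d => (y (idxP hd) : ℂ)) y +
        (fun y : Space d => Complex.I * (y (idxQ hd) : ℂ)) y := rfl
  rw [this, ← magDeriv_zero, magDeriv_add (differentiableAt_coord _ x)
    ((differentiableAt_coord _ x).const_mul _), magDeriv_zero, magDeriv_zero, partialDeriv_coord,
    partialDeriv_const_mul _ _ (differentiableAt_coord _ x), partialDeriv_coord]
  have := idxP_ne_idxQ hd
  split_ifs with h1 h2 h3 <;> simp_all

theorem partialDeriv_planeCoord_zpow (hx : x ∈ offAxis hd) (j : Fin d) :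
    partialDeriv j (fun y => planeCoord hd y ^ m) x =
      m * planeCoord hd x ^ (m - 1) * partialDeriv j (planeCoord hd) x := by
  have h1 : HasDerivAt (fun w : ℂ => w ^ m) (m * planeCoord hd x ^ (m - 1)) (planeCoord hd x) :=
    hasDerivAt_zpow m _ (Or.inl (planeCoord_ne_zero hx))
  have h2 : HasFDerivAt (planeCoord hd) (fderiv ℝ (planeCoord hd) x) x :=
    ((contDiff_planeCoord hd (n := 1)).differentiable (by simp) x).hasFDerivAt
  have h3 := (h1.hasFDerivAt.restrictScalars ℝ).comp x h2
  have h4 : HasFDerivAt (fun y => planeCoord hd y ^ m) _ x := h3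
  simp only [partialDeriv, h4.fderiv]
  simp [mul_comm]

/-- The logarithmic derivative of `angular` with respect to the magnetic derivative. -/
noncomputable def angularLogDeriv (hd : 2 ≤ d) (Ψ : ℝ) (m : ℤ) (j : Fin d) (x : Space d) : ℂ :=
  if j = idxP hd then
    (|m - Ψ| * (x (idxP hd) : ℂ) - Complex.I * (m - Ψ) * (x (idxQ hd) : ℂ)) / axisSq hd x
  else if j = idxQ hd then
    (|m - Ψ| * (x (idxQ hd) : ℂ) + Complex.I * (m - Ψ) * (x (idxP hd) : ℂ)) / axisSq hd x
  else 0

/-- Off the axis A = Ψ∇θ, so the logarithmic gradient of r^ν e^{imθ} is ν∇r/r + i(m - Ψ)∇θ, here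
with ν = |m - Ψ|. -/
theorem magDeriv_angular (hx : x ∈ offAxis hd) (j : Fin d) :
    magDeriv (potential d hd Ψ) j (angular hd Ψ m) x =
      angularLogDeriv hd Ψ m j x * angular hd Ψ m x := by
  have hp := axisSq_pos hx
  have hz := planeCoord_ne_zero hx
  have hρ : (axisSq hd x : ℂ) = (x (idxP hd) : ℂ) ^ 2 + (x (idxQ hd) : ℂ) ^ 2 := by
    simp [axisSq]
  have hρ0 : (axisSq hd x : ℂ) ≠ 0 := by exact_mod_cast hp.ne'
  -- The inverse 1/z = conj z / |z|², in coordinates.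
  have hzz : (planeCoord hd x)⁻¹ =
      ((x (idxP hd) : ℂ) - Complex.I * (x (idxQ hd) : ℂ)) / axisSq hd x := by
    rw [eq_div_iff hρ0, inv_mul_eq_iff_eq_mul₀ hz, hρ, planeCoord]
    linear_combination (x (idxQ hd) : ℂ) ^ 2 * Complex.I_sq
  have hd1 : DifferentiableAt ℝ (fun y => ((axisSq hd y ^ ((|m - Ψ| - m) / 2) : ℝ) : ℂ)) x :=
    (contDiffAt_ofReal (contDiffAt_axisSq_rpow (n := 1) hx _)).differentiableAt (by simp)
  have hd2 : DifferentiableAt ℝ (fun y => planeCoord hd y ^ m) x :=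
    (contDiffAt_planeCoord_zpow (n := 1) hx).differentiableAt (by simp)
  have hq := idxP_ne_idxQ hd
  have hder : deriv (fun t : ℝ => t ^ ((|m - Ψ| - m) / 2)) (axisSq hd x) =
      ((|m - Ψ| - m) / 2) * (axisSq hd x ^ ((|m - Ψ| - m) / 2) / axisSq hd x) := by
    rw [(Real.hasDerivAt_rpow_const (Or.inl hp.ne')).deriv, Real.rpow_sub_one hp.ne']
  have hdr : partialDeriv j (fun y => ((axisSq hd y ^ ((|m - Ψ| - m) / 2) : ℝ) : ℂ)) x =
      (((|m - Ψ| - m) / 2 * (axisSq hd x ^ ((|m - Ψ| - m) / 2) / axisSq hd x) : ℝ) : ℂ) *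
        (if j = idxP hd ∨ j = idxQ hd then 2 * (x j : ℂ) else 0) := by
    rw [partialDeriv_comp (β := fun t => t ^ ((|m - Ψ| - m) / 2)) (τ := axisSq hd)
      (Real.hasDerivAt_rpow_const (Or.inl hp.ne')).differentiableAt
      ((contDiff_axisSq hd (n := 1)).differentiable (by simp) x), hder, partialDeriv_axisSq]
  have : angular hd Ψ m = fun y =>
    ((axisSq hd y ^ ((|m - Ψ| - m) / 2) : ℝ) : ℂ) * planeCoord hd y ^ m := rfl
  rw [magDeriv_eq, this, partialDeriv_mul hd1 hd2, hdr, partialDeriv_planeCoord_zpow hx,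
    partialDeriv_planeCoord, potential_apply, zpow_sub_one₀ hz, hzz, angularLogDeriv]
  by_cases h1 : j = idxP hd
  · subst h1
    simp
    field_simp
    ring
  · by_cases h2 : j = idxQ hd
    · subst h2
      simp [hq.symm]
      field_simp
      set R := ((axisSq hd x ^ ((|m - Ψ| - m) / 2) : ℝ) : ℂ)
      linear_combination (-R * (m : ℂ) * (x (idxQ hd) : ℂ)) * Complex.I_sq
    · simp [h1, h2]

/-- On r^ν e^{imθ} the operator is multiplication by (ν² - (m - Ψ)²)/r². The nonnegative root ν = |m
- Ψ| is the one that keeps the function bounded near the axis. -/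
theorem magLaplacian_angular (hx : x ∈ offAxis hd) :
    magLaplacian (potential d hd Ψ) (angular hd Ψ m) x = 0 := by
  have hp := axisSq_pos hx
  have hρ : (axisSq hd x : ℂ) = (x (idxP hd) : ℂ) ^ 2 + (x (idxQ hd) : ℂ) ^ 2 := by
    simp [axisSq]
  have hρ0 : (axisSq hd x : ℂ) ≠ 0 := by exact_mod_cast hp.ne'
  have hq := idxP_ne_idxQ hd
  have hda : DifferentiableAt ℝ (angular hd Ψ m) x :=
    (contDiffAt_angular (n := 1) hx).differentiableAt (by simp)
  have hinv : DifferentiableAt ℝ (fun y => (((axisSq hd y)⁻¹ : ℝ) : ℂ)) x :=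
    (contDiffAt_ofReal ((contDiff_axisSq hd (n := 1)).contDiffAt.inv hx)).differentiableAt
      (by simp)
  have hpinv : ∀ j, partialDeriv j (fun y => (((axisSq hd y)⁻¹ : ℝ) : ℂ)) x =
      -((axisSq hd x : ℂ) ^ 2)⁻¹ *
        (if j = idxP hd ∨ j = idxQ hd then 2 * (x j : ℂ) else 0) := by
    intro j
    rw [partialDeriv_comp (β := fun t => t⁻¹) (τ := axisSq hd)
      (differentiableAt_inv hp.ne')
      ((contDiff_axisSq hd (n := 1)).differentiable (by simp) x), partialDeriv_axisSq]
    simp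
  have hev : ∀ j, magDeriv (potential d hd Ψ) j (angular hd Ψ m) =ᶠ[𝓝 x]
      fun y => angularLogDeriv hd Ψ m j y * angular hd Ψ m y := by
    intro j
    filter_upwards [(isOpen_offAxis hd).mem_nhds hx] with y hy using magDeriv_angular hy j
  have hP : angularLogDeriv hd Ψ m (idxP hd) = fun y : Space d =>
      (fun y : Space d => |m - Ψ| * (y (idxP hd) : ℂ)
        + (-Complex.I * (m - Ψ)) * (y (idxQ hd) : ℂ)) y *
        (fun y => (((axisSq hd y)⁻¹ : ℝ) : ℂ)) y := by
    ext y; simp [angularLogDeriv]; ring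
  have hQ : angularLogDeriv hd Ψ m (idxQ hd) = fun y : Space d =>
      (fun y : Space d => |m - Ψ| * (y (idxQ hd) : ℂ)
        + (Complex.I * (m - Ψ)) * (y (idxP hd) : ℂ)) y *
        (fun y => (((axisSq hd y)⁻¹ : ℝ) : ℂ)) y := by
    ext y; simp [angularLogDeriv, hq.symm]; ring
  have hlin : ∀ (a b : ℂ) (i k : Fin d), DifferentiableAt ℝ (fun y : Space d =>
      a * (y i : ℂ) + b * (y k : ℂ)) x := fun a b i k =>
    ((differentiableAt_coord i x).const_mul a).add ((differentiableAt_coord k x).const_mul b)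
  have hplin : ∀ (a b : ℂ) (i k j : Fin d), partialDeriv j (fun y : Space d =>
      a * (y i : ℂ) + b * (y k : ℂ)) x = a * (if j = i then 1 else 0)
        + b * (if j = k then 1 else 0) := fun a b i k j => by
    rw [← magDeriv_zero, magDeriv_add ((differentiableAt_coord i x).const_mul a)
      ((differentiableAt_coord k x).const_mul b), magDeriv_zero, magDeriv_zero,
      partialDeriv_const_mul _ _ (differentiableAt_coord _ x),
      partialDeriv_const_mul _ _ (differentiableAt_coord _ x), partialDeriv_coord,
      partialDeriv_coord]
  -- The relation that makes the radial and the angular contributions cancel.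
  have hν : ((|m - Ψ| : ℝ) : ℂ) ^ 2 = (m - Ψ) ^ 2 := by
    have := sq_abs ((m : ℝ) - Ψ)
    exact_mod_cast this
  rw [magLaplacian, sum_eq_add_of_axis hd]
  · rw [magDeriv_congr (hev _), magDeriv_congr (hev _), hP, hQ,
      magDeriv_mul ((hlin _ _ _ _).fun_mul hinv) hda,
      magDeriv_mul ((hlin _ _ _ _).fun_mul hinv) hda,
      magDeriv_angular hx, magDeriv_angular hx,
      partialDeriv_mul (hlin _ _ _ _) hinv, partialDeriv_mul (hlin _ _ _ _) hinv,
      hplin, hplin, hpinv, hpinv, angularLogDeriv, angularLogDeriv]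
    simp only [hq, hq.symm, if_true, if_false, or_true, true_or]
    push_cast
    field_simp
    rw [hρ]
    set a := (x (idxP hd) : ℂ)
    set b := (x (idxQ hd) : ℂ)
    set N := ((|m - Ψ| : ℝ) : ℂ)
    linear_combination (a ^ 2 + b ^ 2) * angular hd Ψ m x * hν +
      ((m - Ψ) ^ 2) * (a ^ 2 + b ^ 2) * angular hd Ψ m x * Complex.I_sq
  · intro j h1 h2
    rw [magDeriv_congr (hev j)]
    have : (fun y => angularLogDeriv hd Ψ m j y * angular hd Ψ m y) = fun _ => 0 := by
      ext y; simp [angularLogDeriv, h1, h2]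
    rw [this]; simp [magDeriv_eq, partialDeriv_const]

end AngularFactor

end AharonovBohm

namespace AharonovBohm

open MeasureTheory Filter Topology

/-! ### The magnetic Laplacian of products of axial, radial and angular factors -/

section SeparatedFunctions

variable {d : ℕ} {hd : 2 ≤ d} {Ψ : ℝ} {m : ℤ} {x : Space d} {c : Fin d → ℝ}

theorem gradInner_linForm_angular (hP : c (idxP hd) = 0) (hQ : c (idxQ hd) = 0)
    (hx : x ∈ offAxis hd) :
    gradInner (potential d hd Ψ) (fun y => (linForm c y : ℂ)) (angular hd Ψ m) x = 0 := by
  simp only [gradInner, magDeriv_angular hx, partialDeriv_linForm]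
  rw [sum_eq_add_of_axis hd]
  · simp [hP, hQ]
  · intro j h1 h2; simp [angularLogDeriv, h1, h2]

/-- Euler's relation for a function of degree |m - Ψ|: the potential is orthogonal to x and drops
out. -/
theorem gradInner_normSq_angular (hx : x ∈ offAxis hd) :
    gradInner (potential d hd Ψ) (fun y => ((‖y‖ ^ 2 : ℝ) : ℂ)) (angular hd Ψ m) x =
      2 * (|m - Ψ| : ℝ) * angular hd Ψ m x := by
  have hρ : (axisSq hd x : ℂ) = (x (idxP hd) : ℂ) ^ 2 + (x (idxQ hd) : ℂ) ^ 2 := by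
    simp [axisSq]
  have hρ0 : (axisSq hd x : ℂ) ≠ 0 := by exact_mod_cast (axisSq_pos hx).ne'
  have hq := idxP_ne_idxQ hd
  simp only [gradInner, magDeriv_angular hx, partialDeriv_normSq]
  rw [sum_eq_add_of_axis hd]
  · simp only [angularLogDeriv, if_true, hq.symm, if_false]
    field_simp
    rw [hρ]; ring
  · intro j h1 h2; simp [angularLogDeriv, h1, h2]

theorem gradInner_axisSq_angular (hx : x ∈ offAxis hd) :
    gradInner (potential d hd Ψ) (fun y => (axisSq hd y : ℂ)) (angular hd Ψ m) x =
      2 * (|m - Ψ| : ℝ) * angular hd Ψ m x := by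
  rw [← gradInner_normSq_angular hx]
  simp only [gradInner, partialDeriv_normSq, partialDeriv_axisSq, magDeriv_angular hx]
  refine Finset.sum_congr rfl fun j _ => ?_
  by_cases h1 : j = idxP hd
  · simp [h1]
  · by_cases h2 : j = idxQ hd
    · simp [h2]
    · simp [angularLogDeriv, h1, h2]

theorem gradInner_comp_comp {β φ : ℝ → ℝ} {τ σ : Space d → ℝ}
    (hβ : DifferentiableAt ℝ β (τ x)) (hτ : DifferentiableAt ℝ τ x)
    (hφ : DifferentiableAt ℝ φ (σ x)) (hσ : DifferentiableAt ℝ σ x) :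
    gradInner 0 (fun y => ((β (τ y) : ℝ) : ℂ)) (fun y => ((φ (σ y) : ℝ) : ℂ)) x =
      ((deriv β (τ x) : ℝ) : ℂ) * (((deriv φ (σ x) : ℝ) : ℂ) *
        gradInner 0 (fun y => (τ y : ℂ)) (fun y => (σ y : ℂ)) x) := by
  rw [gradInner_comp hβ hτ, gradInner_zero_comm, gradInner_comp hφ hσ, gradInner_zero_comm]

/-- The functions `X^k β(ρ) φ(|x|²) r^|m - Ψ| e^{imθ}`, with `X` a linear form and `ρ = r²` the
squared distance to the axis. -/
noncomputable def separated (hd : 2 ≤ d) (Ψ : ℝ) (m : ℤ) (c : Fin d → ℝ) (k : ℕ)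
    (β φ : ℝ → ℝ) (x : Space d) : ℂ :=
  (((linForm c x ^ k : ℝ) : ℂ) * (((β (axisSq hd x) : ℝ) : ℂ) * ((φ (‖x‖ ^ 2) : ℝ) : ℂ))) *
    angular hd Ψ m x

theorem contDiffAt_normSq {n : WithTop ℕ∞} : ContDiffAt ℝ n (fun y : Space d => ‖y‖ ^ 2) x :=
  (contDiff_norm_sq ℝ).contDiffAt

theorem contDiffAt_separated {k : ℕ} {β φ : ℝ → ℝ} {n : WithTop ℕ∞} (hx : x ∈ offAxis hd)
    (hβ : ContDiffAt ℝ n β (axisSq hd x)) (hφ : ContDiffAt ℝ n φ (‖x‖ ^ 2)) :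
    ContDiffAt ℝ n (separated hd Ψ m c k β φ) x :=
  ((contDiffAt_ofReal ((contDiff_linForm c).contDiffAt.pow k)).mul
    ((contDiffAt_ofReal (hβ.comp x (contDiff_axisSq hd).contDiffAt)).mul
      (contDiffAt_ofReal (hφ.comp x contDiffAt_normSq)))).mul (contDiffAt_angular hx)

theorem deriv_deriv_pow (k : ℕ) (t : ℝ) :
    deriv (deriv (fun s : ℝ => s ^ k)) t = k * ((k - 1 : ℕ) * t ^ (k - 1 - 1)) := by
  have : deriv (fun s : ℝ => s ^ k) = fun s : ℝ => (k : ℝ) * s ^ (k - 1) := by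
    ext s; simp
  rw [this]; simp

/-- With X the linear form, ρ = r² and s = |x|², the product rule reduces everything to the table
∇X·∇ρ = 0, ∇X·∇s = 2X, |∇ρ|² = ∇ρ·∇s = 4ρ, |∇s|² = 4s, ΔX = 0, Δρ = 4, Δs = 2d and the derivatives
of the A-harmonic factor. The form X must not involve the two plane coordinates. -/
theorem magLaplacian_separated {k : ℕ} {β φ : ℝ → ℝ} (hP : c (idxP hd) = 0)
    (hQ : c (idxQ hd) = 0) (hx : x ∈ offAxis hd)
    (hβ : ContDiffAt ℝ 2 β (axisSq hd x)) (hφ : ContDiffAt ℝ 2 φ (‖x‖ ^ 2)) :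
    magLaplacian (potential d hd Ψ) (separated hd Ψ m c k β φ) x =
      ((k * (k - 1 : ℕ) * (∑ l, c l ^ 2) * linForm c x ^ (k - 1 - 1) * β (axisSq hd x) *
            φ (‖x‖ ^ 2)
        + linForm c x ^ k * φ (‖x‖ ^ 2) *
          (4 * axisSq hd x * deriv (deriv β) (axisSq hd x)
            + 4 * (1 + |m - Ψ|) * deriv β (axisSq hd x))
        + linForm c x ^ k * β (axisSq hd x) *
          (4 * ‖x‖ ^ 2 * deriv (deriv φ) (‖x‖ ^ 2)
            + (2 * d + 4 * k + 4 * |m - Ψ|) * deriv φ (‖x‖ ^ 2))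
        + 8 * axisSq hd x * deriv β (axisSq hd x) * deriv φ (‖x‖ ^ 2) * linForm c x ^ k : ℝ) : ℂ) *
      angular hd Ψ m x := by
  have hX : ContDiffAt ℝ 2 (linForm c) x := (contDiff_linForm c).contDiffAt
  have hρ : ContDiffAt ℝ 2 (axisSq hd) x := (contDiff_axisSq hd).contDiffAt
  have hs : ContDiffAt ℝ 2 (fun y : Space d => ‖y‖ ^ 2) x := contDiffAt_normSq
  have hk : ContDiffAt ℝ 2 (fun t : ℝ => t ^ k) (linForm c x) := contDiffAt_id.pow k
  have D : ∀ {g : ℝ → ℝ} {y}, ContDiffAt ℝ 2 g y → DifferentiableAt ℝ g y :=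
    fun h => h.differentiableAt (by simp)
  have D' : ∀ {g : Space d → ℝ} {y}, ContDiffAt ℝ 2 g y → DifferentiableAt ℝ g y :=
    fun h => h.differentiableAt (by simp)
  have D'' : ∀ {g : Space d → ℂ} {y}, ContDiffAt ℝ 2 g y → DifferentiableAt ℝ g y :=
    fun h => h.differentiableAt (by simp)
  have C1 : ContDiffAt ℝ 2 (fun y => ((linForm c y ^ k : ℝ) : ℂ)) x :=
    contDiffAt_ofReal (hX.pow k)
  have C2 : ContDiffAt ℝ 2 (fun y => ((β (axisSq hd y) : ℝ) : ℂ)) x :=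
    contDiffAt_ofReal (hβ.comp x hρ)
  have C3 : ContDiffAt ℝ 2 (fun y : Space d => ((φ (‖y‖ ^ 2) : ℝ) : ℂ)) x :=
    contDiffAt_ofReal (hφ.comp x hs)
  have C23 := C2.mul C3
  have hsep : separated hd Ψ m c k β φ = fun y =>
    (fun y => ((linForm c y ^ k : ℝ) : ℂ) *
      (fun y => ((β (axisSq hd y) : ℝ) : ℂ) * ((φ (‖y‖ ^ 2) : ℝ) : ℂ)) y) y *
      angular hd Ψ m y := rfl
  have e1 : ∀ {A : Space d → Space d} {u : Space d → ℂ},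
      gradInner A (fun y => ((linForm c y ^ k : ℝ) : ℂ)) u x =
      ((deriv (fun t : ℝ => t ^ k) (linForm c x) : ℝ) : ℂ) *
        gradInner A (fun y => (linForm c y : ℂ)) u x := fun {A u} =>
    gradInner_comp (β := fun t => t ^ k) (D hk) (D' hX)
  have e2 : laplacian (fun y => ((linForm c y ^ k : ℝ) : ℂ)) x = _ :=
    laplacian_comp (β := fun t => t ^ k) hk hX
  have e3 : gradInner 0 (fun y => ((linForm c y ^ k : ℝ) : ℂ))
      (fun y => ((φ (‖y‖ ^ 2) : ℝ) : ℂ)) x = _ :=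
    gradInner_comp_comp (β := fun t => t ^ k) (σ := fun y => ‖y‖ ^ 2) (D hk) (D' hX) (D hφ) (D' hs)
  have e4 : gradInner 0 (fun y => ((linForm c y ^ k : ℝ) : ℂ))
      (fun y => ((β (axisSq hd y) : ℝ) : ℂ)) x = _ :=
    gradInner_comp_comp (β := fun t => t ^ k) (D hk) (D' hX) (D hβ) (D' hρ)
  have e5 : gradInner 0 (fun y => ((β (axisSq hd y) : ℝ) : ℂ))
      (fun y => ((φ (‖y‖ ^ 2) : ℝ) : ℂ)) x = _ :=
    gradInner_comp_comp (σ := fun y => ‖y‖ ^ 2) (D hβ) (D' hρ) (D hφ) (D' hs)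
  have e6 : laplacian (fun y => ((β (axisSq hd y) : ℝ) : ℂ)) x = _ := laplacian_comp hβ hρ
  have e7 : laplacian (fun y : Space d => ((φ (‖y‖ ^ 2) : ℝ) : ℂ)) x = _ :=
    laplacian_comp (τ := fun y => ‖y‖ ^ 2) hφ hs
  have e8 : gradInner (potential d hd Ψ) (fun y => ((β (axisSq hd y) : ℝ) : ℂ))
      (angular hd Ψ m) x = _ := gradInner_comp (D hβ) (D' hρ)
  have e9 : gradInner (potential d hd Ψ) (fun y => ((φ (‖y‖ ^ 2) : ℝ) : ℂ))
      (angular hd Ψ m) x = _ := gradInner_comp (τ := fun y => ‖y‖ ^ 2) (D hφ) (D' hs)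
  -- Euler's relation for X^k, also valid for k = 0 where the exponent k - 1 is truncated.
  have k1 : deriv (fun t : ℝ => t ^ k) (linForm c x) * linForm c x = k * linForm c x ^ k := by
    have : deriv (fun t : ℝ => t ^ k) (linForm c x) = k * linForm c x ^ (k - 1) := by simp
    rw [this]
    rcases k with _ | k
    · simp
    · rw [Nat.add_sub_cancel]; ring
  have k1' : ((deriv (fun t : ℝ => t ^ k) (linForm c x) : ℝ) : ℂ) * (linForm c x : ℂ) =
      k * (linForm c x : ℂ) ^ k := by exact_mod_cast k1
  rw [hsep, magLaplacian_mul (contDiffAt_potential hd Ψ hx) (C1.mul C23) (contDiffAt_angular hx),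
    magLaplacian_angular hx, laplacian_mul C1 C23, laplacian_mul C2 C3,
    gradInner_mul_left (D'' C1) (D'' C23), gradInner_mul_left (D'' C2) (D'' C3),
    gradInner_mul_right (D'' C2) (D'' C3), e1, e2, e3, e4, e5, e6, e7, e8, e9,
    gradInner_linForm_angular hP hQ hx, gradInner_normSq_angular hx, gradInner_axisSq_angular hx,
    laplacian_linForm, laplacian_normSq, laplacian_axisSq, gradInner_linForm_linForm,
    gradInner_linForm_normSq, gradInner_linForm_axisSq hd hP hQ, gradInner_normSq_normSq,
    gradInner_axisSq_axisSq, gradInner_axisSq_normSq, deriv_deriv_pow]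
  push_cast
  linear_combination (4 * (β (axisSq hd x) : ℂ) * ((deriv φ (‖x‖ ^ 2) : ℝ) : ℂ) *
    angular hd Ψ m x) * k1'

end SeparatedFunctions

end AharonovBohm

namespace AharonovBohm

open MeasureTheory Filter Topology

/-! ### Green's formula away from the axis -/

section Green

open scoped ComplexConjugate

variable {d : ℕ} {A : Space d → Space d} {U : Set (Space d)} {u Φ : Space d → ℂ} {x : Space d}

theorem partialDeriv_conj (j : Fin d) (hu : DifferentiableAt ℝ u x) :
    partialDeriv j (fun y => conj (u y)) x = conj (partialDeriv j u x) := by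
  have h := (Complex.conjCLE.toContinuousLinearMap.hasFDerivAt (x := u x)).comp x hu.hasFDerivAt
  have h' : HasFDerivAt (fun y => conj (u y)) _ x := h
  simp [partialDeriv, h'.fderiv]

theorem integral_partialDeriv_eq_zero (hu : ContDiff ℝ 1 u) (hc : HasCompactSupport u)
    (j : Fin d) : ∫ x, partialDeriv j u x = 0 := by
  have h := integral_mul_fderiv_eq_neg_fderiv_mul_of_integrable (μ := volume)
    (f := fun _ : Space d => (1 : ℂ)) (g := u) (v := EuclideanSpace.single j (1 : ℝ))
    (by simp) ?_ ?_ (fun x _ => by fun_prop)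
    (fun x _ => hu.differentiable (by simp) x)
  · simpa [partialDeriv] using h
  · simp only [one_mul]
    exact ((hu.continuous_fderiv (by simp)).clm_apply continuous_const).integrable_of_hasCompactSupport
      (hc.fderiv_apply (𝕜 := ℝ) _)
  · simpa using hu.continuous.integrable_of_hasCompactSupport hc

theorem partialDeriv_eq_zero_of_notMem (hx : x ∉ tsupport u) (j : Fin d) :
    partialDeriv j u x = 0 := by
  rw [partialDeriv_congr (notMem_tsupport_iff_eventuallyEq.1 hx)]
  simp [partialDeriv]

theorem magDeriv_eq_zero_of_notMem (hx : x ∉ tsupport u) (j : Fin d) : magDeriv A j u x = 0 := by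
  rw [magDeriv_eq, partialDeriv_eq_zero_of_notMem hx, image_eq_zero_of_notMem_tsupport hx]; simp

theorem tsupport_magDeriv_subset (j : Fin d) : tsupport (magDeriv A j u) ⊆ tsupport u :=
  closure_minimal (fun x hx => by
    by_contra h; exact hx (magDeriv_eq_zero_of_notMem h j)) (isClosed_tsupport u)

theorem magLaplacian_eq_zero_of_notMem (hx : x ∉ tsupport u) : magLaplacian A u x = 0 :=
  Finset.sum_eq_zero fun j _ =>
    magDeriv_eq_zero_of_notMem (fun h => hx (tsupport_magDeriv_subset j h)) j

theorem contDiffAt_magLaplacian {m n : WithTop ℕ∞} (hA : ContDiffAt ℝ (n + 1) A x)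
    (hu : ContDiffAt ℝ m u x) (h : n + 1 + 1 ≤ m) : ContDiffAt ℝ n (magLaplacian A u) x :=
  ContDiffAt.sum fun j _ => contDiffAt_magDeriv (hA.of_le le_self_add)
    (contDiffAt_magDeriv hA hu h j) le_rfl j

/-- For real A the difference of the integrands is the divergence of the field with components
(∂_j^A u) conj Φ - u conj(∂_j^A Φ), which is C¹ with compact support. Regularity is needed only on
U, because everything vanishes near the points outside the support of Φ. -/
theorem integral_magLaplacian_mul_conj (hA : ∀ x ∈ U, ContDiffAt ℝ 1 A x)
    (hu : ∀ x ∈ U, ContDiffAt ℝ 2 u x) (hΦ : ∀ x ∈ U, ContDiffAt ℝ 2 Φ x)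
    (hc : HasCompactSupport Φ) (hs : tsupport Φ ⊆ U) :
    ∫ x, magLaplacian A u x * conj (Φ x) = ∫ x, u x * conj (magLaplacian A Φ x) := by
  have hcases : ∀ x, x ∈ U ∨ x ∉ tsupport Φ := fun x => by
    by_cases h : x ∈ tsupport Φ
    · exact Or.inl (hs h)
    · exact Or.inr h
  have conjC : ∀ {n : WithTop ℕ∞} {f : Space d → ℂ} {x}, ContDiffAt ℝ n f x →
      ContDiffAt ℝ n (fun y => conj (f y)) x := fun h =>
    Complex.conjCLE.toContinuousLinearMap.contDiff.contDiffAt.comp _ h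
  have D : ∀ {f : Space d → ℂ} {x}, ContDiffAt ℝ 1 f x → DifferentiableAt ℝ f x :=
    fun h => h.differentiableAt (by simp)
  set F : Fin d → Space d → ℂ := fun j y =>
    magDeriv A j u y * conj (Φ y) - u y * conj (magDeriv A j Φ y) with hF
  have hF0 : ∀ j x, x ∉ tsupport Φ → F j =ᶠ[𝓝 x] 0 := by
    intro j x hx
    filter_upwards [(isClosed_tsupport Φ).isOpen_compl.mem_nhds hx] with y hy
    simp [hF, image_eq_zero_of_notMem_tsupport hy, magDeriv_eq_zero_of_notMem hy]
  have hFC : ∀ j, ContDiff ℝ 1 (F j) := by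
    intro j
    rw [contDiff_iff_contDiffAt]
    intro x
    rcases hcases x with hx | hx
    · have h1 := contDiffAt_magDeriv (m := 1) (hA x hx) (hu x hx) (by norm_num) j
      have h2 := contDiffAt_magDeriv (m := 1) (hA x hx) (hΦ x hx) (by norm_num) j
      exact (h1.mul (conjC ((hΦ x hx).of_le (by norm_num)))).sub
        (((hu x hx).of_le (by norm_num)).mul (conjC h2))
    · exact (contDiffAt_const (c := (0 : ℂ))).congr_of_eventuallyEq (hF0 j x hx)
  have hFs : ∀ j, HasCompactSupport (F j) := fun j =>
    HasCompactSupport.intro hc fun x hx => (hF0 j x hx).eq_of_nhds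
  have hFd : ∀ j x, partialDeriv j (F j) x =
      magDeriv A j (magDeriv A j u) x * conj (Φ x) -
        u x * conj (magDeriv A j (magDeriv A j Φ) x) := by
    intro j x
    rcases hcases x with hx | hx
    · have h1 := D (contDiffAt_magDeriv (m := 1) (hA x hx) (hu x hx) (by norm_num) j)
      have h2 := D (contDiffAt_magDeriv (m := 1) (hA x hx) (hΦ x hx) (by norm_num) j)
      have h3 := D ((hu x hx).of_le (by norm_num))
      have h4 := D ((hΦ x hx).of_le (by norm_num))
      have c2 : DifferentiableAt ℝ (fun y => conj (magDeriv A j Φ y)) x :=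
        D (conjC (contDiffAt_magDeriv (m := 1) (hA x hx) (hΦ x hx) (by norm_num) j))
      have c4 : DifferentiableAt ℝ (fun y => conj (Φ y)) x :=
        D (conjC ((hΦ x hx).of_le (by norm_num)))
      have e : F j = fun y => magDeriv A j u y * conj (Φ y) +
          (fun y => (-1) * (u y * conj (magDeriv A j Φ y))) y := by
        ext y; simp [hF]; ring
      rw [e, ← magDeriv_zero, magDeriv_add (u := fun y => magDeriv A j u y * conj (Φ y))
        (h1.fun_mul c4) ((h3.fun_mul c2).const_mul _), magDeriv_zero, magDeriv_zero,
        partialDeriv_const_mul _ _ (h3.fun_mul c2), partialDeriv_mul h1 c4, partialDeriv_mul h3 c2,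
        partialDeriv_conj _ h2, partialDeriv_conj _ h4]
      simp only [magDeriv_eq (u := magDeriv A j u), magDeriv_eq (u := magDeriv A j Φ)]
      simp only [map_sub, map_mul, Complex.conj_I, Complex.conj_ofReal]
      simp only [magDeriv_eq (u := u), magDeriv_eq (u := Φ)]
      simp only [map_sub, map_mul, Complex.conj_I, Complex.conj_ofReal]
      ring
    · rw [partialDeriv_congr (hF0 j x hx), image_eq_zero_of_notMem_tsupport hx,
        magDeriv_eq_zero_of_notMem fun h => hx (tsupport_magDeriv_subset j h)]
      simp [partialDeriv]
  have key : ∫ x, (magLaplacian A u x * conj (Φ x) - u x * conj (magLaplacian A Φ x)) = 0 := by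
    have : (fun x => magLaplacian A u x * conj (Φ x) - u x * conj (magLaplacian A Φ x)) =
        fun x => ∑ j, partialDeriv j (F j) x := by
      ext x
      simp only [hFd, magLaplacian, map_sum, Finset.sum_mul, Finset.mul_sum,
        Finset.sum_sub_distrib]
    rw [this, integral_finsetSum]
    · exact Finset.sum_eq_zero fun j _ => integral_partialDeriv_eq_zero (hFC j) (hFs j) j
    · intro j _
      exact (((hFC j).continuous_fderiv (by simp)).clm_apply
        continuous_const).integrable_of_hasCompactSupport ((hFs j).fderiv_apply (𝕜 := ℝ) _)
  have cont0 : ∀ {f : Space d → ℂ}, (∀ x ∈ U, ContinuousAt f x) →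
      (∀ x, x ∉ tsupport Φ → f =ᶠ[𝓝 x] 0) → Integrable f := by
    intro f h1 h2
    refine Continuous.integrable_of_hasCompactSupport ?_
      (HasCompactSupport.intro hc fun x hx => (h2 x hx).eq_of_nhds)
    rw [continuous_iff_continuousAt]
    intro x
    rcases hcases x with hx | hx
    · exact h1 x hx
    · exact (continuousAt_const (y := (0 : ℂ))).congr (h2 x hx).symm
  have cL : ∀ {w : Space d → ℂ}, ∀ x ∈ U, ContDiffAt ℝ 2 w x →
      ContinuousAt (magLaplacian A w) x := fun x hx h =>
    (contDiffAt_magLaplacian (n := 0) (by simpa using hA x hx) h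
      (by norm_num)).continuousAt
  rw [integral_sub] at key
  · exact sub_eq_zero.1 key
  · refine cont0 (fun x hx => (cL x hx (hu x hx)).mul
      (Complex.continuous_conj.continuousAt.comp (hΦ x hx).continuousAt)) fun x hx => ?_
    filter_upwards [(isClosed_tsupport Φ).isOpen_compl.mem_nhds hx] with y hy
    simp [image_eq_zero_of_notMem_tsupport hy]
  · refine cont0 (fun x hx => (hu x hx).continuousAt.mul
      (Complex.continuous_conj.continuousAt.comp (cL x hx (hΦ x hx)))) fun x hx => ?_
    filter_upwards [(isClosed_tsupport Φ).isOpen_compl.mem_nhds hx] with y hy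
    simp [magLaplacian_eq_zero_of_notMem hy]

end Green

end AharonovBohm

namespace AharonovBohm

open MeasureTheory Filter Topology

/-! ### The axis is a null set; an integrable majorant near it -/

section NearAxis

variable {d : ℕ}

theorem volume_compl_offAxis (hd : 2 ≤ d) : volume (offAxis hd)ᶜ = 0 := by
  set K : Submodule ℝ (Space d) :=
    LinearMap.ker (EuclideanSpace.proj (idxP hd) : Space d →L[ℝ] ℝ).toLinearMap with hK
  have hK' : K ≠ ⊤ := by
    intro h
    have : (EuclideanSpace.single (idxP hd) (1 : ℝ) : Space d) ∈ K := h ▸ Submodule.mem_top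
    simp [hK] at this
  refine measure_mono_null ?_ (Measure.addHaar_submodule volume K hK')
  intro x hx
  simp only [offAxis, Set.mem_compl_iff, Set.mem_ofPred_eq, not_not, axisSq] at hx
  have h1 : x (idxP hd) = 0 := by
    have := sq_nonneg (x (idxP hd)); have := sq_nonneg (x (idxQ hd))
    exact pow_eq_zero_iff (two_ne_zero) |>.1 (by linarith)
  simp [hK, h1]

theorem ae_mem_offAxis (hd : 2 ≤ d) : ∀ᵐ x : Space d, x ∈ offAxis hd :=
  volume_compl_offAxis hd

theorem aestronglyMeasurable_of_continuousAt {hd : 2 ≤ d} {F : Type*} [NormedAddCommGroup F]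
    {f : Space d → F} (h : ∀ x ∈ offAxis hd, ContinuousAt f x) :
    AEStronglyMeasurable f volume := by
  have h1 : AEStronglyMeasurable f (volume.restrict (offAxis hd)) :=
    ContinuousOn.aestronglyMeasurable (fun x hx => (h x hx).continuousWithinAt)
      (isOpen_offAxis hd).measurableSet
  rwa [Measure.restrict_eq_self_of_ae_mem (ae_mem_offAxis hd)] at h1

/-- The tube lies in a box with two sides of length 2s and d - 2 sides of length 2R. -/
theorem volume_tube_le (hd : 2 ≤ d) {R s : ℝ} (hs : 0 ≤ s) :
    volume {x : Space d | ‖x‖ ≤ R ∧ axisSq hd x ≤ s ^ 2} ≤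
      ENNReal.ofReal (4 * s ^ 2) * ENNReal.ofReal (2 * R) ^ (d - 2) := by
  classical
  have hne := idxP_ne_idxQ hd
  set w : Fin d → ℝ := fun l => if l ∈ ({idxP hd, idxQ hd} : Finset (Fin d)) then s else R with hw
  have hsub : {x : Space d | ‖x‖ ≤ R ∧ axisSq hd x ≤ s ^ 2} ⊆
      (WithLp.ofLp : Space d → (Fin d → ℝ)) ⁻¹' Set.Icc (-w) w := by
    rintro x ⟨hx1, hx2⟩
    have hcoord : ∀ l, |x l| ≤ w l := by
      intro l
      have hR : |x l| ≤ R := by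
        have := PiLp.norm_apply_le x l
        rw [Real.norm_eq_abs] at this
        linarith
      simp only [hw, Finset.mem_insert, Finset.mem_singleton]
      split_ifs with h
      · refine abs_le_of_sq_le_sq ?_ hs
        unfold axisSq at hx2
        rcases h with rfl | rfl
        · nlinarith [sq_nonneg (x (idxQ hd))]
        · nlinarith [sq_nonneg (x (idxP hd))]
      · exact hR
    exact ⟨fun l => (abs_le.1 (hcoord l)).1, fun l => (abs_le.1 (hcoord l)).2⟩
  refine (measure_mono hsub).trans ?_
  rw [(PiLp.volume_preserving_ofLp (Fin d)).measure_preimage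
    measurableSet_Icc.nullMeasurableSet, Real.volume_Icc_pi]
  have hcard : ({idxP hd, idxQ hd} : Finset (Fin d)).card = 2 := Finset.card_pair hne
  rw [← Finset.prod_mul_prod_compl ({idxP hd, idxQ hd} : Finset (Fin d))]
  have h1 : ∏ i ∈ ({idxP hd, idxQ hd} : Finset (Fin d)), ENNReal.ofReal (w i - (-w) i) =
      ENNReal.ofReal (4 * s ^ 2) := by
    rw [Finset.prod_congr rfl (g := fun _ => ENNReal.ofReal (2 * s)), Finset.prod_const, hcard,
      ← ENNReal.ofReal_pow (by positivity)]
    · congr 1; ring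
    · intro i hi
      simp only [hw, hi, if_true, Pi.neg_apply]; congr 1; ring
  have h2 : ∏ i ∈ ({idxP hd, idxQ hd} : Finset (Fin d))ᶜ, ENNReal.ofReal (w i - (-w) i) =
      ENNReal.ofReal (2 * R) ^ (d - 2) := by
    rw [Finset.prod_congr rfl (g := fun _ => ENNReal.ofReal (2 * R)), Finset.prod_const,
      Finset.card_compl, hcard, Fintype.card_fin]
    intro i hi
    have hi' := Finset.mem_compl.1 hi
    simp only [hw, hi', if_false, Pi.neg_apply]; congr 1; ring
  rw [h1, h2]

/-- An integrable singularity at the axis. -/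
noncomputable def logSing (hd : 2 ≤ d) (R : ℝ) : Space d → ℝ :=
  Set.indicator {x | ‖x‖ ≤ R ∧ 0 < axisSq hd x ∧ axisSq hd x ≤ Real.exp (-1)}
    fun x => (axisSq hd x * Real.log (axisSq hd x) ^ 2)⁻¹

theorem measurableSet_logSing (hd : 2 ≤ d) (R : ℝ) :
    MeasurableSet {x : Space d | ‖x‖ ≤ R ∧ 0 < axisSq hd x ∧ axisSq hd x ≤ Real.exp (-1)} := by
  have hm : Measurable (axisSq hd) := (contDiff_axisSq hd (n := 0)).continuous.measurable
  exact (measurableSet_le measurable_norm measurable_const).inter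
    ((measurableSet_lt measurable_const hm).inter (measurableSet_le hm measurable_const))

/-- On the shell e^{-(k+2)} ≤ ρ ≤ e^{-(k+1)} the function is at most e^{k+2}/(k+1)², and the shell
has volume O(e^{-k}). The sum over k is controlled by ∑ 1/(k+1)². -/
theorem integrable_logSing (hd : 2 ≤ d) (R : ℝ) : Integrable (logSing hd R) := by
  have hm : Measurable (axisSq hd) := (contDiff_axisSq hd (n := 0)).continuous.measurable
  have hmeas : Measurable (logSing hd R) :=
    ((hm.mul ((Real.measurable_log.comp hm).pow_const 2)).inv).indicator
      (measurableSet_logSing hd R)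
  refine ⟨hmeas.aestronglyMeasurable, ?_⟩
  set S : ℕ → Set (Space d) := fun k =>
    {x | (‖x‖ ≤ R ∧ axisSq hd x ≤ Real.exp (-(k + 1 : ℝ) / 2) ^ 2) ∧
      Real.exp (-(k + 2 : ℝ)) ≤ axisSq hd x} with hS
  have hexp : ∀ a : ℝ, Real.exp (a / 2) ^ 2 = Real.exp a := fun a => by
    rw [← Real.exp_nat_mul]; congr 1; push_cast; ring
  have hSm : ∀ k, MeasurableSet (S k) := fun k =>
    ((measurableSet_le measurable_norm measurable_const).inter
      (measurableSet_le hm measurable_const)).inter (measurableSet_le measurable_const hm)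
  have hcover : ∀ x ∉ ⋃ k, S k, logSing hd R x = 0 := by
    intro x hx
    refine Set.indicator_of_notMem ?_ _
    rintro ⟨h1, h2, h3⟩
    apply hx
    set L := -Real.log (axisSq hd x) with hL
    have hL1 : 1 ≤ L := by
      have := Real.log_le_log h2 h3
      rw [Real.log_exp] at this; linarith
    have hfl := Nat.floor_le (show 0 ≤ L by linarith)
    have hfl2 := Nat.lt_floor_add_one L
    have hfl3 : 1 ≤ ⌊L⌋₊ := Nat.le_floor (by simpa using hL1)
    have hax : axisSq hd x = Real.exp (-L) := by rw [hL, neg_neg, Real.exp_log h2]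
    refine Set.mem_iUnion.2 ⟨⌊L⌋₊ - 1, ⟨h1, ?_⟩, ?_⟩
    · rw [hexp, hax, Real.exp_le_exp, Nat.cast_sub hfl3]; push_cast; linarith
    · rw [hax, Real.exp_le_exp, Nat.cast_sub hfl3]; push_cast; linarith
  set C : ℝ≥0∞ := ENNReal.ofReal (2 * R) ^ (d - 2) with hC
  have hCtop : C ≠ ⊤ := ENNReal.pow_ne_top ENNReal.ofReal_ne_top
  have hbound : ∀ k, ∫⁻ x in S k, ‖logSing hd R x‖ₑ ≤
      ENNReal.ofReal (4 * Real.exp 1 * (1 / ((k : ℝ) + 1) ^ 2)) * C := by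
    intro k
    have hk : ∀ x ∈ S k, ‖logSing hd R x‖ₑ ≤
        ENNReal.ofReal (Real.exp (k + 2) * (1 / ((k : ℝ) + 1) ^ 2)) := by
      rintro x ⟨⟨h1, h2⟩, h3⟩
      rw [hexp] at h2
      have hp : 0 < axisSq hd x := (Real.exp_pos _).trans_le h3
      rw [Real.enorm_eq_ofReal_abs]
      refine ENNReal.ofReal_le_ofReal ?_
      unfold logSing Set.indicator
      split_ifs with h
      · have hlog : Real.log (axisSq hd x) ≤ -(k + 1 : ℝ) := by
          have := Real.log_le_log hp h2; rwa [Real.log_exp] at this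
        have hsq : ((k : ℝ) + 1) ^ 2 ≤ Real.log (axisSq hd x) ^ 2 := by nlinarith
        have hk0 : (0 : ℝ) < (k : ℝ) + 1 := by positivity
        rw [abs_of_nonneg (by positivity)]
        simp only []
        rw [mul_inv, ← one_div (_ ^ 2)]
        gcongr
        rw [inv_le_comm₀ hp (Real.exp_pos _), ← Real.exp_neg]
        exact h3
      · simp; positivity
    refine (setLIntegral_mono measurable_const hk).trans ?_
    rw [setLIntegral_const]
    have hv : volume (S k) ≤ ENNReal.ofReal (4 * Real.exp (-(k + 1 : ℝ) / 2) ^ 2) * C :=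
      (measure_mono fun x hx => hx.1).trans (volume_tube_le hd (Real.exp_pos _).le)
    refine (mul_le_mul_right hv _).trans ?_
    rw [← mul_assoc, ← ENNReal.ofReal_mul (by positivity), hexp]
    refine mul_le_mul_left (ENNReal.ofReal_le_ofReal (le_of_eq ?_)) _
    have : Real.exp (k + 2) * Real.exp (-(k + 1 : ℝ)) = Real.exp 1 := by
      rw [← Real.exp_add]; congr 1; ring
    rw [← this]; ring
  have hsum : Summable fun k : ℕ => 4 * Real.exp 1 * (1 / ((k : ℝ) + 1) ^ 2) := by
    refine Summable.mul_left _ ?_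
    have := (summable_nat_add_iff 1).2 (Real.summable_one_div_nat_pow (p := 2) |>.2 one_lt_two)
    simpa using this
  rw [HasFiniteIntegral, ← setLIntegral_eq_of_support_subset (s := ⋃ k, S k)]
  · refine (lintegral_iUnion_le S _).trans_lt ?_
    refine (ENNReal.tsum_le_tsum hbound).trans_lt ?_
    rw [ENNReal.tsum_mul_right]
    refine ENNReal.mul_lt_top ?_ hCtop.lt_top
    rw [← ENNReal.ofReal_tsum_of_nonneg (fun k => by positivity) hsum]
    exact ENNReal.ofReal_lt_top
  · intro x hx
    by_contra h
    simp [hcover x h] at hx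

end NearAxis

end AharonovBohm

namespace AharonovBohm

open MeasureTheory Filter Topology

/-! ### Cutoff functions on the logarithmic scale -/

section LogCutoff

theorem deriv_eq_zero_of_forall_notMem {f : ℝ → ℝ} {s : Set ℝ} (hs : IsClosed s)
    (h : ∀ t ∉ s, f t = 0) : ∀ t ∉ s, deriv f t = 0 := by
  intro t ht
  have : f =ᶠ[𝓝 t] fun _ => 0 := by
    filter_upwards [hs.isOpen_compl.mem_nhds ht] with y hy using h y hy
  rw [this.deriv_eq]; simp

theorem deriv_contDiffAt {f : ℝ → ℝ} {t : ℝ} {m n : WithTop ℕ∞} (hf : ContDiffAt ℝ n f t)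
    (h : m + 1 ≤ n) : ContDiffAt ℝ m (deriv f) t :=
  (hf.fderiv_right h).clm_apply contDiffAt_const

theorem deriv_deriv_mul {f g : ℝ → ℝ} {t : ℝ} (hf : ContDiffAt ℝ 2 f t)
    (hg : ContDiffAt ℝ 2 g t) : deriv (deriv fun y => f y * g y) t =
      deriv (deriv f) t * g t + 2 * deriv f t * deriv g t + f t * deriv (deriv g) t := by
  have h1 : deriv (fun y => f y * g y) =ᶠ[𝓝 t] fun y => deriv f y * g y + f y * deriv g y := by
    filter_upwards [hf.eventually (by simp), hg.eventually (by simp)] with y h1 h2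
    exact deriv_fun_mul (h1.differentiableAt (by simp)) (h2.differentiableAt (by simp))
  have hf' := (deriv_contDiffAt (m := 1) hf (by norm_num)).differentiableAt (by simp)
  have hg' := (deriv_contDiffAt (m := 1) hg (by norm_num)).differentiableAt (by simp)
  have hf0 := hf.differentiableAt (by simp)
  have hg0 := hg.differentiableAt (by simp)
  rw [h1.deriv_eq, deriv_fun_add (hf'.fun_mul hg0) (hf0.fun_mul hg'), deriv_fun_mul hf' hg0,
    deriv_fun_mul hf0 hg']
  ring

/-- A cutoff that is `0` on `(-∞, e^{-2n}]` and `1` on `[e^{-n}, ∞)`. -/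
noncomputable def logCutoff (n : ℕ) (y : ℝ) : ℝ :=
  if 0 < y then Real.smoothTransition (Real.log y / n + 2) else 0

variable {n : ℕ} {y : ℝ}

theorem logCutoff_nonneg : 0 ≤ logCutoff n y := by
  unfold logCutoff; split_ifs
  · exact Real.smoothTransition.nonneg _
  · exact le_rfl

theorem logCutoff_le_one : logCutoff n y ≤ 1 := by
  unfold logCutoff; split_ifs
  · exact Real.smoothTransition.le_one _
  · exact zero_le_one

theorem logCutoff_eq_zero (hn : 0 < n) (hy : y < Real.exp (-(2 * n : ℝ))) :
    logCutoff n y = 0 := by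
  unfold logCutoff; split_ifs with h
  · refine Real.smoothTransition.zero_of_nonpos ?_
    have hn' : (0 : ℝ) < n := by exact_mod_cast hn
    have := Real.log_lt_log h hy
    rw [Real.log_exp] at this
    have : Real.log y / n ≤ -2 := by rw [div_le_iff₀ hn']; linarith
    linarith
  · rfl

theorem logCutoff_eq_one (hn : 0 < n) (hy : Real.exp (-(n : ℝ)) ≤ y) : logCutoff n y = 1 := by
  have h : 0 < y := (Real.exp_pos _).trans_le hy
  rw [logCutoff, if_pos h]
  refine Real.smoothTransition.one_of_one_le ?_
  have hn' : (0 : ℝ) < n := by exact_mod_cast hn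
  have := Real.log_le_log (Real.exp_pos _) hy
  rw [Real.log_exp] at this
  have : -1 ≤ Real.log y / n := by rw [le_div_iff₀ hn']; linarith
  linarith

theorem logCutoff_eventuallyEq (hy : 0 < y) :
    logCutoff n =ᶠ[𝓝 y] fun y => Real.smoothTransition (Real.log y / n + 2) := by
  filter_upwards [lt_mem_nhds hy] with z hz
  rw [logCutoff, if_pos hz]

theorem contDiffAt_logCutoff (hy : 0 < y) : ContDiffAt ℝ 2 (logCutoff n) y := by
  refine ContDiffAt.congr_of_eventuallyEq ?_ (logCutoff_eventuallyEq hy)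
  exact (Real.smoothTransition.contDiffAt (n := 2)).comp y
    (((Real.contDiffAt_log.2 hy.ne').div_const _).add contDiffAt_const)

theorem hasDerivAt_log_div (hy : 0 < y) :
    HasDerivAt (fun y => Real.log y / n + 2) (1 / (n * y)) y := by
  have := ((Real.hasDerivAt_log hy.ne').div_const (n : ℝ)).add_const 2
  refine this.congr_deriv ?_
  rw [one_div, mul_inv, div_eq_mul_inv, mul_comm]

theorem deriv_logCutoff (hy : 0 < y) : deriv (logCutoff n) y =
    deriv Real.smoothTransition (Real.log y / n + 2) * (1 / (n * y)) := by
  rw [(logCutoff_eventuallyEq hy).deriv_eq]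
  exact HasDerivAt.deriv (HasDerivAt.comp y
    ((Real.smoothTransition.contDiffAt (n := 1)).differentiableAt (by simp)).hasDerivAt
    (hasDerivAt_log_div hy))

theorem deriv_deriv_logCutoff (hn : 0 < n) (hy : 0 < y) : deriv (deriv (logCutoff n)) y =
    (deriv (deriv Real.smoothTransition) (Real.log y / n + 2) / n ^ 2
      - deriv Real.smoothTransition (Real.log y / n + 2) / n) / y ^ 2 := by
  have hev : deriv (logCutoff n) =ᶠ[𝓝 y] fun y =>
      deriv Real.smoothTransition (Real.log y / n + 2) * (1 / (n * y)) := by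
    filter_upwards [lt_mem_nhds hy] with z hz using deriv_logCutoff hz
  have hn' : (n : ℝ) ≠ 0 := by positivity
  have h1 : HasDerivAt (fun y => deriv Real.smoothTransition (Real.log y / n + 2))
      (deriv (deriv Real.smoothTransition) (Real.log y / n + 2) * (1 / (n * y))) y :=
    HasDerivAt.comp y ((deriv_contDiffAt (m := 1) (Real.smoothTransition.contDiffAt (n := 2))
      (by norm_num)).differentiableAt (by simp)).hasDerivAt (hasDerivAt_log_div hy)
  have h2 : HasDerivAt (fun y : ℝ => 1 / ((n : ℝ) * y)) (-(1 / (n * y ^ 2))) y := by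
    have := (hasDerivAt_inv hy.ne').const_mul ((n : ℝ)⁻¹)
    refine (this.congr_deriv ?_).congr_of_eventuallyEq (Eventually.of_forall fun z => ?_)
    · field_simp
    · simp [mul_comm]
  rw [hev.deriv_eq, (h1.fun_mul h2).deriv]
  field_simp
  ring

theorem exists_bound_deriv_smoothTransition : ∃ B : ℝ, 0 ≤ B ∧
    (∀ t, |deriv Real.smoothTransition t| ≤ B) ∧
    (∀ t, |deriv (deriv Real.smoothTransition) t| ≤ B) ∧
    (∀ t ∉ Set.Icc (0 : ℝ) 1, deriv Real.smoothTransition t = 0) ∧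
    (∀ t ∉ Set.Icc (0 : ℝ) 1, deriv (deriv Real.smoothTransition) t = 0) := by
  have h1 : ∀ t ∉ Set.Icc (0 : ℝ) 1, deriv Real.smoothTransition t = 0 := by
    intro t ht
    rcases lt_or_ge t 0 with h | h
    · have : Real.smoothTransition =ᶠ[𝓝 t] fun _ => 0 := by
        filter_upwards [gt_mem_nhds h] with y hy using Real.smoothTransition.zero_of_nonpos hy.le
      rw [this.deriv_eq]; simp
    · have h' : 1 < t := by
        by_contra h2; exact ht ⟨h, not_lt.1 h2⟩
      have : Real.smoothTransition =ᶠ[𝓝 t] fun _ => 1 := by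
        filter_upwards [lt_mem_nhds h'] with y hy using Real.smoothTransition.one_of_one_le hy.le
      rw [this.deriv_eq]; simp
  have h2 := deriv_eq_zero_of_forall_notMem isClosed_Icc h1
  have c1 : Continuous (deriv Real.smoothTransition) :=
    (Real.smoothTransition.contDiff (n := 1)).continuous_deriv (by simp)
  have c2 : Continuous (deriv (deriv Real.smoothTransition)) := by
    have : ContDiff ℝ 1 (deriv Real.smoothTransition) := contDiff_iff_contDiffAt.2 fun t =>
      deriv_contDiffAt (Real.smoothTransition.contDiffAt (n := 2)) (by norm_num)
    exact this.continuous_deriv (by simp)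
  obtain ⟨B1, hB1⟩ := (isCompact_Icc (a := (0 : ℝ)) (b := 1)).exists_bound_of_continuousOn
    c1.continuousOn
  obtain ⟨B2, hB2⟩ := (isCompact_Icc (a := (0 : ℝ)) (b := 1)).exists_bound_of_continuousOn
    c2.continuousOn
  refine ⟨max (max B1 B2) 0, le_max_right _ _, fun t => ?_, fun t => ?_, h1, h2⟩
  · by_cases ht : t ∈ Set.Icc (0 : ℝ) 1
    · exact (hB1 t ht).trans ((le_max_left _ _).trans (le_max_left _ _))
    · rw [h1 t ht, abs_zero]; exact le_max_right _ _
  · by_cases ht : t ∈ Set.Icc (0 : ℝ) 1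
    · exact (hB2 t ht).trans ((le_max_right _ _).trans (le_max_left _ _))
    · rw [h2 t ht, abs_zero]; exact le_max_right _ _

/-- The operator 4y∂² + 4(1 + ν)∂ is how Δ_A acts on a function of ρ multiplying the angular factor.
Since log r is harmonic in the plane, the first-order error of size 1/n carries the coefficient 8j +
4ν, which vanishes exactly when y^j r^ν does not decay at the axis. -/
theorem pow_mul_logCutoff_radial {j : ℕ} {ν : ℝ} (hn : 0 < n) (hy : 0 < y) :
    4 * y * deriv (deriv fun y => y ^ j * logCutoff n y) y
        + 4 * (1 + ν) * deriv (fun y => y ^ j * logCutoff n y) y =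
      logCutoff n y * (4 * y * deriv (deriv fun y : ℝ => y ^ j) y
        + 4 * (1 + ν) * deriv (fun y : ℝ => y ^ j) y)
      + y ^ j / y * ((8 * j + 4 * ν) * (deriv Real.smoothTransition (Real.log y / n + 2) / n)
        + 4 * (deriv (deriv Real.smoothTransition) (Real.log y / n + 2) / n ^ 2)) := by
  have hp : ContDiffAt ℝ 2 (fun y : ℝ => y ^ j) y := contDiffAt_id.pow j
  have hn' : (n : ℝ) ≠ 0 := by positivity
  have hj : deriv (fun y : ℝ => y ^ j) y = j * (y ^ j / y) := by
    rw [show deriv (fun y : ℝ => y ^ j) y = j * y ^ (j - 1) by simp]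
    rcases j with _ | j
    · simp
    · rw [Nat.add_sub_cancel, pow_succ, mul_div_cancel_right₀ _ hy.ne']
  rw [deriv_deriv_mul hp (contDiffAt_logCutoff hy), deriv_fun_mul (hp.differentiableAt (by simp))
    ((contDiffAt_logCutoff hy).differentiableAt (by simp)), deriv_deriv_logCutoff hn hy,
    deriv_logCutoff hy, hj]
  field_simp
  ring

theorem mul_exp_neg_le_one (t : ℝ) : t * Real.exp (-t) ≤ 1 := by
  have h1 := Real.add_one_le_exp t
  rw [Real.exp_neg, ← div_eq_mul_inv, div_le_one (Real.exp_pos t)]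
  linarith

end LogCutoff

/-! ### The error produced by the cutoff -/

section GreenSeparated

open scoped ComplexConjugate

variable {d : ℕ} {hd : 2 ≤ d} {Ψ : ℝ} {m : ℤ} {c : Fin d → ℝ} {k j : ℕ} {φ : ℝ → ℝ} {a b : ℝ}

/-- The difference between `Δ_A` of a cut off function and the cut off of `Δ_A`. -/
noncomputable def cutoffError (hd : 2 ≤ d) (Ψ : ℝ) (m : ℤ) (c : Fin d → ℝ) (k j : ℕ) (φ : ℝ → ℝ)
    (n : ℕ) (x : Space d) : ℂ :=
  ((linForm c x ^ k * (axisSq hd x ^ j * (φ (‖x‖ ^ 2) / axisSq hd x *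
      ((8 * j + 4 * |m - Ψ|) *
        (deriv Real.smoothTransition (Real.log (axisSq hd x) / n + 2) / n)
      + 4 * (deriv (deriv Real.smoothTransition) (Real.log (axisSq hd x) / n + 2) / n ^ 2))
    + 8 * (deriv Real.smoothTransition (Real.log (axisSq hd x) / n + 2) / n)
      * deriv φ (‖x‖ ^ 2))) : ℝ) : ℂ) * angular hd Ψ m x

theorem magLaplacian_cutoff (hP : c (idxP hd) = 0) (hQ : c (idxQ hd) = 0)
    (hφ : ContDiff ℝ 2 φ) {n : ℕ} (hn : 0 < n) {x : Space d} (hx : x ∈ offAxis hd) :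
    magLaplacian (potential d hd Ψ)
        (separated hd Ψ m c k (fun y => y ^ j * logCutoff n y) φ) x =
      (logCutoff n (axisSq hd x) : ℂ) *
        magLaplacian (potential d hd Ψ) (separated hd Ψ m c k (fun y => y ^ j) φ) x
      + cutoffError hd Ψ m c k j φ n x := by
  have hy := axisSq_pos hx
  have hp : ContDiffAt ℝ 2 (fun y : ℝ => y ^ j) (axisSq hd x) := contDiffAt_id.pow j
  rw [magLaplacian_separated hP hQ hx (hp.mul (contDiffAt_logCutoff hy)) hφ.contDiffAt,
    magLaplacian_separated hP hQ hx hp hφ.contDiffAt, pow_mul_logCutoff_radial hn hy,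
    deriv_fun_mul (hp.differentiableAt (by simp))
      ((contDiffAt_logCutoff hy).differentiableAt (by simp)), deriv_logCutoff hy, cutoffError]
  have hcomb : ∀ (p q r : ℝ) (z : ℂ), (p : ℂ) * ((q : ℂ) * z) + (r : ℂ) * z =
      ((p * q + r : ℝ) : ℂ) * z := fun p q r z => by push_cast; ring
  rw [hcomb]
  congr 2
  have hn' : (n : ℝ) ≠ 0 := by positivity
  have hy' := hy.ne'
  field_simp
  ring

/-- With ℓ = -log ρ, the error lives where n ≤ ℓ ≤ 2n, so 1/n ≤ 2/ℓ. The second-derivative term is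
then O(1/(ρℓ²)). The first-derivative term is only O(δ/(ρℓ)), but it is multiplied by ρ^δ = e^{-δℓ},
and δ e^{-δℓ} ≤ 1/ℓ supplies the missing power. The majorant does not depend on n. -/
theorem norm_cutoffError_le {R C₁ C₂ C₃ B : ℝ} (hφ0 : ∀ t, R ^ 2 < t → φ t = 0)
    (hφ1 : ∀ t, R ^ 2 < t → deriv φ t = 0) (hR : 0 ≤ R) (hC1 : ∀ t, |φ t| ≤ C₁)
    (hC2 : ∀ t, |deriv φ t| ≤ C₂)
    (hC3 : ∀ x : Space d, ‖x‖ ≤ R → |linForm c x| ^ k ≤ C₃)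
    (hB0 : 0 ≤ B) (hB1 : ∀ t, |deriv Real.smoothTransition t| ≤ B)
    (hB2 : ∀ t, |deriv (deriv Real.smoothTransition) t| ≤ B)
    (hB3 : ∀ t ∉ Set.Icc (0 : ℝ) 1, deriv Real.smoothTransition t = 0)
    (hB4 : ∀ t ∉ Set.Icc (0 : ℝ) 1, deriv (deriv Real.smoothTransition) t = 0)
    {n : ℕ} (hn : 0 < n) {x : Space d} (hx : x ∈ offAxis hd) :
    ‖cutoffError hd Ψ m c k j φ n x‖ ≤ C₃ * (32 * C₁ * B + 16 * B * C₂) * logSing hd R x := by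
  have hy := axisSq_pos hx
  have hn' : (0 : ℝ) < n := by exact_mod_cast hn
  have hC10 : 0 ≤ C₁ := (abs_nonneg _).trans (hC1 0)
  have hC20 : 0 ≤ C₂ := (abs_nonneg _).trans (hC2 0)
  have hC30 : 0 ≤ C₃ := (pow_nonneg (abs_nonneg _) k).trans (hC3 0 (by simpa using hR))
  have hlog0 : 0 ≤ logSing hd R x := by
    unfold logSing
    refine Set.indicator_nonneg (fun z hz => ?_) x
    have := hz.2.1
    positivity
  have hrhs : 0 ≤ C₃ * (32 * C₁ * B + 16 * B * C₂) * logSing hd R x := by positivity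
  by_cases hxR : ‖x‖ ≤ R
  swap
  · have : R ^ 2 < ‖x‖ ^ 2 := by nlinarith [not_le.1 hxR]
    rw [cutoffError, hφ0 _ this, hφ1 _ this]; simpa using hrhs
  by_cases hL : Real.log (axisSq hd x) / n + 2 ∈ Set.Icc (0 : ℝ) 1
  swap
  · rw [cutoffError, hB3 _ hL, hB4 _ hL]; simpa using hrhs
  set y := axisSq hd x with hydef
  set ℓ := -Real.log y with hℓ
  have hyl : y = Real.exp (-ℓ) := by rw [hℓ, neg_neg, Real.exp_log hy]
  have hl1 : ℓ ≤ 2 * n := by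
    have := hL.1
    have h2 : -2 ≤ Real.log y / n := by linarith
    rw [le_div_iff₀ hn'] at h2; linarith
  have hl2 : (n : ℝ) ≤ ℓ := by
    have := hL.2
    have h2 : Real.log y / n ≤ -1 := by linarith
    rw [div_le_iff₀ hn'] at h2; linarith
  have hn1 : (1 : ℝ) ≤ n := by exact_mod_cast hn
  have hl0 : 0 < ℓ := by linarith
  have hsing : logSing hd R x = (y * ℓ ^ 2)⁻¹ := by
    unfold logSing
    rw [Set.indicator_of_mem]
    · rw [← hydef, hℓ, neg_sq]
    · refine ⟨hxR, hy, ?_⟩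
      rw [← hydef, hyl, Real.exp_le_exp]; linarith
  have hninv : (n : ℝ)⁻¹ ≤ 2 / ℓ := by
    rw [inv_le_comm₀ hn' (by positivity), inv_div, div_le_iff₀ two_pos]; linarith
  set T1 := deriv Real.smoothTransition (Real.log y / n + 2)
  set T2 := deriv (deriv Real.smoothTransition) (Real.log y / n + 2)
  -- The exponent of ρ in |y^j · angular|; the coefficient 8j + 4|m - Ψ| equals 8δ.
  set δ := |(m : ℝ) - Ψ| / 2 + j with hδ
  have hδ0 : 0 ≤ δ := by positivity
  have hang : ‖angular hd Ψ m x‖ * y ^ j = Real.exp (-(δ * ℓ)) := by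
    rw [norm_angular hx, ← hydef, ← Real.rpow_natCast, ← Real.rpow_add hy, ← hδ, hyl,
      ← Real.exp_mul]
    congr 1; ring
  have hE1 : Real.exp (-(δ * ℓ)) ≤ 1 := Real.exp_le_one_iff.2 (by nlinarith [mul_nonneg hδ0 hl0.le])
  have hE2 : δ * Real.exp (-(δ * ℓ)) ≤ 1 / ℓ := by
    rw [le_div_iff₀ hl0]
    have := mul_exp_neg_le_one (δ * ℓ); linarith
  -- Lets the term with φ', of size 1/ℓ, be absorbed in 1/(ρℓ²).
  have hyl1 : y * ℓ ≤ 1 := by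
    have := mul_exp_neg_le_one ℓ; rw [hyl]; linarith
  have hT1 : |T1 / n| ≤ B * (2 / ℓ) := by
    rw [abs_div, Nat.abs_cast, div_eq_mul_inv]
    exact mul_le_mul (hB1 _) hninv (by positivity) hB0
  have hT2 : |T2 / n ^ 2| ≤ B * (2 / ℓ) ^ 2 := by
    rw [abs_div, abs_pow, Nat.abs_cast, div_eq_mul_inv, ← inv_pow]
    exact mul_le_mul (hB2 _) (pow_le_pow_left₀ (by positivity) hninv 2) (by positivity) hB0
  set E := Real.exp (-(δ * ℓ)) with hE
  have hE0 : 0 < E := Real.exp_pos _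
  have hval : ‖cutoffError hd Ψ m c k j φ n x‖ = |linForm c x| ^ k * (E *
      |φ (‖x‖ ^ 2) / y * ((8 * δ) * (T1 / n) + 4 * (T2 / n ^ 2))
        + 8 * (T1 / n) * deriv φ (‖x‖ ^ 2)|) := by
    rw [cutoffError, norm_mul, Complex.norm_real, Real.norm_eq_abs, abs_mul, abs_mul, abs_pow,
      abs_pow, ← hydef, abs_of_pos hy, ← hang]
    have : (8 * j + 4 * |(m : ℝ) - Ψ|) = 8 * δ := by rw [hδ]; ring
    rw [this]; ring
  rw [hval, hsing, mul_assoc C₃]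
  refine mul_le_mul (hC3 x hxR) ?_ (by positivity) hC30
  calc E * |φ (‖x‖ ^ 2) / y * ((8 * δ) * (T1 / n) + 4 * (T2 / n ^ 2))
        + 8 * (T1 / n) * deriv φ (‖x‖ ^ 2)|
      ≤ E * (C₁ / y * ((8 * δ) * (B * (2 / ℓ)) + 4 * (B * (2 / ℓ) ^ 2))
        + 8 * (B * (2 / ℓ)) * C₂) := by
        refine mul_le_mul_of_nonneg_left ?_ hE0.le
        refine (abs_add_le _ _).trans (add_le_add ?_ ?_)
        · rw [abs_mul, abs_div, abs_of_pos hy]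
          refine mul_le_mul (by gcongr; exact hC1 _) ?_ (abs_nonneg _) (by positivity)
          refine (abs_add_le _ _).trans (add_le_add ?_ ?_)
          · rw [abs_mul, abs_of_nonneg (by positivity : 0 ≤ 8 * δ)]; gcongr
          · rw [abs_mul, abs_of_nonneg (by norm_num : (0 : ℝ) ≤ 4)]; gcongr
        · rw [abs_mul, abs_mul, abs_of_nonneg (by norm_num : (0 : ℝ) ≤ 8)]
          gcongr
          exact hC2 _
    _ = C₁ / y * (16 * (δ * E) * B / ℓ + 16 * B * E / ℓ ^ 2) + 16 * B * C₂ * E / ℓ := by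
        field_simp; ring
    _ ≤ C₁ / y * (16 * (1 / ℓ) * B / ℓ + 16 * B * 1 / ℓ ^ 2) + 16 * B * C₂ * 1 / ℓ := by gcongr
    _ = (32 * C₁ * B + 16 * B * C₂ * (y * ℓ)) * (y * ℓ ^ 2)⁻¹ := by field_simp; ring
    _ ≤ (32 * C₁ * B + 16 * B * C₂ * 1) * (y * ℓ ^ 2)⁻¹ := by gcongr
    _ = (32 * C₁ * B + 16 * B * C₂) * (y * ℓ ^ 2)⁻¹ := by ring

end GreenSeparated

end AharonovBohm

namespace AharonovBohm

open MeasureTheory Filter Topology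

/-! ### Green's formula across the axis -/

section GreenSeparated

open scoped ComplexConjugate

variable {d : ℕ} {hd : 2 ≤ d} {Ψ : ℝ} {m : ℤ} {c : Fin d → ℝ} {k j : ℕ} {φ : ℝ → ℝ} {a b : ℝ}

theorem axisSq_le_norm_sq (hd : 2 ≤ d) (x : Space d) : axisSq hd x ≤ ‖x‖ ^ 2 := by
  rw [EuclideanSpace.real_norm_sq_eq, axisSq,
    ← Finset.sum_pair (f := fun i => x i ^ 2) (idxP_ne_idxQ hd)]
  exact Finset.sum_le_sum_of_subset_of_nonneg (Finset.subset_univ _) fun i _ _ => sq_nonneg _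

theorem norm_angular_le {R : ℝ} (hR : 1 ≤ R) {x : Space d} (hx : x ∈ offAxis hd) (hxR : ‖x‖ ≤ R) :
    ‖angular hd Ψ m x‖ ≤ R ^ |(m : ℝ) - Ψ| := by
  rw [norm_angular hx]
  have h1 : axisSq hd x ≤ R ^ (2 : ℝ) := by
    rw [Real.rpow_two]
    exact (axisSq_le_norm_sq hd x).trans (pow_le_pow_left₀ (norm_nonneg _) hxR 2)
  refine (Real.rpow_le_rpow (axisSq_nonneg hd x) h1 (by positivity)).trans_eq ?_
  rw [← Real.rpow_mul (by linarith)]; congr 1; ring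

theorem exists_bound_closedBall {f : Space d → ℝ} (hf : Continuous f) (R : ℝ) :
    ∃ C, 0 ≤ C ∧ ∀ x, ‖x‖ ≤ R → |f x| ≤ C := by
  obtain ⟨C, hC⟩ := (isCompact_closedBall (0 : Space d) R).exists_bound_of_continuousOn
    hf.continuousOn
  exact ⟨max C 0, le_max_right _ _, fun x hx => (hC x (by simpa using hx)).trans (le_max_left _ _)⟩

theorem eventually_exp_neg_le {y : ℝ} (hy : 0 < y) :
    ∀ᶠ n : ℕ in atTop, 0 < n ∧ Real.exp (-(n : ℝ)) < y := by
  have h := (Real.tendsto_exp_neg_atTop_nhds_zero.comp tendsto_natCast_atTop_atTop).eventually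
    (gt_mem_nhds hy)
  filter_upwards [h, eventually_gt_atTop 0] with n h1 h2 using ⟨h2, h1⟩

theorem cutoffError_eq_zero {n : ℕ} {x : Space d} (hn : 0 < n)
    (h : Real.exp (-(n : ℝ)) < axisSq hd x)
    (hB3 : ∀ t ∉ Set.Icc (0 : ℝ) 1, deriv Real.smoothTransition t = 0)
    (hB4 : ∀ t ∉ Set.Icc (0 : ℝ) 1, deriv (deriv Real.smoothTransition) t = 0) :
    cutoffError hd Ψ m c k j φ n x = 0 := by
  have hn' : (0 : ℝ) < n := by exact_mod_cast hn
  have h1 := Real.log_lt_log (Real.exp_pos _) h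
  rw [Real.log_exp] at h1
  have h2 : -1 < Real.log (axisSq hd x) / n := by rw [lt_div_iff₀ hn']; linarith
  have h3 : Real.log (axisSq hd x) / n + 2 ∉ Set.Icc (0 : ℝ) 1 := fun h => by
    have := h.2; linarith
  rw [cutoffError, hB3 _ h3, hB4 _ h3]; simp

theorem logSing_nonneg (hd : 2 ≤ d) (R : ℝ) (x : Space d) : 0 ≤ logSing hd R x :=
  Set.indicator_nonneg (fun z hz => by have := hz.2.1; positivity) x

/-- Green's formula against a function whose singularity at the axis is that of `angular`. -/
theorem integral_magLaplacian_mul_conj_separated (hP : c (idxP hd) = 0) (hQ : c (idxQ hd) = 0)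
    (hφ : ContDiff ℝ 2 φ) (hsupp : ∀ t ∉ Set.Icc a b, φ t = 0) {u : Space d → ℂ} {M : ℝ}
    (hu : ∀ x ∈ offAxis hd, ContDiffAt ℝ 2 u x)
    (huM : ∀ x ∈ offAxis hd, ‖x‖ ^ 2 ∈ Set.Icc a b → ‖u x‖ ≤ M)
    (huL : IntegrableOn (magLaplacian (potential d hd Ψ) u) {x | ‖x‖ ^ 2 ∈ Set.Icc a b}) :
    ∫ x, magLaplacian (potential d hd Ψ) u x * conj (separated hd Ψ m c k (fun y => y ^ j) φ x) =
      ∫ x, u x * conj (magLaplacian (potential d hd Ψ)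
        (separated hd Ψ m c k (fun y => y ^ j) φ) x) := by
  obtain ⟨B, hB0, hB1, hB2, hB3, hB4⟩ := exists_bound_deriv_smoothTransition
  set A := potential d hd Ψ with hA
  set F := separated hd Ψ m c k (fun y => y ^ j) φ with hF
  set Φ : ℕ → Space d → ℂ := fun n =>
    separated hd Ψ m c k (fun y => y ^ j * logCutoff n y) φ with hΦ
  have hsupp1 := deriv_eq_zero_of_forall_notMem isClosed_Icc hsupp
  have hsupp2 := deriv_eq_zero_of_forall_notMem isClosed_Icc hsupp1
  -- This radius is at least 1, as the bound on the angular factor requires, and b ≤ R².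
  set R : ℝ := |b| + 1 with hR
  have hR1 : 1 ≤ R := by rw [hR]; linarith [abs_nonneg b]
  have hRb : b ≤ R ^ 2 := by nlinarith [le_abs_self b]
  have hnot : ∀ t, R ^ 2 < t → t ∉ Set.Icc a b := fun t ht h => by linarith [h.2]
  have hpj : ∀ {y : ℝ}, ContDiffAt ℝ 2 (fun y : ℝ => y ^ j) y := contDiffAt_id.pow j
  have hφ1 : Continuous (deriv φ) := hφ.continuous_deriv (by norm_num)
  have hφ2 : Continuous (deriv (deriv φ)) := by
    have : ContDiff ℝ 1 (deriv φ) := contDiff_iff_contDiffAt.2 fun t =>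
      deriv_contDiffAt hφ.contDiffAt (by norm_num)
    exact this.continuous_deriv (by simp)
  have hbd : ∀ {f : ℝ → ℝ}, Continuous f → (∀ t ∉ Set.Icc a b, f t = 0) →
      ∃ C, ∀ t, |f t| ≤ C := by
    intro f hf h0
    obtain ⟨C, hC⟩ := (isCompact_Icc (a := a) (b := b)).exists_bound_of_continuousOn
      hf.continuousOn
    refine ⟨max C 0, fun t => ?_⟩
    by_cases ht : t ∈ Set.Icc a b
    · exact (hC t ht).trans (le_max_left _ _)
    · rw [h0 t ht, abs_zero]; exact le_max_right _ _
  obtain ⟨C₁, hC1⟩ := hbd hφ.continuous hsupp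
  obtain ⟨C₂, hC2⟩ := hbd hφ1 hsupp1
  have cX : Continuous (linForm c) := (contDiff_linForm c (n := 0)).continuous
  have cρ : Continuous (axisSq hd) := (contDiff_axisSq hd (n := 0)).continuous
  have cs : Continuous fun x : Space d => ‖x‖ ^ 2 := continuous_norm.pow 2
  obtain ⟨C₃, hC30, hC3⟩ := exists_bound_closedBall (cX.pow k) R
  have hC3' : ∀ x : Space d, ‖x‖ ≤ R → |linForm c x| ^ k ≤ C₃ := fun x hx => by
    have := hC3 x hx; rwa [Pi.pow_apply, abs_pow] at this
  have hCA : 0 ≤ R ^ |(m : ℝ) - Ψ| := by positivity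
  -- bounds for `F` and `Δ_A F`
  have hxle : ∀ x : Space d, ‖x‖ ^ 2 ∈ Set.Icc a b → ‖x‖ ≤ R := fun x hx => by
    have h1 := hx.2.trans hRb
    exact (sq_le_sq₀ (norm_nonneg _) (by linarith)).1 h1
  obtain ⟨D₁, hD10, hD1⟩ := exists_bound_closedBall
    (f := fun x => linForm c x ^ k * (axisSq hd x ^ j * φ (‖x‖ ^ 2)))
    ((cX.pow k).mul ((cρ.pow j).mul (hφ.continuous.comp cs))) R
  have hF0 : ∀ x, ‖x‖ ^ 2 ∉ Set.Icc a b → F x = 0 := fun x hx => by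
    simp [hF, separated, hsupp _ hx]
  have hΦ0 : ∀ n x, ‖x‖ ^ 2 ∉ Set.Icc a b → Φ n x = 0 := fun n x hx => by
    simp [hΦ, separated, hsupp _ hx]
  have hFb : ∀ x ∈ offAxis hd, ‖F x‖ ≤ D₁ * R ^ |(m : ℝ) - Ψ| := by
    intro x hx
    by_cases hxs : ‖x‖ ^ 2 ∈ Set.Icc a b
    · have hxR := hxle x hxs
      rw [hF, separated, norm_mul]
      refine mul_le_mul ?_ (norm_angular_le hR1 hx hxR) (norm_nonneg _) hD10
      have := hD1 x hxR
      rwa [← Complex.ofReal_mul, ← Complex.ofReal_mul, Complex.norm_real, Real.norm_eq_abs]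
    · rw [hF0 x hxs, norm_zero]; positivity
  have hΦF : ∀ n x, Φ n x = (logCutoff n (axisSq hd x) : ℂ) * F x := fun n x => by
    simp only [hΦ, hF, separated]; push_cast; ring
  have hcutle : ∀ (n : ℕ) (y : ℝ), ‖(logCutoff n y : ℂ)‖ ≤ 1 := fun n y => by
    rw [Complex.norm_real, Real.norm_of_nonneg logCutoff_nonneg]; exact logCutoff_le_one
  have cd1 : Continuous (deriv fun y : ℝ => y ^ j) :=
    (contDiff_id.pow j : ContDiff ℝ 1 fun y : ℝ => y ^ j).continuous_deriv (by simp)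
  have cd2 : Continuous (deriv (deriv fun y : ℝ => y ^ j)) := by
    have : ContDiff ℝ 1 (deriv fun y : ℝ => y ^ j) := contDiff_iff_contDiffAt.2 fun t =>
      deriv_contDiffAt (n := 2) hpj (by norm_num)
    exact this.continuous_deriv (by simp)
  obtain ⟨D₂, hD20, hD2⟩ := exists_bound_closedBall
    (f := fun x => (k * (k - 1 : ℕ) * (∑ l, c l ^ 2) * linForm c x ^ (k - 1 - 1) *
            axisSq hd x ^ j * φ (‖x‖ ^ 2)
        + linForm c x ^ k * φ (‖x‖ ^ 2) *
          (4 * axisSq hd x * deriv (deriv fun y : ℝ => y ^ j) (axisSq hd x)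
            + 4 * (1 + |m - Ψ|) * deriv (fun y : ℝ => y ^ j) (axisSq hd x))
        + linForm c x ^ k * axisSq hd x ^ j *
          (4 * ‖x‖ ^ 2 * deriv (deriv φ) (‖x‖ ^ 2)
            + (2 * d + 4 * k + 4 * |m - Ψ|) * deriv φ (‖x‖ ^ 2))
        + 8 * axisSq hd x * deriv (fun y : ℝ => y ^ j) (axisSq hd x) * deriv φ (‖x‖ ^ 2) *
          linForm c x ^ k))
    (by
      have c1 := hφ.continuous
      fun_prop) R
  have hLF : ∀ x ∈ offAxis hd, ‖x‖ ≤ R → ‖magLaplacian A F x‖ ≤ D₂ * R ^ |(m : ℝ) - Ψ| := by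
    intro x hx hxR
    rw [hF, hA, magLaplacian_separated hP hQ hx hpj hφ.contDiffAt, norm_mul, Complex.norm_real,
      Real.norm_eq_abs]
    exact mul_le_mul (hD2 x hxR) (norm_angular_le hR1 hx hxR) (norm_nonneg _) hD20
  have hLΦ0 : ∀ n x, x ∈ offAxis hd → ‖x‖ ^ 2 ∉ Set.Icc a b → magLaplacian A (Φ n) x = 0 := by
    intro n x hx hxs
    rw [hΦ, hA, magLaplacian_separated hP hQ hx (hpj.mul (contDiffAt_logCutoff (axisSq_pos hx)))
      hφ.contDiffAt, hsupp _ hxs, hsupp1 _ hxs, hsupp2 _ hxs]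
    simp
  -- regularity of the cut off functions
  have hΦC : ∀ n, ∀ x ∈ offAxis hd, ContDiffAt ℝ 2 (Φ n) x := fun n x hx =>
    contDiffAt_separated hx (hpj.mul (contDiffAt_logCutoff (axisSq_pos hx))) hφ.contDiffAt
  have hK : ∀ n : ℕ, 0 < n → ∀ x, Φ n x ≠ 0 →
      ‖x‖ ≤ R ∧ Real.exp (-(2 * n : ℝ)) ≤ axisSq hd x := by
    intro n hn x hx
    refine ⟨?_, ?_⟩
    · by_contra h
      refine hx (hΦ0 n x (hnot _ ?_))
      nlinarith [not_le.1 h]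
    · by_contra h
      apply hx
      rw [hΦF, logCutoff_eq_zero hn (not_le.1 h)]; simp
  have hKc : ∀ n : ℕ, IsClosed {x : Space d | ‖x‖ ≤ R ∧ Real.exp (-(2 * n : ℝ)) ≤ axisSq hd x} :=
    fun n => (isClosed_le continuous_norm continuous_const).inter
      (isClosed_le continuous_const cρ)
  have htsupp : ∀ n : ℕ, 0 < n → tsupport (Φ n) ⊆
      {x : Space d | ‖x‖ ≤ R ∧ Real.exp (-(2 * n : ℝ)) ≤ axisSq hd x} := fun n hn =>
    closure_minimal (fun x hx => hK n hn x hx) (hKc n)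
  have hgreen : ∀ n : ℕ, 0 < n → ∫ x, magLaplacian A u x * conj (Φ n x) =
      ∫ x, u x * conj (magLaplacian A (Φ n) x) := by
    intro n hn
    refine integral_magLaplacian_mul_conj (U := offAxis hd)
      (fun x hx => contDiffAt_potential hd Ψ hx) hu (hΦC n) ?_ ?_
    · refine HasCompactSupport.intro (isCompact_closedBall (0 : Space d) R) fun x hx => ?_
      by_contra h
      exact hx (by simpa using (hK n hn x h).1)
    · intro x hx
      exact ((Real.exp_pos _).trans_le (htsupp n hn hx).2).ne'
  -- passage to the limit
  have contL : ∀ {w : Space d → ℂ} {x}, x ∈ offAxis hd → ContDiffAt ℝ 2 w x →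
      ContinuousAt (magLaplacian A w) x := fun hx h =>
    (contDiffAt_magLaplacian (n := 0) (contDiffAt_potential hd Ψ hx) h
      (by norm_num)).continuousAt
  have conjC : ∀ {w : Space d → ℂ} {x}, ContinuousAt w x →
      ContinuousAt (fun y => conj (w y)) x := fun h =>
    Complex.continuous_conj.continuousAt.comp h
  have hS : MeasurableSet {x : Space d | ‖x‖ ^ 2 ∈ Set.Icc a b} :=
    cs.measurable measurableSet_Icc
  -- Dominated by Δ_A u on the annulus times a uniform bound for F.
  have lim1 : Tendsto (fun n => ∫ x, magLaplacian A u x * conj (Φ n x)) atTop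
      (𝓝 (∫ x, magLaplacian A u x * conj (F x))) := by
    refine tendsto_integral_of_dominated_convergence
      (fun x => (D₁ * R ^ |(m : ℝ) - Ψ|) *
        ‖Set.indicator {x | ‖x‖ ^ 2 ∈ Set.Icc a b} (magLaplacian A u) x‖) ?_ ?_ ?_ ?_
    · exact fun n => aestronglyMeasurable_of_continuousAt (hd := hd) fun x hx =>
        (contL hx (hu x hx)).mul (conjC (hΦC n x hx).continuousAt)
    · exact ((integrable_indicator_iff hS).2 huL).norm.const_mul _
    · intro n
      filter_upwards [ae_mem_offAxis hd] with x hx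
      by_cases hxs : ‖x‖ ^ 2 ∈ Set.Icc a b
      · rw [Set.indicator_of_mem (by exact hxs), norm_mul, RCLike.norm_conj, hΦF, norm_mul, mul_comm]
        refine mul_le_mul_of_nonneg_right ?_ (norm_nonneg _)
        calc _ ≤ 1 * (D₁ * R ^ |(m : ℝ) - Ψ|) :=
              mul_le_mul (hcutle _ _) (hFb x hx) (norm_nonneg _) zero_le_one
          _ = _ := one_mul _
      · rw [hΦ0 n x hxs]; simp; positivity
    · filter_upwards [ae_mem_offAxis hd] with x hx
      refine tendsto_const_nhds.congr' ?_
      filter_upwards [eventually_exp_neg_le (axisSq_pos hx)] with n hn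
      rw [hΦF, logCutoff_eq_one hn.1 hn.2.le]; simp
  -- Dominated by the bounded function Δ_A F plus the logarithmic majorant of the cutoff error. The
  -- index is shifted because the cutoff has log ρ divided by n.
  have lim2 : Tendsto (fun n => ∫ x, u x * conj (magLaplacian A (Φ (n + 1)) x)) atTop
      (𝓝 (∫ x, u x * conj (magLaplacian A F x))) := by
    refine tendsto_integral_of_dominated_convergence
      (fun x => |M| * (Set.indicator (Metric.closedBall 0 R)
        (fun _ => D₂ * R ^ |(m : ℝ) - Ψ|) x +
          C₃ * (32 * C₁ * B + 16 * B * C₂) * logSing hd R x)) ?_ ?_ ?_ ?_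
    · exact fun n => aestronglyMeasurable_of_continuousAt (hd := hd) fun x hx =>
        (hu x hx).continuousAt.mul (conjC (contL hx (hΦC (n + 1) x hx)))
    · refine (Integrable.add ?_ ((integrable_logSing hd R).const_mul _)).const_mul _
      exact (integrable_indicator_iff Metric.isClosed_closedBall.measurableSet).2
        (integrableOn_const measure_closedBall_lt_top.ne)
    · intro n
      filter_upwards [ae_mem_offAxis hd] with x hx
      by_cases hxs : ‖x‖ ^ 2 ∈ Set.Icc a b
      · have hxR := hxle x hxs
        rw [norm_mul, RCLike.norm_conj]
        refine mul_le_mul ((huM x hx hxs).trans (le_abs_self M)) ?_ (norm_nonneg _) (abs_nonneg M)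
        rw [hΦ, hA]
        simp only []
        rw [magLaplacian_cutoff hP hQ hφ n.succ_pos hx]
        refine (norm_add_le _ _).trans (add_le_add ?_ ?_)
        · rw [Set.indicator_of_mem (by simpa using hxR), norm_mul]
          calc _ ≤ 1 * (D₂ * R ^ |(m : ℝ) - Ψ|) :=
              mul_le_mul (hcutle _ _) (hLF x hx hxR) (norm_nonneg _) zero_le_one
            _ = _ := one_mul _
        · exact norm_cutoffError_le (fun t ht => hsupp t (hnot t ht))
            (fun t ht => hsupp1 t (hnot t ht)) (by linarith) hC1 hC2 hC3' hB0 hB1 hB2 hB3 hB4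
            n.succ_pos hx
      · rw [hLΦ0 _ x hx hxs]
        simp only [map_zero, mul_zero, norm_zero]
        have h1 : 0 ≤ C₁ := (abs_nonneg _).trans (hC1 0)
        have h2 : 0 ≤ C₂ := (abs_nonneg _).trans (hC2 0)
        have h3 := logSing_nonneg hd R x
        have h4 : 0 ≤ Set.indicator (Metric.closedBall 0 R)
          (fun _ => D₂ * R ^ |(m : ℝ) - Ψ|) x := Set.indicator_nonneg (fun _ _ => by positivity) x
        positivity
    · filter_upwards [ae_mem_offAxis hd] with x hx
      refine tendsto_const_nhds.congr' ?_
      filter_upwards [(tendsto_add_atTop_nat 1).eventually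
        (eventually_exp_neg_le (axisSq_pos hx))] with n hn
      rw [hΦ, hA]
      simp only []
      rw [magLaplacian_cutoff hP hQ hφ n.succ_pos hx, logCutoff_eq_one hn.1 hn.2.le,
        cutoffError_eq_zero hn.1 hn.2 hB3 hB4]
      simp [hF]
  refine tendsto_nhds_unique (lim1.comp (tendsto_add_atTop_nat 1)) (lim2.congr fun n => ?_)
  exact (hgreen (n + 1) n.succ_pos).symm

end GreenSeparated

end AharonovBohm

namespace AharonovBohm

open MeasureTheory Filter Topology

/-! ### Logarithmic polar coordinates -/

section LogPolar

/-- The unit sphere. -/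
abbrev Sph (d : ℕ) : Type := Metric.sphere (0 : Space d) 1

/-- The surface measure on the unit sphere. -/
noncomputable abbrev sphMeasure (d : ℕ) : Measure (Sph d) := (volume : Measure (Space d)).toSphere

/-- Logarithmic polar coordinates. -/
noncomputable def logPolar {d : ℕ} (p : ℝ × Sph d) : Space d := Real.exp p.1 • (p.2 : Space d)

variable {d : ℕ}

theorem continuous_logPolar : Continuous (logPolar (d := d)) :=
  (Real.continuous_exp.comp continuous_fst).smul (continuous_subtype_val.comp continuous_snd)

theorem norm_logPolar (p : ℝ × Sph d) : ‖logPolar p‖ = Real.exp p.1 := by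
  rw [logPolar, norm_smul, Real.norm_of_nonneg (Real.exp_pos _).le, norm_eq_of_mem_sphere, mul_one]

theorem injective_logPolar : Function.Injective (logPolar (d := d)) := by
  rintro ⟨t, w⟩ ⟨s, w'⟩ h
  have h1 : t = s := by
    have := congrArg norm h
    rw [norm_logPolar, norm_logPolar] at this
    exact Real.exp_injective this
  subst h1
  have h2 : (w : Space d) = w' := by
    have h' : Real.exp t • (w : Space d) = Real.exp t • (w' : Space d) := h
    exact smul_right_injective _ (Real.exp_pos t).ne' h'
  rw [Subtype.ext h2]

theorem measurableEmbedding_logPolar : MeasurableEmbedding (logPolar (d := d)) :=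
  continuous_logPolar.measurableEmbedding injective_logPolar

/-- Polar coordinates followed by r = e^t, which turns r^{d-1} dr into e^{dt} dt. -/
theorem lintegral_logPolar (hd : 2 ≤ d) {F : Space d → ℝ≥0∞} (hF : Measurable F) :
    ∫⁻ x, F x = ∫⁻ p, ENNReal.ofReal (Real.exp (d * p.1)) * F (logPolar p)
      ∂((volume : Measure ℝ).prod (sphMeasure d)) := by
  have : Nontrivial (Fin d) := Fin.nontrivial_iff_two_le.2 hd
  have : Nonempty (Fin d) := ⟨idxP hd⟩
  have hdim : Module.finrank ℝ (Space d) = d := by simp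
  have hmF : Measurable fun p : ℝ × Sph d =>
      ENNReal.ofReal (Real.exp (d * p.1)) * F (logPolar p) :=
    ((Real.measurable_exp.comp (measurable_fst.const_mul _)).ennreal_ofReal).mul
      (hF.comp continuous_logPolar.measurable)
  have hm2 : Measurable fun p : Sph d × Set.Ioi (0 : ℝ) => F (p.2.1 • (p.1 : Space d)) := by
    refine hF.comp (Continuous.measurable ?_)
    fun_prop
  calc ∫⁻ x, F x = ∫⁻ x in {0}ᶜ, F x := by
        rw [restrict_compl_singleton]
    _ = ∫⁻ x : ({0}ᶜ : Set (Space d)), F (x : Space d) 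
          ∂((volume : Measure (Space d)).comap (Subtype.val : ({0}ᶜ : Set (Space d)) → Space d)) :=
        (lintegral_subtype_comap (measurableSet_singleton _).compl F).symm
    _ = ∫⁻ p : Sph d × Set.Ioi (0 : ℝ), F (p.2.1 • (p.1 : Space d))
          ∂((sphMeasure d).prod (Measure.volumeIoiPow (d - 1))) := by
        have h := (volume : Measure (Space d)).measurePreserving_homeomorphUnitSphereProd.lintegral_comp
          (f := fun p : Sph d × Set.Ioi (0 : ℝ) => F (p.2.1 • (p.1 : Space d))) hm2
        rw [hdim] at h
        rw [← h]
        refine lintegral_congr fun x => ?_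
        congr 1
        have hx : ‖(x : Space d)‖ ≠ 0 := norm_ne_zero_iff.2 x.2
        simp [smul_smul, mul_inv_cancel₀ hx]
    _ = ∫⁻ w, ∫⁻ r, F (r.1 • (w : Space d)) ∂(Measure.volumeIoiPow (d - 1)) ∂(sphMeasure d) :=
        lintegral_prod _ hm2.aemeasurable
    _ = ∫⁻ w, ∫⁻ t, ENNReal.ofReal (Real.exp (d * t)) * F (logPolar (t, w)) ∂volume
          ∂(sphMeasure d) := by
        refine lintegral_congr fun w => ?_
        have hmw : Measurable fun r : Set.Ioi (0 : ℝ) => F (r.1 • (w : Space d)) :=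
          hF.comp (by fun_prop)
        rw [Measure.volumeIoiPow, lintegral_withDensity_eq_lintegral_mul _ (by fun_prop) hmw]
        simp only [Pi.mul_apply]
        rw [lintegral_subtype_comap measurableSet_Ioi
          (fun r : ℝ => ENNReal.ofReal (r ^ (d - 1)) * F (r • (w : Space d)))]
        have himg : Set.Ioi (0 : ℝ) = Real.exp '' Set.univ := by
          rw [Set.image_univ, Real.range_exp]
        rw [himg, lintegral_image_eq_lintegral_abs_deriv_mul MeasurableSet.univ
          (fun t _ => (Real.hasDerivAt_exp t).hasDerivWithinAt) Real.exp_injective.injOn,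
          Measure.restrict_univ]
        refine lintegral_congr fun t => ?_
        rw [← mul_assoc, ← ENNReal.ofReal_mul (abs_nonneg _), abs_of_pos (Real.exp_pos t),
          ← pow_succ', Nat.sub_add_cancel (by omega), ← Real.exp_nat_mul]
        rfl
    _ = _ := by
        rw [lintegral_prod_symm _ hmF.aemeasurable]

theorem measurePreserving_logPolar (hd : 2 ≤ d) : MeasurePreserving (logPolar (d := d))
    (((volume : Measure ℝ).prod (sphMeasure d)).withDensity
      fun p => ((Real.exp (d * p.1)).toNNReal : ℝ≥0∞)) volume := by
  refine ⟨continuous_logPolar.measurable, Measure.ext fun s hs => ?_⟩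
  have hm : Measurable fun p : ℝ × Sph d => ((Real.exp (d * p.1)).toNNReal : ℝ≥0∞) :=
    (Real.measurable_exp.comp (measurable_fst.const_mul _)).ennreal_ofReal
  rw [Measure.map_apply continuous_logPolar.measurable hs,
    withDensity_apply _ (continuous_logPolar.measurable hs), ← lintegral_indicator_one hs,
    lintegral_logPolar hd (measurable_one.indicator hs),
    ← lintegral_indicator (continuous_logPolar.measurable hs)]
  refine lintegral_congr fun p => ?_
  by_cases h : logPolar p ∈ s
  · simp [Set.indicator, h, ENNReal.ofReal]
  · simp [Set.indicator, h]

/-- The density e^{dt} is positive, so null sets such as the axis pull back to null sets of the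
product measure. -/
theorem quasiMeasurePreserving_logPolar (hd : 2 ≤ d) :
    Measure.QuasiMeasurePreserving (logPolar (d := d))
      ((volume : Measure ℝ).prod (sphMeasure d)) volume := by
  have hm : Measurable fun p : ℝ × Sph d => ((Real.exp (d * p.1)).toNNReal : ℝ≥0∞) :=
    (Real.measurable_exp.comp (measurable_fst.const_mul _)).ennreal_ofReal
  refine (measurePreserving_logPolar hd).quasiMeasurePreserving.mono_left ?_
  exact withDensity_absolutelyContinuous' hm.aemeasurable
    (Eventually.of_forall fun p => by simp [Real.exp_pos])

variable {F : Type*} [NormedAddCommGroup F] [NormedSpace ℝ F]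

theorem integrable_logPolar_iff (hd : 2 ≤ d) {f : Space d → F} :
    Integrable (fun p : ℝ × Sph d => Real.exp (d * p.1) • f (logPolar p))
      ((volume : Measure ℝ).prod (sphMeasure d)) ↔ Integrable f := by
  have hm : Measurable fun p : ℝ × Sph d => (Real.exp (d * p.1)).toNNReal :=
    (Real.measurable_exp.comp (measurable_fst.const_mul _)).real_toNNReal
  rw [← (measurePreserving_logPolar hd).integrable_comp_emb measurableEmbedding_logPolar,
    integrable_withDensity_iff_integrable_smul hm]
  refine integrable_congr (Eventually.of_forall fun p => ?_)
  simp [NNReal.smul_def, (Real.exp_pos _).le]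

theorem integral_logPolar (hd : 2 ≤ d) (f : Space d → F) :
    ∫ x, f x = ∫ p, Real.exp (d * p.1) • f (logPolar p)
      ∂((volume : Measure ℝ).prod (sphMeasure d)) := by
  have hm : Measurable fun p : ℝ × Sph d => (Real.exp (d * p.1)).toNNReal :=
    (Real.measurable_exp.comp (measurable_fst.const_mul _)).real_toNNReal
  rw [← (measurePreserving_logPolar hd).integral_comp measurableEmbedding_logPolar,
    integral_withDensity_eq_integral_smul hm]
  refine integral_congr_ae (Eventually.of_forall fun p => ?_)
  simp [NNReal.smul_def, (Real.exp_pos _).le]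

end LogPolar

end AharonovBohm

namespace AharonovBohm

open MeasureTheory Filter Topology

/-! ### Homogeneous functions and their magnetic Laplacians -/

section HarmonicFactors

open scoped ComplexConjugate

variable {d : ℕ} {hd : 2 ≤ d} {Ψ : ℝ} {m : ℤ} {c : Fin d → ℝ} {k j : ℕ}

/-- The homogeneous functions `X^k r^{2j} r^|m - Ψ| e^{imθ}`. -/
noncomputable def homFn (hd : 2 ≤ d) (Ψ : ℝ) (m : ℤ) (c : Fin d → ℝ) (k j : ℕ) : Space d → ℂ :=
  separated hd Ψ m c k (fun y => y ^ j) fun _ => 1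

/-- The magnetic Laplacian of `homFn`. -/
noncomputable def lapHomFn (hd : 2 ≤ d) (Ψ : ℝ) (m : ℤ) (c : Fin d → ℝ) (k j : ℕ)
    (x : Space d) : ℂ :=
  ((k * (k - 1 : ℕ) * (∑ l, c l ^ 2) : ℝ) : ℂ) * homFn hd Ψ m c (k - 2) j x
    + ((4 * j * (j + |m - Ψ|) : ℝ) : ℂ) * homFn hd Ψ m c k (j - 1) x

/-- The degree of homogeneity of `homFn`. -/
noncomputable def homDegree (Ψ : ℝ) (m : ℤ) (k j : ℕ) : ℝ := |m - Ψ| + k + 2 * j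

theorem homFn_apply (x : Space d) : homFn hd Ψ m c k j x =
    ((linForm c x ^ k * axisSq hd x ^ j : ℝ) : ℂ) * angular hd Ψ m x := by
  simp [homFn, separated]

theorem pow_radial {ν y : ℝ} (j : ℕ) :
    4 * y * deriv (deriv fun y : ℝ => y ^ j) y + 4 * (1 + ν) * deriv (fun y : ℝ => y ^ j) y =
      4 * j * (j + ν) * y ^ (j - 1) := by
  rw [deriv_deriv_pow, show deriv (fun y : ℝ => y ^ j) y = j * y ^ (j - 1) by simp]
  rcases j with _ | _ | j
  · simp
  · simp
  · simp only [Nat.add_sub_cancel]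
    push_cast
    ring

/-- All cross terms between h(|x|²) and the homogeneous factor merge, by Euler's relation, into
4κh', where κ is the degree. -/
theorem magLaplacian_separated_eq {h : ℝ → ℝ} {x : Space d} (hP : c (idxP hd) = 0)
    (hQ : c (idxQ hd) = 0) (hx : x ∈ offAxis hd) (hh : ContDiffAt ℝ 2 h (‖x‖ ^ 2)) :
    magLaplacian (potential d hd Ψ) (separated hd Ψ m c k (fun y => y ^ j) h) x =
      ((4 * ‖x‖ ^ 2 * deriv (deriv h) (‖x‖ ^ 2)
        + (2 * d + 4 * homDegree Ψ m k j) * deriv h (‖x‖ ^ 2) : ℝ) : ℂ) * homFn hd Ψ m c k j x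
      + (h (‖x‖ ^ 2) : ℂ) * lapHomFn hd Ψ m c k j x := by
  have hpj : ContDiffAt ℝ 2 (fun y : ℝ => y ^ j) (axisSq hd x) := contDiffAt_id.pow j
  have hj : axisSq hd x * deriv (fun y : ℝ => y ^ j) (axisSq hd x) = j * axisSq hd x ^ j := by
    rw [show deriv (fun y : ℝ => y ^ j) (axisSq hd x) = j * axisSq hd x ^ (j - 1) by simp]
    rcases j with _ | j
    · simp
    · rw [Nat.add_sub_cancel]; ring
  rw [magLaplacian_separated hP hQ hx hpj hh, pow_radial, lapHomFn, homFn_apply, homFn_apply,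
    homFn_apply, homDegree, Nat.sub_sub, one_add_one_eq_two]
  push_cast
  have hj' : (axisSq hd x : ℂ) * ((deriv (fun y : ℝ => y ^ j) (axisSq hd x) : ℝ) : ℂ) =
      j * (axisSq hd x : ℂ) ^ j := by exact_mod_cast hj
  linear_combination (8 * ((deriv h (‖x‖ ^ 2) : ℝ) : ℂ) * (linForm c x : ℂ) ^ k *
    angular hd Ψ m x) * hj'

theorem magLaplacian_homFn {x : Space d} (hP : c (idxP hd) = 0)
    (hQ : c (idxQ hd) = 0) (hx : x ∈ offAxis hd) :
    magLaplacian (potential d hd Ψ) (homFn hd Ψ m c k j) x = lapHomFn hd Ψ m c k j x := by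
  rw [homFn, magLaplacian_separated_eq hP hQ hx contDiffAt_const]
  simp

theorem axisSq_smul (s : ℝ) (x : Space d) : axisSq hd (s • x) = s ^ 2 * axisSq hd x := by
  simp [axisSq]; ring

theorem planeCoord_smul (s : ℝ) (x : Space d) : planeCoord hd (s • x) = s * planeCoord hd x := by
  simp [planeCoord]; ring

theorem linForm_smul (s : ℝ) (x : Space d) : linForm c (s • x) = s * linForm c x := by
  simp only [linForm, Finset.mul_sum]
  exact Finset.sum_congr rfl fun l _ => by simp; ring

theorem angular_exp_smul (t : ℝ) (x : Space d) : angular hd Ψ m (Real.exp t • x) =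
    (Real.exp (|(m : ℝ) - Ψ| * t) : ℂ) * angular hd Ψ m x := by
  have h1 : (Real.exp t : ℂ) ^ m = ((Real.exp (m * t) : ℝ) : ℂ) := by
    rw [← Complex.ofReal_zpow, ← Real.rpow_intCast, ← Real.exp_mul, mul_comm]
  rw [angular, angular, axisSq_smul, planeCoord_smul, mul_zpow, h1,
    Real.mul_rpow (by positivity) (axisSq_nonneg hd x), ← Real.exp_nat_mul, ← Real.exp_mul]
  have h2 : Real.exp (|(m : ℝ) - Ψ| * t) =
      Real.exp ((2 : ℕ) * t * ((|(m : ℝ) - Ψ| - m) / 2)) * Real.exp (m * t) := by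
    rw [← Real.exp_add]; congr 1; push_cast; ring
  rw [h2]; push_cast; ring

theorem homFn_exp_smul (t : ℝ) (x : Space d) : homFn hd Ψ m c k j (Real.exp t • x) =
    (Real.exp (homDegree Ψ m k j * t) : ℂ) * homFn hd Ψ m c k j x := by
  rw [homFn_apply, homFn_apply, angular_exp_smul, linForm_smul, axisSq_smul]
  have h2 : Real.exp (homDegree Ψ m k j * t) =
      Real.exp (|(m : ℝ) - Ψ| * t) * (Real.exp t ^ k * (Real.exp t ^ 2) ^ j) := by
    rw [← Real.exp_nat_mul, ← Real.exp_nat_mul, ← Real.exp_nat_mul, ← Real.exp_add,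
      ← Real.exp_add, homDegree]
    congr 1; push_cast; ring
  rw [h2]; push_cast; ring

theorem lapHomFn_exp_smul (t : ℝ) (x : Space d) : lapHomFn hd Ψ m c k j (Real.exp t • x) =
    (Real.exp ((homDegree Ψ m k j - 2) * t) : ℂ) * lapHomFn hd Ψ m c k j x := by
  simp only [lapHomFn, homFn_exp_smul]
  -- For k ≤ 1 the truncated index k - 2 does not have degree κ - 2, but then the coefficient is
  -- zero; likewise for j = 0 in the next identity.
  have h1 : ((k * (k - 1 : ℕ) * (∑ l, c l ^ 2) : ℝ) : ℂ) * (Real.exp (homDegree Ψ m (k - 2) j * t))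
      = ((k * (k - 1 : ℕ) * (∑ l, c l ^ 2) : ℝ) : ℂ) *
        (Real.exp ((homDegree Ψ m k j - 2) * t)) := by
    rcases k with _ | _ | k
    · simp
    · simp
    · congr 4; simp [homDegree]; ring
  have h2 : ((4 * j * (j + |m - Ψ|) : ℝ) : ℂ) * (Real.exp (homDegree Ψ m k (j - 1) * t))
      = ((4 * j * (j + |m - Ψ|) : ℝ) : ℂ) * (Real.exp ((homDegree Ψ m k j - 2) * t)) := by
    rcases j with _ | j
    · simp
    · congr 4; simp [homDegree]; ring
  rw [← mul_assoc, h1, ← mul_assoc, h2]; ring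

theorem measurable_homFn : Measurable (homFn hd Ψ m c k j) := by
  have h1 : Measurable (axisSq hd) := (contDiff_axisSq hd (n := 0)).continuous.measurable
  have h2 : Measurable (linForm c) := (contDiff_linForm c (n := 0)).continuous.measurable
  have h3 : Measurable (planeCoord hd) := (contDiff_planeCoord hd (n := 0)).continuous.measurable
  have h4 : Measurable fun x => planeCoord hd x ^ m := by
    rcases m with n | n
    · simpa using h3.pow_const n
    · simp only [zpow_negSucc]
      exact (h3.pow_const (n + 1)).inv
  have h5 : homFn hd Ψ m c k j = fun x =>
    ((linForm c x ^ k * axisSq hd x ^ j : ℝ) : ℂ) * angular hd Ψ m x := by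
    ext x; rw [homFn_apply]
  rw [h5]
  unfold angular
  exact (Complex.measurable_ofReal.comp ((h2.pow_const k).mul (h1.pow_const j))).mul
    ((Complex.measurable_ofReal.comp (h1.pow_const _)).mul h4)

theorem measurable_lapHomFn : Measurable (lapHomFn hd Ψ m c k j) :=
  (measurable_homFn.const_mul _).add (measurable_homFn.const_mul _)

theorem exists_bound_homFn (R : ℝ) : ∃ C, 0 ≤ C ∧ ∀ x ∈ offAxis hd, ‖x‖ ≤ R →
    ‖homFn hd Ψ m c k j x‖ ≤ C := by
  obtain ⟨C, hC0, hC⟩ := exists_bound_closedBall (f := fun x => linForm c x ^ k * axisSq hd x ^ j)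
    (((contDiff_linForm c (n := 0)).continuous.pow k).mul
      ((contDiff_axisSq hd (n := 0)).continuous.pow j)) R
  refine ⟨C * max R 1 ^ |(m : ℝ) - Ψ|, by positivity, fun x hx hxR => ?_⟩
  rw [homFn_apply, norm_mul, Complex.norm_real]
  exact mul_le_mul (hC x hxR) (norm_angular_le (le_max_right _ _) hx (hxR.trans (le_max_left _ _)))
    (norm_nonneg _) hC0

theorem exists_bound_lapHomFn (R : ℝ) : ∃ C, 0 ≤ C ∧ ∀ x ∈ offAxis hd, ‖x‖ ≤ R →
    ‖lapHomFn hd Ψ m c k j x‖ ≤ C := by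
  obtain ⟨C, hC0, hC⟩ := exists_bound_homFn (hd := hd) (Ψ := Ψ) (m := m) (c := c) (k := k - 2)
    (j := j) R
  obtain ⟨D, hD0, hD⟩ := exists_bound_homFn (hd := hd) (Ψ := Ψ) (m := m) (c := c) (k := k)
    (j := j - 1) R
  refine ⟨‖((k * (k - 1 : ℕ) * (∑ l, c l ^ 2) : ℝ) : ℂ)‖ * C +
    ‖((4 * j * (j + |m - Ψ|) : ℝ) : ℂ)‖ * D, by positivity, fun x hx hxR => ?_⟩
  rw [lapHomFn]
  refine (norm_add_le _ _).trans ?_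
  rw [norm_mul, norm_mul]
  gcongr
  · exact hC x hx hxR
  · exact hD x hx hxR

theorem contDiffAt_homFn {x : Space d} (hx : x ∈ offAxis hd) {n : WithTop ℕ∞} :
    ContDiffAt ℝ n (homFn hd Ψ m c k j) x :=
  contDiffAt_separated hx (contDiffAt_id.pow j) contDiffAt_const

/-- By Fubini almost every sphere meets the axis in a null set, and since the axis is a cone one
such sphere is enough. -/
theorem ae_sph_mem_offAxis (hd : 2 ≤ d) :
    ∀ᵐ w : Sph d ∂(sphMeasure d), (w : Space d) ∈ offAxis hd := by
  have h : ∀ᵐ p ∂((volume : Measure ℝ).prod (sphMeasure d)), logPolar p ∈ offAxis hd :=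
    (quasiMeasurePreserving_logPolar hd).tendsto_ae.eventually (ae_mem_offAxis hd)
  have h2 : ∀ᵐ t, ∀ᵐ w ∂(sphMeasure d), logPolar (t, w) ∈ offAxis hd :=
    Measure.ae_ae_of_ae_prod h
  obtain ⟨t, ht⟩ := h2.exists
  filter_upwards [ht] with w hw
  have hw' : axisSq hd (Real.exp t • (w : Space d)) ≠ 0 := hw
  rw [axisSq_smul] at hw'
  exact right_ne_zero_of_mul hw'

end HarmonicFactors

/-! ### Radial profiles in logarithmic coordinates -/

section RadialTest

/-- A radial profile in the variable `s = |x|²` with prescribed values in logarithmic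
coordinates. -/
noncomputable def radialProfile (η : ℝ → ℝ) (β s : ℝ) : ℝ :=
  if 0 < s then η (Real.log s / 2) * Real.exp (-(β * (Real.log s / 2))) else 0

variable {η : ℝ → ℝ} {β : ℝ}

theorem radialProfile_exp (t : ℝ) :
    radialProfile η β (Real.exp t ^ 2) = η t * Real.exp (-(β * t)) := by
  rw [radialProfile, if_pos (by positivity), Real.log_pow, Real.log_exp]
  congr 2 <;> simp

theorem radialProfile_eventuallyEq {s : ℝ} (hs : 0 < s) : radialProfile η β =ᶠ[𝓝 s]
    fun s => η (Real.log s / 2) * Real.exp (-(β * (Real.log s / 2))) := by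
  filter_upwards [lt_mem_nhds hs] with y hy
  rw [radialProfile, if_pos hy]

theorem contDiffAt_radialProfile (hη : ContDiff ℝ 2 η) {s : ℝ} (hs : 0 < s) :
    ContDiffAt ℝ 2 (radialProfile η β) s := by
  refine ContDiffAt.congr_of_eventuallyEq ?_ (radialProfile_eventuallyEq hs)
  have hl : ContDiffAt ℝ 2 (fun s => Real.log s / 2) s :=
    (Real.contDiffAt_log.2 hs.ne').div_const _
  exact (hη.contDiffAt.comp s hl).mul
    (Real.contDiff_exp.contDiffAt.comp s (contDiffAt_const.mul hl).neg)

theorem radialProfile_support {T : ℝ} (hT : ∀ t, T < |t| → η t = 0) :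
    ∀ s ∉ Set.Icc (Real.exp (-(2 * T))) (Real.exp (2 * T)), radialProfile η β s = 0 := by
  intro s hs
  unfold radialProfile
  split_ifs with h
  · rw [hT, zero_mul]
    by_contra hcon
    have := abs_le.1 (not_lt.1 hcon)
    refine hs ⟨?_, ?_⟩
    · rw [← Real.le_log_iff_exp_le h]; linarith
    · rw [← Real.log_le_iff_le_exp h]; linarith
  · rfl

theorem contDiff_radialProfile (hη : ContDiff ℝ 2 η) {T : ℝ} (hT : ∀ t, T < |t| → η t = 0) :
    ContDiff ℝ 2 (radialProfile η β) := by
  rw [contDiff_iff_contDiffAt]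
  intro s
  rcases lt_or_ge 0 s with h | h
  · exact contDiffAt_radialProfile hη h
  · have : radialProfile η β =ᶠ[𝓝 s] fun _ => 0 := by
      filter_upwards [gt_mem_nhds (h.trans_lt (Real.exp_pos (-(2 * T))))] with y hy
      exact radialProfile_support hT y fun h => absurd h.1 (not_le.2 hy)
    exact contDiffAt_const.congr_of_eventuallyEq this

/-- Under s = e^{2t} the operator s(4s∂_s² + K∂_s) becomes ∂_t² + (K/2 - 2)∂_t, and conjugation by
e^{-βt} replaces ∂_t by ∂_t - β. -/
theorem radialProfile_operator (hη : ContDiff ℝ 2 η) (K : ℝ) (t : ℝ) :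
    Real.exp (2 * t) * (4 * Real.exp t ^ 2 * deriv (deriv (radialProfile η β)) (Real.exp t ^ 2)
        + K * deriv (radialProfile η β) (Real.exp t ^ 2)) =
      Real.exp (-(β * t)) * (deriv (deriv η) t + (K / 2 - 2 - 2 * β) * deriv η t
        + (β ^ 2 - (K / 2 - 2) * β) * η t) := by
  set h := radialProfile η β with hh
  have hsq : ∀ t, Real.exp t ^ 2 = Real.exp (2 * t) := fun t => by
    rw [← Real.exp_nat_mul]; norm_num
  have hC : ∀ s, 0 < s → ContDiffAt ℝ 2 h s := fun s hs => contDiffAt_radialProfile hη hs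
  have hder : ∀ t, HasDerivAt (fun t => Real.exp (2 * t)) (2 * Real.exp (2 * t)) t := fun t => by
    have := ((hasDerivAt_id t).const_mul 2).exp
    refine this.congr_deriv ?_
    simp; ring
  have hη1 : ∀ t, HasDerivAt η (deriv η t) t := fun t =>
    (hη.differentiable (by norm_num) t).hasDerivAt
  have hη2 : ∀ t, HasDerivAt (deriv η) (deriv (deriv η) t) t := fun t =>
    ((deriv_contDiffAt (m := 1) hη.contDiffAt (by norm_num)).differentiableAt (by simp)).hasDerivAt
  have hexp : ∀ t, HasDerivAt (fun t => Real.exp (-(β * t))) (-β * Real.exp (-(β * t))) t :=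
    fun t => by
    have := (((hasDerivAt_id t).const_mul β).neg).exp
    refine this.congr_deriv ?_
    simp; ring
  have hH : (fun t => h (Real.exp (2 * t))) = fun t => η t * Real.exp (-(β * t)) := by
    ext t; rw [← hsq, hh, radialProfile_exp]
  have e1 : ∀ t, 2 * Real.exp (2 * t) * deriv h (Real.exp (2 * t)) =
      (deriv η t - β * η t) * Real.exp (-(β * t)) := by
    intro t
    have h1 := (((hC _ (Real.exp_pos (2 * t))).differentiableAt (by simp)).hasDerivAt.comp t
      (hder t))
    have h2 : HasDerivAt (fun t => h (Real.exp (2 * t))) _ t := h1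
    rw [hH] at h2
    have h3 := h2.unique ((hη1 t).fun_mul (hexp t))
    linarith
  have e2 : 4 * Real.exp (2 * t) * deriv h (Real.exp (2 * t))
      + 4 * Real.exp (2 * t) * Real.exp (2 * t) * deriv (deriv h) (Real.exp (2 * t)) =
      (deriv (deriv η) t - 2 * β * deriv η t + β ^ 2 * η t) * Real.exp (-(β * t)) := by
    have hd2 := (((deriv_contDiffAt (m := 1) (hC _ (Real.exp_pos (2 * t)))
      (by norm_num)).differentiableAt (by simp)).hasDerivAt.comp t (hder t))
    have h1 : HasDerivAt (fun t => deriv h (Real.exp (2 * t))) _ t := hd2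
    have h2 := ((hder t).const_mul 2).fun_mul h1
    have h3 : (fun t => 2 * Real.exp (2 * t) * deriv h (Real.exp (2 * t))) =
      fun t => (deriv η t - β * η t) * Real.exp (-(β * t)) := funext e1
    rw [h3] at h2
    have h4 := h2.unique (((hη2 t).fun_sub ((hη1 t).const_mul β)).fun_mul (hexp t))
    linarith
  have e1' := e1 t
  rw [hsq]
  linear_combination e2 + (K / 2 - 2) * e1'

end RadialTest

end AharonovBohm

namespace AharonovBohm

open MeasureTheory Filter Topology

/-! ### The weak form of the radial equation -/

section WeakIdentity

open scoped ComplexConjugate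

variable {d : ℕ} {hd : 2 ≤ d} {Ψ : ℝ} {m : ℤ} {c : Fin d → ℝ} {k j : ℕ}

theorem separated_eq_mul_homFn (h : ℝ → ℝ) (x : Space d) :
    separated hd Ψ m c k (fun y => y ^ j) h x = (h (‖x‖ ^ 2) : ℂ) * homFn hd Ψ m c k j x := by
  rw [homFn_apply, separated]; push_cast; ring

/-- In logarithmic polar coordinates the magnetic Laplacian acts on the coefficient of a function
with respect to a homogeneous function of degree `κ` as an ordinary differential operator. -/
theorem integral_logPolar_magLaplacian (hP : c (idxP hd) = 0) (hQ : c (idxQ hd) = 0)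
    {u : Space d → ℂ} (hu : ∀ x ∈ offAxis hd, ContDiffAt ℝ 2 u x)
    (hub : ∀ a b : ℝ, 0 < a → ∃ M, ∀ x ∈ offAxis hd, ‖x‖ ^ 2 ∈ Set.Icc a b → ‖u x‖ ≤ M)
    (huL : ∀ a b : ℝ, 0 < a →
      IntegrableOn (magLaplacian (potential d hd Ψ) u) {x | ‖x‖ ^ 2 ∈ Set.Icc a b})
    {η : ℝ → ℝ} (hη : ContDiff ℝ 2 η) (hηc : HasCompactSupport η) :
    ∫ p, ((η p.1 * Real.exp (2 * p.1) : ℝ) : ℂ) *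
        magLaplacian (potential d hd Ψ) u (logPolar p) * conj (homFn hd Ψ m c k j p.2)
        ∂((volume : Measure ℝ).prod (sphMeasure d)) =
      ∫ p, u (logPolar p) * conj (((deriv (deriv η) p.1 - (d - 2) * deriv η p.1
          - homDegree Ψ m k j * (homDegree Ψ m k j + d - 2) * η p.1 : ℝ) : ℂ) *
            homFn hd Ψ m c k j p.2 + (η p.1 : ℂ) * lapHomFn hd Ψ m c k j p.2)
        ∂((volume : Measure ℝ).prod (sphMeasure d)) := by
  obtain ⟨T, hT⟩ := hηc.isCompact.isBounded.exists_norm_le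
  have hT' : ∀ t, T < |t| → η t = 0 := fun t ht => by
    by_contra h
    exact absurd (hT t (subset_tsupport _ h)) (not_le.2 ht)
  set κ := homDegree Ψ m k j with hκ
  -- Chosen so that the volume factor e^{dt}, the profile e^{-βt} and the homogeneous factor e^{κt}
  -- multiply to e^{2t}. The first-order coefficient then becomes -(d - 2) and the zeroth-order one
  -- -κ(κ + d - 2).
  set β : ℝ := d + κ - 2 with hβ
  obtain ⟨M, hM⟩ := hub _ (Real.exp (2 * T)) (Real.exp_pos (-(2 * T)))
  have hG := integral_magLaplacian_mul_conj_separated (m := m) (k := k) (j := j) hP hQ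
    (contDiff_radialProfile (β := β) hη hT') (radialProfile_support hT') hu hM
    (huL _ _ (Real.exp_pos _))
  rw [integral_logPolar hd, integral_logPolar hd] at hG
  have hexp2 : ∀ t, Real.exp t ^ 2 = Real.exp (2 * t) := fun t => by
    rw [← Real.exp_nat_mul]; norm_num
  convert hG using 1
  · refine integral_congr_ae (Eventually.of_forall fun p => ?_)
    simp only [separated_eq_mul_homFn, norm_logPolar, radialProfile_exp]
    have h1 : homFn hd Ψ m c k j (logPolar p) = _ := homFn_exp_smul p.1 (p.2 : Space d)
    have h2 : Real.exp (2 * p.1) = Real.exp (d * p.1) * (Real.exp (-(β * p.1)) *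
        Real.exp (κ * p.1)) := by
      rw [← Real.exp_add, ← Real.exp_add]; congr 1; rw [hβ]; ring
    rw [h1, ← hκ, h2, Complex.real_smul]
    simp only [map_mul, Complex.conj_ofReal]
    push_cast
    ring
  · have hae : ∀ᵐ p ∂((volume : Measure ℝ).prod (sphMeasure d)), logPolar p ∈ offAxis hd :=
      (quasiMeasurePreserving_logPolar hd).tendsto_ae.eventually (ae_mem_offAxis hd)
    refine integral_congr_ae ?_
    filter_upwards [hae] with p hp
    have hh : ContDiffAt ℝ 2 (radialProfile η β) (‖logPolar p‖ ^ 2) :=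
      (contDiff_radialProfile hη hT').contDiffAt
    rw [magLaplacian_separated_eq hP hQ hp hh, norm_logPolar, radialProfile_exp]
    have h1 : homFn hd Ψ m c k j (logPolar p) = _ := homFn_exp_smul p.1 (p.2 : Space d)
    have h2 : lapHomFn hd Ψ m c k j (logPolar p) = _ := lapHomFn_exp_smul p.1 (p.2 : Space d)
    rw [h1, h2, ← hκ]
    have h3 := radialProfile_operator (β := β) hη (2 * d + 4 * κ) p.1
    have h4 : 4 * Real.exp p.1 ^ 2 * deriv (deriv (radialProfile η β)) (Real.exp p.1 ^ 2)
        + (2 * d + 4 * κ) * deriv (radialProfile η β) (Real.exp p.1 ^ 2) =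
        Real.exp (-(β * p.1)) * Real.exp (-(2 * p.1)) * (deriv (deriv η) p.1
          - (d - 2) * deriv η p.1 - κ * (κ + d - 2) * η p.1) := by
      have h5 : Real.exp (-(2 * p.1)) * Real.exp (2 * p.1) = 1 := by
        rw [← Real.exp_add]; simp
      have h6 : deriv (deriv η) p.1 - (d - 2) * deriv η p.1 - κ * (κ + d - 2) * η p.1 =
        deriv (deriv η) p.1 + ((2 * d + 4 * κ) / 2 - 2 - 2 * β) * deriv η p.1
          + (β ^ 2 - ((2 * d + 4 * κ) / 2 - 2) * β) * η p.1 := by rw [hβ]; ring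
      rw [h6]
      linear_combination Real.exp (-(2 * p.1)) * h3 -
        (4 * Real.exp p.1 ^ 2 * deriv (deriv (radialProfile η β)) (Real.exp p.1 ^ 2)
        + (2 * d + 4 * κ) * deriv (radialProfile η β) (Real.exp p.1 ^ 2)) * h5
    rw [h4, Complex.real_smul]
    have e1 : (1 : ℝ) = Real.exp (d * p.1) * (Real.exp (-(β * p.1)) * Real.exp (-(2 * p.1)) *
        Real.exp (κ * p.1)) := by
      rw [← Real.exp_add, ← Real.exp_add, ← Real.exp_add, ← Real.exp_zero]
      congr 1; rw [hβ]; ring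
    have e2 : (1 : ℝ) = Real.exp (d * p.1) * (Real.exp (-(β * p.1)) *
        Real.exp ((κ - 2) * p.1)) := by
      rw [← Real.exp_add, ← Real.exp_add, ← Real.exp_zero]
      congr 1; rw [hβ]; ring
    have e1' := congrArg (fun r : ℝ => (r : ℂ)) e1
    have e2' := congrArg (fun r : ℝ => (r : ℂ)) e2
    simp only [Complex.ofReal_mul, Complex.ofReal_one] at e1' e2'
    simp only [map_add, map_mul, Complex.conj_ofReal, Complex.ofReal_mul]
    linear_combination (u (logPolar p) * (((deriv (deriv η) p.1 - (d - 2) * deriv η p.1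
      - κ * (κ + d - 2) * η p.1 : ℝ) : ℂ) * conj (homFn hd Ψ m c k j p.2))) * e1' +
      (u (logPolar p) * ((η p.1 : ℂ) * conj (lapHomFn hd Ψ m c k j p.2))) * e2'

end WeakIdentity

end AharonovBohm

namespace AharonovBohm

open MeasureTheory Filter Topology

/-! ### Symmetry of the spherical operator -/

section Symmetry

open scoped ComplexConjugate

variable {d : ℕ} {hd : 2 ≤ d} {Ψ : ℝ} {m m' : ℤ} {c c' : Fin d → ℝ} {k k' j j' : ℕ}

theorem norm_sph (w : Sph d) : ‖(w : Space d)‖ = 1 := norm_eq_of_mem_sphere w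

theorem exists_ae_bound_homFn_sph : ∃ C, 0 ≤ C ∧ ∀ᵐ w : Sph d ∂(sphMeasure d),
    ‖homFn hd Ψ m c k j w‖ ≤ C := by
  obtain ⟨C, hC0, hC⟩ := exists_bound_homFn (hd := hd) (Ψ := Ψ) (m := m) (c := c) (k := k)
    (j := j) 1
  refine ⟨C, hC0, ?_⟩
  filter_upwards [ae_sph_mem_offAxis hd] with w hw using hC _ hw (norm_sph w).le

theorem exists_ae_bound_lapHomFn_sph : ∃ C, 0 ≤ C ∧ ∀ᵐ w : Sph d ∂(sphMeasure d),
    ‖lapHomFn hd Ψ m c k j w‖ ≤ C := by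
  obtain ⟨C, hC0, hC⟩ := exists_bound_lapHomFn (hd := hd) (Ψ := Ψ) (m := m) (c := c) (k := k)
    (j := j) 1
  refine ⟨C, hC0, ?_⟩
  filter_upwards [ae_sph_mem_offAxis hd] with w hw using hC _ hw (norm_sph w).le

theorem measurable_homFn_sph : Measurable fun w : Sph d => homFn hd Ψ m c k j w :=
  measurable_homFn.comp measurable_subtype_coe

theorem measurable_lapHomFn_sph : Measurable fun w : Sph d => lapHomFn hd Ψ m c k j w :=
  measurable_lapHomFn.comp measurable_subtype_coe

theorem integrable_mul_conj_of_bound {f g : Sph d → ℂ} (hf : Measurable f) (hg : Measurable g)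
    (hfb : ∃ C, 0 ≤ C ∧ ∀ᵐ w ∂(sphMeasure d), ‖f w‖ ≤ C)
    (hgb : ∃ C, 0 ≤ C ∧ ∀ᵐ w ∂(sphMeasure d), ‖g w‖ ≤ C) :
    Integrable (fun w => f w * conj (g w)) (sphMeasure d) := by
  obtain ⟨C, hC0, hC⟩ := hfb
  obtain ⟨D, hD0, hD⟩ := hgb
  refine Integrable.of_bound (C := C * D)
    (hf.mul (Complex.continuous_conj.measurable.comp hg)).aestronglyMeasurable ?_
  filter_upwards [hC, hD] with w h1 h2
  rw [norm_mul, RCLike.norm_conj]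
  exact mul_le_mul h1 h2 (norm_nonneg _) hC0

theorem le_abs_add_one_sq {x b : ℝ} (hx : 0 ≤ x) (h : x ^ 2 ≤ b) : x ≤ |b| + 1 := by
  nlinarith [le_abs_self b, abs_nonneg b]

theorem integrableOn_annulus_of_bound {f : Space d → ℂ} (hf : AEStronglyMeasurable f volume)
    (hb : ∀ R : ℝ, ∃ C, ∀ᵐ x : Space d, ‖x‖ ≤ R → ‖f x‖ ≤ C) (a b : ℝ) :
    IntegrableOn f {x | ‖x‖ ^ 2 ∈ Set.Icc a b} := by
  obtain ⟨C, hC⟩ := hb (|b| + 1)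
  have hS : {x : Space d | ‖x‖ ^ 2 ∈ Set.Icc a b} ⊆ Metric.closedBall 0 (|b| + 1) := fun x hx => by
    simpa using le_abs_add_one_sq (norm_nonneg x) hx.2
  have hm : MeasurableSet {x : Space d | ‖x‖ ^ 2 ∈ Set.Icc a b} :=
    (continuous_norm.pow 2).measurable measurableSet_Icc
  refine Measure.integrableOn_of_bounded (M := C) ?_ hf ?_
  · exact ((measure_mono hS).trans_lt measure_closedBall_lt_top).ne
  · rw [ae_restrict_iff' hm]
    filter_upwards [hC] with x hx hxs
    exact hx (by simpa using hS hxs)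

theorem integral_deriv_eq_zero_of_compact {f : ℝ → ℝ} (hf : ContDiff ℝ 1 f)
    (hc : HasCompactSupport f) : ∫ t, deriv f t = 0 :=
  integral_eq_zero_of_hasDerivAt_of_integrable
    (fun t => (hf.differentiable (by simp) t).hasDerivAt)
    ((hf.continuous_deriv (by simp)).integrable_of_hasCompactSupport hc.deriv)
    (hf.continuous.integrable_of_hasCompactSupport hc)

/-- On the sphere, κ(κ + d - 2)e - Δ_A e is the spherical operator Λ applied to a homogeneous e of
degree κ, and this is its symmetry. It is the weak identity with u itself homogeneous, after which
the variable t integrates out. -/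
theorem integral_lapHomFn_mul_conj (hP : c (idxP hd) = 0) (hQ : c (idxQ hd) = 0)
    (hP' : c' (idxP hd) = 0) (hQ' : c' (idxQ hd) = 0) :
    ∫ w, lapHomFn hd Ψ m' c' k' j' w * conj (homFn hd Ψ m c k j w) ∂(sphMeasure d) =
      ((homDegree Ψ m' k' j' * (homDegree Ψ m' k' j' + d - 2)
        - homDegree Ψ m k j * (homDegree Ψ m k j + d - 2) : ℝ) : ℂ) *
        ∫ w, homFn hd Ψ m' c' k' j' w * conj (homFn hd Ψ m c k j w) ∂(sphMeasure d)
      + ∫ w, homFn hd Ψ m' c' k' j' w * conj (lapHomFn hd Ψ m c k j w) ∂(sphMeasure d) := by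
  set κ := homDegree Ψ m k j with hκ
  set κ' := homDegree Ψ m' k' j' with hκ'
  set f : ContDiffBump (0 : ℝ) := default
  have hf : ContDiff ℝ 2 f := f.contDiff
  have hfc : HasCompactSupport f := f.hasCompactSupport
  have hfi : 0 < ∫ t, f t := f.integral_pos
  -- The exponential cancels the growth e^{κ't} of u, leaving the nonzero number ∫ f as a common
  -- factor.
  set η : ℝ → ℝ := fun t => f t * Real.exp (-(κ' * t)) with hη
  have hexp : ∀ t, HasDerivAt (fun t => Real.exp (-(κ' * t))) (-κ' * Real.exp (-(κ' * t))) t :=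
    fun t => by
    have := (((hasDerivAt_id t).const_mul κ').neg).exp
    refine this.congr_deriv ?_
    simp; ring
  have hf1 : ∀ t, HasDerivAt f (deriv f t) t := fun t =>
    (hf.differentiable (by norm_num) t).hasDerivAt
  have hfC1 : ContDiff ℝ 1 (deriv f) := contDiff_iff_contDiffAt.2 fun t =>
    deriv_contDiffAt hf.contDiffAt (by norm_num)
  have hf2 : ∀ t, HasDerivAt (deriv f) (deriv (deriv f) t) t := fun t =>
    (hfC1.differentiable (by simp) t).hasDerivAt
  have hη1 : deriv η = fun t => (deriv f t - κ' * f t) * Real.exp (-(κ' * t)) := by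
    ext t
    rw [((hf1 t).fun_mul (hexp t)).deriv]; ring
  have hη2 : deriv (deriv η) = fun t =>
      (deriv (deriv f) t - 2 * κ' * deriv f t + κ' ^ 2 * f t) * Real.exp (-(κ' * t)) := by
    ext t
    rw [hη1, (((hf2 t).fun_sub ((hf1 t).const_mul κ')).fun_mul (hexp t)).deriv]; ring
  have hηC : ContDiff ℝ 2 η := hf.mul (Real.contDiff_exp.comp (contDiff_const.mul contDiff_id).neg)
  have hηc : HasCompactSupport η := hfc.mul_right
  have hmain := integral_logPolar_magLaplacian (Ψ := Ψ) (m := m) (k := k) (j := j) hP hQ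
    (u := homFn hd Ψ m' c' k' j') (fun x hx => contDiffAt_homFn hx) ?_ ?_ hηC hηc
  rotate_left
  · intro a b _
    obtain ⟨C, _, hC⟩ := exists_bound_homFn (hd := hd) (Ψ := Ψ) (m := m') (c := c') (k := k')
      (j := j') (|b| + 1)
    exact ⟨C, fun x hx hxs => hC x hx (le_abs_add_one_sq (norm_nonneg x) hxs.2)⟩
  · intro a b _
    refine integrableOn_annulus_of_bound ?_ ?_ a b
    · refine aestronglyMeasurable_of_continuousAt (hd := hd) fun x hx => ?_
      exact (contDiffAt_magLaplacian (n := 0) (contDiffAt_potential hd Ψ hx)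
        (contDiffAt_homFn hx (n := 2)) (by norm_num)).continuousAt
    · intro R
      obtain ⟨C, _, hC⟩ := exists_bound_lapHomFn (hd := hd) (Ψ := Ψ) (m := m') (c := c') (k := k')
        (j := j') R
      refine ⟨C, ?_⟩
      filter_upwards [ae_mem_offAxis hd] with x hx hxR
      rw [magLaplacian_homFn hP' hQ' hx]
      exact hC x hx hxR
  have hexpm : ∀ t, Real.exp (-(κ' * t)) * Real.exp (κ' * t) = 1 := fun t => by
    rw [← Real.exp_add]; simp
  have hae : ∀ᵐ p ∂((volume : Measure ℝ).prod (sphMeasure d)), logPolar p ∈ offAxis hd :=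
    (quasiMeasurePreserving_logPolar hd).tendsto_ae.eventually (ae_mem_offAxis hd)
  have hL : ∫ p, ((η p.1 * Real.exp (2 * p.1) : ℝ) : ℂ) *
        magLaplacian (potential d hd Ψ) (homFn hd Ψ m' c' k' j') (logPolar p) *
          conj (homFn hd Ψ m c k j p.2) ∂((volume : Measure ℝ).prod (sphMeasure d)) =
      ((∫ t, f t : ℝ) : ℂ) *
        ∫ w, lapHomFn hd Ψ m' c' k' j' w * conj (homFn hd Ψ m c k j w) ∂(sphMeasure d) := by
    have hcast : ((∫ t, f t : ℝ) : ℂ) = ∫ t, (f t : ℂ) := integral_complex_ofReal.symm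
    rw [hcast, ← integral_prod_mul (L := ℂ)]
    refine integral_congr_ae ?_
    filter_upwards [hae] with p hp
    have h2 : lapHomFn hd Ψ m' c' k' j' (logPolar p) = _ := lapHomFn_exp_smul p.1 (p.2 : Space d)
    rw [magLaplacian_homFn hP' hQ' hp, h2]
    have h3 : η p.1 * Real.exp (2 * p.1) * Real.exp ((κ' - 2) * p.1) = f p.1 := by
      have h4 : Real.exp (2 * p.1) * Real.exp ((κ' - 2) * p.1) = Real.exp (κ' * p.1) := by
        rw [← Real.exp_add]; congr 1; ring
      rw [mul_assoc, h4, hη]; simp only []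
      rw [mul_assoc, hexpm, mul_one]
    have h3' : ((η p.1 * Real.exp (2 * p.1) : ℝ) : ℂ) * (Real.exp ((κ' - 2) * p.1) : ℂ) =
        (f p.1 : ℂ) := by rw [← h3]; push_cast; ring
    rw [← hκ']
    linear_combination (lapHomFn hd Ψ m' c' k' j' p.2 * conj (homFn hd Ψ m c k j p.2)) * h3'
  -- The integrals of f' and f'' vanish, so only the zeroth-order coefficient of `g` survives.
  set g : ℝ → ℝ := fun t => deriv (deriv f) t - (2 * κ' + (d - 2)) * deriv f t
    + (κ' * (κ' + d - 2) - κ * (κ + d - 2)) * f t with hg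
  have i0 : Integrable f := hf.continuous.integrable_of_hasCompactSupport hfc
  have i1 : Integrable (deriv f) := hfC1.continuous.integrable_of_hasCompactSupport hfc.deriv
  have i2 : Integrable (deriv (deriv f)) :=
    (hfC1.continuous_deriv (by simp)).integrable_of_hasCompactSupport hfc.deriv.deriv
  have ig : Integrable g := (i2.sub (i1.const_mul _)).add (i0.const_mul _)
  have hgint : ∫ t, g t = (κ' * (κ' + d - 2) - κ * (κ + d - 2)) * ∫ t, f t := by
    have i21 : Integrable fun t => deriv (deriv f) t - (2 * κ' + (d - 2)) * deriv f t :=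
      i2.sub (i1.const_mul _)
    rw [hg, integral_add i21 (i0.const_mul _),
      integral_sub i2 (i1.const_mul _), integral_const_mul, integral_const_mul,
      integral_deriv_eq_zero_of_compact hfC1 hfc.deriv,
      integral_deriv_eq_zero_of_compact (hf.of_le (by norm_num)) hfc]
    ring
  have hR : ∫ p, homFn hd Ψ m' c' k' j' (logPolar p) * conj (((deriv (deriv η) p.1
        - (d - 2) * deriv η p.1 - κ * (κ + d - 2) * η p.1 : ℝ) : ℂ) *
            homFn hd Ψ m c k j p.2 + (η p.1 : ℂ) * lapHomFn hd Ψ m c k j p.2)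
        ∂((volume : Measure ℝ).prod (sphMeasure d)) =
      ((∫ t, g t : ℝ) : ℂ) *
        (∫ w, homFn hd Ψ m' c' k' j' w * conj (homFn hd Ψ m c k j w) ∂(sphMeasure d))
      + ((∫ t, f t : ℝ) : ℂ) *
        ∫ w, homFn hd Ψ m' c' k' j' w * conj (lapHomFn hd Ψ m c k j w) ∂(sphMeasure d) := by
    have hcast : ((∫ t, f t : ℝ) : ℂ) = ∫ t, (f t : ℂ) := integral_complex_ofReal.symm
    have hcast' : ((∫ t, g t : ℝ) : ℂ) = ∫ t, (g t : ℂ) := integral_complex_ofReal.symm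
    rw [hcast, hcast', ← integral_prod_mul (L := ℂ),
      ← integral_prod_mul (L := ℂ), ← integral_add]
    · refine integral_congr_ae (Eventually.of_forall fun p => ?_)
      have h2 : homFn hd Ψ m' c' k' j' (logPolar p) = _ := homFn_exp_smul p.1 (p.2 : Space d)
      have h3 : Real.exp (κ' * p.1) * (deriv (deriv η) p.1
        - (d - 2) * deriv η p.1 - κ * (κ + d - 2) * η p.1) = g p.1 := by
        rw [hη2, hη1, hη, hg]
        linear_combination (deriv (deriv f) p.1 - (2 * κ' + (d - 2)) * deriv f p.1
          + (κ' * (κ' + d - 2) - κ * (κ + d - 2)) * f p.1) * hexpm p.1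
      have h4 : Real.exp (κ' * p.1) * η p.1 = f p.1 := by
        rw [hη]; linear_combination f p.1 * hexpm p.1
      simp only []
      rw [h2, ← hκ', ← h3, ← h4, map_add, map_mul, map_mul, Complex.conj_ofReal,
        Complex.conj_ofReal]
      push_cast
      ring
    · exact Integrable.mul_prod (L := ℂ) ig.ofReal (integrable_mul_conj_of_bound
        measurable_homFn_sph measurable_homFn_sph exists_ae_bound_homFn_sph
        exists_ae_bound_homFn_sph)
    · exact Integrable.mul_prod (L := ℂ) i0.ofReal (integrable_mul_conj_of_bound
        measurable_homFn_sph measurable_lapHomFn_sph exists_ae_bound_homFn_sph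
        exists_ae_bound_lapHomFn_sph)
  rw [hL] at hmain
  rw [← hκ, hR, hgint] at hmain
  have hne : ((∫ t, f t : ℝ) : ℂ) ≠ 0 := by exact_mod_cast hfi.ne'
  refine mul_left_cancel₀ hne (hmain.trans ?_)
  push_cast
  ring

end Symmetry

end AharonovBohm

namespace AharonovBohm

open MeasureTheory Filter Topology

/-! ### Diagonalising an operator that is symmetric through a linear map -/

section SymmetricPair

variable {H W : Type*} [NormedAddCommGroup H] [InnerProductSpace ℂ H]
  [AddCommGroup W] [Module ℂ W]

/-- If `Λ` becomes symmetric after applying `T`, it can be diagonalised on the range of `T`. -/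
theorem exists_orthonormal_of_symmetric [FiniteDimensional ℂ W] (T : W →ₗ[ℂ] H) (Λ : W →ₗ[ℂ] W)
    (hsym : ∀ u v, inner ℂ (T (Λ u)) (T v) = inner ℂ (T u) (T (Λ v))) :
    ∃ (n : ℕ) (u : Fin n → W) (μ : Fin n → ℝ), Orthonormal ℂ (fun i => T (u i)) ∧
      Submodule.span ℂ (Set.range fun i => T (u i)) = LinearMap.range T ∧
      (∀ i, T (Λ (u i)) = (μ i : ℂ) • T (u i)) ∧
      ∀ i, ¬ Function.Surjective fun w => Λ w - (μ i : ℂ) • w := by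
  -- `T` may have a kernel, since the formal generators can be dependent on the sphere, so `Λ` is
  -- transported to the range of `T` through a linear section.
  obtain ⟨s, hs⟩ := T.rangeRestrict.exists_rightInverse_of_surjective T.range_rangeRestrict
  have hs' : ∀ x, T (s x) = x := fun x => congrArg Subtype.val (LinearMap.congr_fun hs x)
  set L : LinearMap.range T →ₗ[ℂ] LinearMap.range T := T.rangeRestrict ∘ₗ Λ ∘ₗ s with hL
  have hL' : ∀ x, ((L x : LinearMap.range T) : H) = T (Λ (s x)) := fun x => rfl
  have hsymm : L.IsSymmetric := fun x y => by
    rw [Submodule.coe_inner, Submodule.coe_inner, hL', hL']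
    conv_lhs => rw [← hs' y]
    conv_rhs => rw [← hs' x]
    exact hsym _ _
  set b := hsymm.eigenvectorBasis rfl with hb
  have hTu : ∀ i, T (s (b i)) = b i := fun i => hs' _
  have heig : ∀ i, T (Λ (s (b i))) = ((hsymm.eigenvalues rfl i : ℝ) : ℂ) • T (s (b i)) :=
    fun i => by
    rw [hTu, ← hL', hb, hsymm.apply_eigenvectorBasis]
    rfl
  refine ⟨_, fun i => s (b i), hsymm.eigenvalues rfl, ?_, ?_, heig, ?_⟩
  · simp only [hTu]
    exact b.orthonormal.comp_linearIsometry (LinearMap.range T).subtypeₗᵢ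
  · simp only [hTu]
    have h1 : Set.range (fun i => ((b i : LinearMap.range T) : H)) =
        (LinearMap.range T).subtype '' Set.range b := by
      rw [← Set.range_comp]; rfl
    have h2 := b.toBasis.span_eq
    rw [OrthonormalBasis.coe_toBasis] at h2
    rw [h1, ← Submodule.map_span, h2, Submodule.map_top, Submodule.range_subtype]
  · intro i hsurj
    obtain ⟨w, hw⟩ := hsurj (s (b i))
    -- If u = (Λ - μ)w, then ⟨Tu, Tu⟩ = ⟨Tw, T(Λ - μ)u⟩ = 0 by symmetry, although Tu has norm one.
    have h1 : inner ℂ (T (s (b i))) (T (s (b i))) = 0 := by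
      conv_lhs => enter [2]; rw [← hw]
      simp only [map_sub, map_smul, inner_sub_left, inner_smul_left]
      rw [hsym, heig, inner_smul_right, Complex.conj_ofReal, sub_self]
    rw [hTu, inner_self_eq_zero] at h1
    have h2 := b.orthonormal.1 i
    rw [show ‖b i‖ = ‖((b i : LinearMap.range T) : H)‖ from rfl, h1, norm_zero] at h2
    exact zero_ne_one h2

end SymmetricPair

/-! ### The spherical operator on formal combinations and its eigenvalues -/

section SphericalHarmonics

open scoped ComplexConjugate

/-- The indices `((m, ζ), (k, j))` of the homogeneous functions `homFn`. -/
abbrev HomIndex (d : ℕ) : Type := (ℤ × (Fin d → ℤ)) × (ℕ × ℕ)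

variable {d : ℕ} {hd : 2 ≤ d} {Ψ : ℝ}

/-- The integer vector `ζ` with its last two coordinates replaced by zero. -/
noncomputable def axialVec (hd : 2 ≤ d) (ζ : Fin d → ℤ) (l : Fin d) : ℝ :=
  if l = idxP hd ∨ l = idxQ hd then 0 else ζ l

theorem axialVec_idxP (ζ : Fin d → ℤ) : axialVec hd ζ (idxP hd) = 0 := by simp [axialVec]

theorem axialVec_idxQ (ζ : Fin d → ℤ) : axialVec hd ζ (idxQ hd) = 0 := by simp [axialVec]

/-- The homogeneous function of index `i`. -/
noncomputable def indexedFn (hd : 2 ≤ d) (Ψ : ℝ) (i : HomIndex d) : Space d → ℂ :=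
  homFn hd Ψ i.1.1 (axialVec hd i.1.2) i.2.1 i.2.2

/-- Its magnetic Laplacian. -/
noncomputable def indexedLap (hd : 2 ≤ d) (Ψ : ℝ) (i : HomIndex d) : Space d → ℂ :=
  lapHomFn hd Ψ i.1.1 (axialVec hd i.1.2) i.2.1 i.2.2

/-- Its degree. -/
noncomputable def indexedDegree (Ψ : ℝ) (i : HomIndex d) : ℝ := homDegree Ψ i.1.1 i.2.1 i.2.2

/-- The space of square integrable functions on the sphere. -/
abbrev SphL2 (d : ℕ) : Type := Lp ℂ 2 (sphMeasure d)

theorem memLp_of_ae_bound {f : Sph d → ℂ} (hf : Measurable f)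
    (hb : ∃ C, 0 ≤ C ∧ ∀ᵐ w ∂(sphMeasure d), ‖f w‖ ≤ C) (p : ℝ≥0∞) :
    MemLp f p (sphMeasure d) := by
  obtain ⟨C, -, hC⟩ := hb
  exact MemLp.of_bound hf.aestronglyMeasurable C hC

theorem memLp_indexedFn (i : HomIndex d) (p : ℝ≥0∞) :
    MemLp (fun w : Sph d => indexedFn hd Ψ i w) p (sphMeasure d) :=
  memLp_of_ae_bound measurable_homFn_sph exists_ae_bound_homFn_sph p

theorem memLp_indexedLap (i : HomIndex d) (p : ℝ≥0∞) :
    MemLp (fun w : Sph d => indexedLap hd Ψ i w) p (sphMeasure d) :=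
  memLp_of_ae_bound measurable_lapHomFn_sph exists_ae_bound_lapHomFn_sph p

/-- The restriction of `indexedFn` to the sphere. -/
noncomputable def indexedVec (hd : 2 ≤ d) (Ψ : ℝ) (i : HomIndex d) : SphL2 d :=
  (memLp_indexedFn (hd := hd) (Ψ := Ψ) i 2).toLp

/-- Restriction of formal combinations to the sphere. -/
noncomputable def toSphL2 (hd : 2 ≤ d) (Ψ : ℝ) : (HomIndex d →₀ ℂ) →ₗ[ℂ] SphL2 d :=
  Finsupp.linearCombination ℂ (indexedVec hd Ψ)

/-- The formal magnetic Laplacian of a basis element. -/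
noncomputable def formalLap (hd : 2 ≤ d) (Ψ : ℝ) (i : HomIndex d) : HomIndex d →₀ ℂ :=
  Finsupp.single (i.1, (i.2.1 - 2, i.2.2))
      ((i.2.1 * (i.2.1 - 1 : ℕ) * (∑ l, axialVec hd i.1.2 l ^ 2) : ℝ) : ℂ)
    + Finsupp.single (i.1, (i.2.1, i.2.2 - 1)) ((4 * i.2.2 * (i.2.2 + |i.1.1 - Ψ|) : ℝ) : ℂ)

/-- The number `κ (κ + d - 2)`, where `κ` is the degree. -/
noncomputable def indexedEigenvalue (Ψ : ℝ) (i : HomIndex d) : ℝ :=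
  indexedDegree Ψ i * (indexedDegree Ψ i + d - 2)

/-- The formal spherical operator. -/
noncomputable def sphOp (hd : 2 ≤ d) (Ψ : ℝ) : (HomIndex d →₀ ℂ) →ₗ[ℂ] (HomIndex d →₀ ℂ) :=
  Finsupp.linearCombination ℂ fun i =>
    (indexedEigenvalue Ψ i : ℂ) • Finsupp.single i 1 - formalLap hd Ψ i

theorem toSphL2_single (i : HomIndex d) (a : ℂ) :
    toSphL2 hd Ψ (Finsupp.single i a) = a • indexedVec hd Ψ i := by
  simp [toSphL2]

theorem toSphL2_formalLap (i : HomIndex d) :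
    toSphL2 hd Ψ (formalLap hd Ψ i) = (memLp_indexedLap (hd := hd) (Ψ := Ψ) i 2).toLp := by
  rw [formalLap, map_add, toSphL2_single, toSphL2_single, indexedVec, indexedVec,
    ← MemLp.toLp_const_smul, ← MemLp.toLp_const_smul, ← MemLp.toLp_add]
  rfl

theorem sphOp_single (i : HomIndex d) : sphOp hd Ψ (Finsupp.single i 1) =
    (indexedEigenvalue Ψ i : ℂ) • Finsupp.single i 1 - formalLap hd Ψ i := by
  simp [sphOp]

theorem inner_toLp {f g : Sph d → ℂ} (hf : MemLp f 2 (sphMeasure d))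
    (hg : MemLp g 2 (sphMeasure d)) :
    inner ℂ hf.toLp hg.toLp = ∫ w, g w * conj (f w) ∂(sphMeasure d) := by
  rw [L2.inner_def]
  refine integral_congr_ae ?_
  filter_upwards [hf.coeFn_toLp, hg.coeFn_toLp] with w h1 h2
  rw [h1, h2]
  simp

theorem symmetric_sphOp (u v : HomIndex d →₀ ℂ) :
    inner ℂ (toSphL2 hd Ψ (sphOp hd Ψ u)) (toSphL2 hd Ψ v) =
      inner ℂ (toSphL2 hd Ψ u) (toSphL2 hd Ψ (sphOp hd Ψ v)) := by
  have key : ∀ i j : HomIndex d,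
      inner ℂ (toSphL2 hd Ψ (sphOp hd Ψ (Finsupp.single i 1))) (toSphL2 hd Ψ (Finsupp.single j 1))
        = inner ℂ (toSphL2 hd Ψ (Finsupp.single i 1))
          (toSphL2 hd Ψ (sphOp hd Ψ (Finsupp.single j 1))) := by
    intro i j
    have h := integral_lapHomFn_mul_conj (Ψ := Ψ) (m := i.1.1) (k := i.2.1) (j := i.2.2)
      (m' := j.1.1) (k' := j.2.1) (j' := j.2.2)
      (axialVec_idxP (hd := hd) i.1.2) (axialVec_idxQ (hd := hd) i.1.2)
      (axialVec_idxP (hd := hd) j.1.2) (axialVec_idxQ (hd := hd) j.1.2)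
    rw [sphOp_single, sphOp_single, map_sub, map_sub, map_smul, map_smul, toSphL2_formalLap,
      toSphL2_formalLap, toSphL2_single, toSphL2_single, one_smul, one_smul, inner_sub_left,
      inner_sub_right, inner_smul_left, inner_smul_right, Complex.conj_ofReal, indexedVec,
      indexedVec, inner_toLp, inner_toLp, inner_toLp, indexedEigenvalue, indexedEigenvalue]
    unfold indexedFn indexedLap indexedDegree
    rw [h]
    push_cast
    ring
  induction u using Finsupp.induction_linear with
  | zero => simp
  | add f g hf hg => simp only [map_add, inner_add_left, hf, hg]
  | single i a =>
    induction v using Finsupp.induction_linear with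
    | zero => simp
    | add f g hf hg => simp only [map_add, inner_add_right, hf, hg]
    | single j b =>
      have e1 : Finsupp.single i a = a • Finsupp.single i (1 : ℂ) := by simp
      have e2 : Finsupp.single j b = b • Finsupp.single j (1 : ℂ) := by simp
      rw [e1, e2]
      simp only [map_smul, inner_smul_left, inner_smul_right, key i j]

/-- The indices with `(m, ζ)` in `s` and `k + 2 j ≤ N`. -/
def boundedIndex (s : Finset (ℤ × (Fin d → ℤ))) (N : ℕ) : Set (HomIndex d) :=
  {i | i.1 ∈ s ∧ i.2.1 + 2 * i.2.2 ≤ N}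

theorem finite_boundedIndex (s : Finset (ℤ × (Fin d → ℤ))) (N : ℕ) :
    (boundedIndex s N).Finite := by
  refine (s ×ˢ (Finset.range (N + 1) ×ˢ Finset.range (N + 1))).finite_toSet.subset fun i hi => ?_
  obtain ⟨h1, h2⟩ := hi
  simp only [Finset.coe_product, Set.mem_prod, Finset.mem_coe, Finset.mem_range]
  exact ⟨h1, by omega, by omega⟩

/-- Each term keeps (m, ζ) and lowers k + 2j by two, or else has coefficient zero. The general
submodule `R` serves both the invariance of the finite families and the triangular induction. -/
theorem formalLap_mem {s : Finset (ℤ × (Fin d → ℤ))} {N : ℕ} {i : HomIndex d}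
    {R : Submodule ℂ (HomIndex d →₀ ℂ)}
    (hR : ∀ i' : HomIndex d, i' ∈ boundedIndex s N →
      i'.2.1 + 2 * i'.2.2 < i.2.1 + 2 * i.2.2 → Finsupp.single i' (1 : ℂ) ∈ R)
    (hi : i ∈ boundedIndex s N) : formalLap hd Ψ i ∈ R := by
  obtain ⟨⟨m, ζ⟩, k, j⟩ := i
  obtain ⟨h1, h2⟩ := hi
  dsimp only at h1 h2 hR
  unfold formalLap
  dsimp only
  refine R.add_mem ?_ ?_
  · rcases k with _ | _ | k
    · simp
    · simp
    · rw [← mul_one (Complex.ofReal _), ← smul_eq_mul, ← Finsupp.smul_single]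
      refine R.smul_mem _ (hR _ ⟨h1, ?_⟩ ?_)
      · dsimp only; omega
      · dsimp only; omega
  · rcases j with _ | j
    · simp
    · rw [← mul_one (Complex.ofReal _), ← smul_eq_mul, ← Finsupp.smul_single]
      refine R.smul_mem _ (hR _ ⟨h1, ?_⟩ ?_)
      · dsimp only; omega
      · dsimp only; omega

theorem sphOp_mem_supported {s : Finset (ℤ × (Fin d → ℤ))} {N : ℕ} {w : HomIndex d →₀ ℂ}
    (hw : w ∈ Finsupp.supported ℂ ℂ (boundedIndex s N)) :
    sphOp hd Ψ w ∈ Finsupp.supported ℂ ℂ (boundedIndex s N) := by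
  rw [Finsupp.supported_eq_span_single] at hw
  refine Submodule.span_induction ?_ ?_ ?_ ?_ hw
  · rintro _ ⟨i, hi, rfl⟩
    rw [sphOp_single]
    exact Submodule.sub_mem _ (Submodule.smul_mem _ _ (Finsupp.single_mem_supported ℂ 1 hi))
      (formalLap_mem (fun i' hi' _ => Finsupp.single_mem_supported ℂ 1 hi') hi)
  · simp
  · intro x y _ _ hx hy
    rw [map_add]
    exact Submodule.add_mem _ hx hy
  · intro a x _ hx
    rw [map_smul]
    exact Submodule.smul_mem _ _ hx

/-- Back substitution: ordered by k + 2j the operator is triangular with diagonal entries κ(κ + d -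
2), so subtracting any other scalar leaves it surjective. -/
theorem single_mem_map_sphOp_sub {s : Finset (ℤ × (Fin d → ℤ))} {N : ℕ} {μ : ℂ}
    (hμ : ∀ i : HomIndex d, (indexedEigenvalue Ψ i : ℂ) ≠ μ) {i : HomIndex d}
    (hi : i ∈ boundedIndex s N) :
    Finsupp.single i (1 : ℂ) ∈
      (Finsupp.supported ℂ ℂ (boundedIndex s N)).map
        (sphOp hd Ψ - μ • (LinearMap.id : _ →ₗ[ℂ] (HomIndex d →₀ ℂ))) := by
  set R := (Finsupp.supported ℂ ℂ (boundedIndex s N)).map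
        (sphOp hd Ψ - μ • (LinearMap.id : _ →ₗ[ℂ] (HomIndex d →₀ ℂ)))
  induction h : i.2.1 + 2 * i.2.2 using Nat.strong_induction_on generalizing i with
  | _ n ih =>
    have h1 : formalLap hd Ψ i ∈ R :=
      formalLap_mem (fun i' hi' hlt => ih _ (h ▸ hlt) hi' rfl) hi
    have h2 : (sphOp hd Ψ - μ • (LinearMap.id : _ →ₗ[ℂ] (HomIndex d →₀ ℂ)))
        (Finsupp.single i (1 : ℂ)) ∈ R :=
      Submodule.mem_map_of_mem (Finsupp.single_mem_supported ℂ 1 hi)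
    rw [LinearMap.sub_apply, sphOp_single, LinearMap.smul_apply, LinearMap.id_apply] at h2
    have h3 : ((indexedEigenvalue Ψ i : ℂ) - μ) • Finsupp.single i (1 : ℂ) ∈ R := by
      have := R.add_mem h2 h1
      rwa [sub_right_comm, sub_add_cancel, ← sub_smul] at this
    exact (Submodule.smul_mem_iff _ (sub_ne_zero.2 (hμ i))).1 h3

/-- The number κ(κ + d - 2) is invariant under κ ↦ 2 - d - κ, and κ = |m - Ψ| + k + 2j. For m ≤ Ψ
the degree κ itself has the form m' + Ψ with m' an integer, otherwise 2 - d - κ does. This accounts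
for the two branches of the index set. -/
theorem indexedEigenvalue_mem (hd : 2 ≤ d) (i : HomIndex d) :
    ∃ m ∈ indexSet d Ψ, indexedEigenvalue Ψ i = eigenvalue d Ψ m := by
  have h2 : (2 : ℝ) ≤ d := by exact_mod_cast hd
  rcases le_total ((i.1.1 : ℝ) - Ψ) 0 with h | h
  · refine ⟨i.2.1 + 2 * i.2.2 - i.1.1, Or.inr ?_, ?_⟩
    · push_cast
      have : (0 : ℝ) ≤ i.2.1 + 2 * i.2.2 := by positivity
      linarith
    · rw [indexedEigenvalue, indexedDegree, homDegree, abs_of_nonpos h, eigenvalue]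
      push_cast
      ring
  · refine ⟨2 - d - i.1.1 - (i.2.1 + 2 * i.2.2), Or.inl ?_, ?_⟩
    · push_cast
      have : (0 : ℝ) ≤ i.2.1 + 2 * i.2.2 := by positivity
      linarith
    · rw [indexedEigenvalue, indexedDegree, homDegree, abs_of_nonneg h, eigenvalue]
      push_cast
      ring

/-- The spherical operator is diagonalised on the span of finitely many homogeneous functions. -/
theorem exists_eigenbasis (hd : 2 ≤ d) (Ψ : ℝ) (s : Finset (ℤ × (Fin d → ℤ))) (N : ℕ) :
    ∃ (n : ℕ) (u : Fin n → (HomIndex d →₀ ℂ)) (μ : Fin n → ℝ),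
      Orthonormal ℂ (fun i => toSphL2 hd Ψ (u i)) ∧
      Submodule.span ℂ (Set.range fun i => toSphL2 hd Ψ (u i)) =
        (Finsupp.supported ℂ ℂ (boundedIndex s N)).map (toSphL2 hd Ψ) ∧
      (∀ i, toSphL2 hd Ψ (sphOp hd Ψ (u i)) = (μ i : ℂ) • toSphL2 hd Ψ (u i)) ∧
      ∀ i, ∃ m ∈ indexSet d Ψ, μ i = eigenvalue d Ψ m := by
  set W := Finsupp.supported ℂ ℂ (boundedIndex (d := d) s N) with hW
  have : FiniteDimensional ℂ W := by
    rw [hW, Finsupp.supported_eq_span_single]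
    exact FiniteDimensional.span_of_finite ℂ ((finite_boundedIndex s N).image _)
  obtain ⟨n, u, μ, h1, h2, h3, h4⟩ := exists_orthonormal_of_symmetric (W := W)
    ((toSphL2 hd Ψ).domRestrict W)
    ((sphOp hd Ψ).restrict fun w (hw : w ∈ W) => sphOp_mem_supported hw)
    (fun u v => symmetric_sphOp (hd := hd) (Ψ := Ψ) (u : HomIndex d →₀ ℂ) v)
  refine ⟨n, fun i => u i, μ, h1, ?_, h3, fun i => ?_⟩
  · rw [← LinearMap.range_domRestrict]; exact h2
  · by_contra! hcon
    -- An eigenvalue that is no diagonal entry would make the shifted operator surjective, which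
    -- diagonalisation excludes.
    refine h4 i ?_
    have hμ : ∀ i' : HomIndex d, (indexedEigenvalue Ψ i' : ℂ) ≠ (μ i : ℂ) := by
      intro i' heq
      obtain ⟨m, hm, hm'⟩ := indexedEigenvalue_mem (Ψ := Ψ) hd i'
      exact hcon m hm (hm' ▸ (Complex.ofReal_injective heq).symm)
    have hle : W ≤ W.map (sphOp hd Ψ - (μ i : ℂ) • LinearMap.id) := by
      conv_lhs => rw [hW, Finsupp.supported_eq_span_single]
      rw [Submodule.span_le]
      rintro _ ⟨i', hi', rfl⟩
      exact single_mem_map_sphOp_sub hμ hi'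
    rintro ⟨y, hy⟩
    obtain ⟨w, hw, hwy⟩ := hle hy
    exact ⟨⟨w, hw⟩, Subtype.ext hwy⟩

end SphericalHarmonics

end AharonovBohm

namespace AharonovBohm

open MeasureTheory Filter Topology

/-! ### From vanishing moments to continuous functions -/

section Moments

variable {X : Type*} [MeasurableSpace X] {μ : Measure X}

theorem integral_polynomial_mul_eq_zero {f : X → ℂ} {τ : X → ℝ}
    (hi : ∀ k : ℕ, Integrable (fun x => ((τ x ^ k : ℝ) : ℂ) * f x) μ)
    (h : ∀ k : ℕ, ∫ x, ((τ x ^ k : ℝ) : ℂ) * f x ∂μ = 0) (P : Polynomial ℝ) :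
    ∫ x, ((P.eval (τ x) : ℝ) : ℂ) * f x ∂μ = 0 := by
  have h1 : ∀ x, ((P.eval (τ x) : ℝ) : ℂ) * f x =
      ∑ k ∈ Finset.range (P.natDegree + 1), (P.coeff k : ℂ) * (((τ x ^ k : ℝ) : ℂ) * f x) := by
    intro x
    rw [Polynomial.eval_eq_sum_range, Complex.ofReal_sum, Finset.sum_mul]
    exact Finset.sum_congr rfl fun k _ => by push_cast; ring
  simp only [h1]
  rw [integral_finsetSum _ fun k _ => (hi k).const_mul _]
  refine Finset.sum_eq_zero fun k _ => ?_
  rw [integral_const_mul, h k, mul_zero]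

/-- If all moments of `f` with respect to a bounded function `τ` vanish, then `f` is orthogonal to
every continuous function of `τ`. -/
theorem integral_comp_mul_eq_zero {f : X → ℂ} (hf : Integrable f μ) {τ : X → ℝ}
    (hτ : Measurable τ) {R : ℝ} (hR : ∀ x, |τ x| ≤ R)
    (h : ∀ k : ℕ, ∫ x, ((τ x ^ k : ℝ) : ℂ) * f x ∂μ = 0) {q : ℝ → ℝ} (hq : Continuous q) :
    ∫ x, ((q (τ x) : ℝ) : ℂ) * f x ∂μ = 0 := by
  have hint : ∀ {g : ℝ → ℝ}, Continuous g → Integrable (fun x => ((g (τ x) : ℝ) : ℂ) * f x) μ := by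
    intro g hg
    obtain ⟨C, hC⟩ := (isCompact_Icc (a := -R) (b := R)).exists_bound_of_continuousOn
      hg.continuousOn
    refine hf.bdd_mul (c := C)
      (Complex.measurable_ofReal.comp (hg.measurable.comp hτ)).aestronglyMeasurable
      (Eventually.of_forall fun x => ?_)
    rw [Complex.norm_real]
    exact hC _ (abs_le.1 (hR x))
  -- Weierstrass approximation of `q` on [-R, R] by a polynomial, against which the integral
  -- vanishes.
  have hbound : ∀ ε > 0, ‖∫ x, ((q (τ x) : ℝ) : ℂ) * f x ∂μ‖ ≤ ε * ∫ x, ‖f x‖ ∂μ := by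
    intro ε hε
    obtain ⟨P, hP⟩ := exists_polynomial_near_of_continuousOn (-R) R q hq.continuousOn ε hε
    have h1 := integral_polynomial_mul_eq_zero (fun k => hint (continuous_pow k)) h P
    have h2 : ∫ x, ((q (τ x) : ℝ) : ℂ) * f x ∂μ =
        ∫ x, ((q (τ x) : ℝ) : ℂ) * f x - ((P.eval (τ x) : ℝ) : ℂ) * f x ∂μ := by
      rw [integral_sub (hint hq) (hint P.continuous), h1, sub_zero]
    rw [h2, ← integral_const_mul]
    refine norm_integral_le_of_norm_le (hf.norm.const_mul ε) (Eventually.of_forall fun x => ?_)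
    rw [← sub_mul, norm_mul, ← Complex.ofReal_sub, Complex.norm_real, Real.norm_eq_abs, abs_sub_comm]
    exact mul_le_mul_of_nonneg_right (hP _ (abs_le.1 (hR x))).le (norm_nonneg _)
  rw [← norm_le_zero_iff]
  have hlim : Tendsto (fun ε : ℝ => ε * ∫ x, ‖f x‖ ∂μ) (𝓝[>] 0) (𝓝 0) := by
    have : Tendsto (fun ε : ℝ => ε * ∫ x, ‖f x‖ ∂μ) (𝓝 0) (𝓝 (0 * ∫ x, ‖f x‖ ∂μ)) :=
      (continuous_id.mul continuous_const).tendsto 0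
    rw [zero_mul] at this
    exact this.mono_left nhdsWithin_le_nhds
  exact ge_of_tendsto hlim (eventually_nhdsWithin_of_forall fun ε hε => hbound ε hε)

end Moments

/-! ### Completeness of the homogeneous functions on the sphere -/

section Density

open scoped ComplexConjugate

variable {d : ℕ} {hd : 2 ≤ d} {Ψ : ℝ}

/-- The monomials in the plane coordinate and its conjugate times characters of the axis. -/
noncomputable def monoChar (hd : 2 ≤ d) (a b : ℕ) (ζ : Fin d → ℤ) : C(Sph d, ℂ) where
  toFun w := planeCoord hd w ^ a * conj (planeCoord hd w) ^ b *
    Complex.exp (Complex.I * (linForm (axialVec hd ζ) w : ℂ))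
  continuous_toFun := by
    have h1 : Continuous fun w : Sph d => planeCoord hd w :=
      (contDiff_planeCoord hd (n := 0)).continuous.comp continuous_subtype_val
    have h2 : Continuous fun w : Sph d => linForm (axialVec hd ζ) w :=
      (contDiff_linForm _ (n := 0)).continuous.comp continuous_subtype_val
    exact ((h1.pow a).mul ((Complex.continuous_conj.comp h1).pow b)).mul
      (Complex.continuous_exp.comp (continuous_const.mul (Complex.continuous_ofReal.comp h2)))

theorem monoChar_apply (a b : ℕ) (ζ : Fin d → ℤ) (w : Sph d) : monoChar hd a b ζ w =
    planeCoord hd w ^ a * conj (planeCoord hd w) ^ b *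
      Complex.exp (Complex.I * (linForm (axialVec hd ζ) w : ℂ)) := rfl

theorem linForm_axialVec_add (ζ ζ' : Fin d → ℤ) (x : Space d) : linForm (axialVec hd (ζ + ζ')) x =
    linForm (axialVec hd ζ) x + linForm (axialVec hd ζ') x := by
  simp only [linForm, ← Finset.sum_add_distrib, axialVec]
  refine Finset.sum_congr rfl fun l _ => ?_
  split_ifs
  · simp
  · simp; ring

theorem linForm_axialVec_neg (ζ : Fin d → ℤ) (x : Space d) : linForm (axialVec hd (-ζ)) x =
    -linForm (axialVec hd ζ) x := by
  simp only [linForm, ← Finset.sum_neg_distrib, axialVec]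
  refine Finset.sum_congr rfl fun l _ => ?_
  split_ifs
  · simp
  · simp

theorem linForm_axialVec_zero (x : Space d) : linForm (axialVec hd 0) x = 0 := by
  simp [linForm, axialVec]

theorem linForm_axialVec_single {l : Fin d} (h1 : l ≠ idxP hd) (h2 : l ≠ idxQ hd) (x : Space d) :
    linForm (axialVec hd (Pi.single l 1)) x = x l := by
  rw [linForm, Finset.sum_eq_single l]
  · simp [axialVec, h1, h2]
  · intro j _ hj
    simp [axialVec, hj]
  · simp

theorem monoChar_mul (a b a' b' : ℕ) (ζ ζ' : Fin d → ℤ) :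
    monoChar hd a b ζ * monoChar hd a' b' ζ' = monoChar hd (a + a') (b + b') (ζ + ζ') := by
  ext w
  rw [ContinuousMap.mul_apply, monoChar_apply, monoChar_apply, monoChar_apply,
    linForm_axialVec_add, Complex.ofReal_add, mul_add, Complex.exp_add]
  ring

theorem star_monoChar (a b : ℕ) (ζ : Fin d → ℤ) :
    star (monoChar hd a b ζ) = monoChar hd b a (-ζ) := by
  ext w
  rw [ContinuousMap.star_apply, monoChar_apply, monoChar_apply, linForm_axialVec_neg]
  simp only [RCLike.star_def, map_mul, map_pow, Complex.conj_conj, ← Complex.exp_conj,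
    Complex.conj_I, Complex.conj_ofReal, Complex.ofReal_neg]
  ring_nf

theorem one_eq_monoChar : (1 : C(Sph d, ℂ)) = monoChar hd 0 0 0 := by
  ext w
  simp [monoChar_apply, linForm_axialVec_zero]

/-- The set of all these functions. -/
def monoChars (hd : 2 ≤ d) : Set C(Sph d, ℂ) :=
  Set.range fun p : (ℕ × ℕ) × (Fin d → ℤ) => monoChar hd p.1.1 p.1.2 p.2

/-- The star algebra generated by these functions. -/
noncomputable def monoCharAlgebra (hd : 2 ≤ d) : StarSubalgebra ℂ C(Sph d, ℂ) :=
  StarAlgebra.adjoin ℂ (monoChars hd)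

/-- The generators contain 1 and are closed under products and conjugation, so the algebra is merely
their linear span. -/
theorem monoCharAlgebra_subset (hd : 2 ≤ d) :
    (monoCharAlgebra hd : Set C(Sph d, ℂ)) ⊆ Submodule.span ℂ (monoChars hd) := by
  have h1 : monoChars hd ∪ star (monoChars hd) = monoChars hd := by
    refine Set.union_eq_left.2 ?_
    rintro f ⟨⟨⟨a, b⟩, ζ⟩, hf⟩
    refine ⟨((b, a), -ζ), ?_⟩
    dsimp only at hf ⊢
    rw [← star_monoChar, hf, star_star]
  have h2 : (Submonoid.closure (monoChars hd) : Set C(Sph d, ℂ)) ⊆ monoChars hd := by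
    intro f hf
    refine Submonoid.closure_induction (fun x hx => hx) ?_ ?_ hf
    · exact ⟨((0, 0), 0), one_eq_monoChar.symm⟩
    · rintro _ _ _ _ ⟨p, rfl⟩ ⟨q, rfl⟩
      exact ⟨((p.1.1 + q.1.1, p.1.2 + q.1.2), p.2 + q.2), (monoChar_mul _ _ _ _ _ _).symm⟩
  intro f hf
  have h3 : f ∈ (StarAlgebra.adjoin ℂ (monoChars hd)).toSubalgebra := hf
  rw [StarAlgebra.adjoin_toSubalgebra, h1, ← Subalgebra.mem_toSubmodule,
    Algebra.adjoin_eq_span] at h3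
  exact Submodule.span_mono h2 h3

/-- The plane coordinate z determines two coordinates. Each other coordinate is determined by e^{i
x_l}, because |x_l| ≤ 1 < π on the sphere; integer frequencies therefore suffice. -/
theorem monoCharAlgebra_separatesPoints (hd : 2 ≤ d) : (monoCharAlgebra hd).SeparatesPoints := by
  intro w w' hne
  by_contra! hcon
  have key : ∀ a b ζ, monoChar hd a b ζ w = monoChar hd a b ζ w' := fun a b ζ =>
    hcon _ ⟨_, StarAlgebra.subset_adjoin ℂ _ ⟨((a, b), ζ), rfl⟩, rfl⟩
  apply hne
  ext l
  have hz := key 1 0 0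
  simp only [monoChar_apply, linForm_axialVec_zero, pow_one, pow_zero, mul_one, Complex.ofReal_zero,
    mul_zero, Complex.exp_zero] at hz
  have hre := congrArg Complex.re hz
  have him := congrArg Complex.im hz
  simp only [planeCoord, Complex.add_re, Complex.add_im, Complex.mul_re, Complex.mul_im,
    Complex.I_re, Complex.I_im, Complex.ofReal_re, Complex.ofReal_im] at hre him
  by_cases h1 : l = idxP hd
  · subst h1; linarith
  by_cases h2 : l = idxQ hd
  · subst h2; linarith
  have he := key 0 0 (Pi.single l 1)
  simp only [monoChar_apply, pow_zero, one_mul, linForm_axialVec_single h1 h2] at he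
  have hb : ∀ w : Sph d, |(w : Space d) l| ≤ 1 := fun w => by
    have := PiLp.norm_apply_le (w : Space d) l
    rwa [norm_sph] at this
  have hb1 := abs_le.1 (hb w)
  have hb2 := abs_le.1 (hb w')
  have hpi := Real.pi_gt_three
  obtain ⟨n, hn⟩ := Complex.exp_eq_exp_iff_exists_int.1 he
  have hn' := congrArg Complex.im hn
  simp only [Complex.add_im, Complex.mul_im, Complex.I_re, Complex.I_im, Complex.ofReal_re,
    Complex.ofReal_im, Complex.intCast_re, Complex.intCast_im, Complex.mul_re, Complex.re_ofNat,
    Complex.im_ofNat] at hn'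
  have hn'' : (w : Space d) l = (w' : Space d) l + n * (2 * Real.pi) := by linarith
  have hn0 : n = 0 := by
    by_contra hn0
    rcases lt_or_gt_of_ne hn0 with h | h
    · have : (n : ℝ) ≤ -1 := by exact_mod_cast Int.le_sub_one_of_lt h
      nlinarith
    · have : (1 : ℝ) ≤ n := by exact_mod_cast h
      nlinarith
  simpa [hn0] using hn''

/-- Stone–Weierstrass, combined with the density of continuous functions in L². -/
theorem eq_zero_of_inner_monoChar {F : SphL2 d}
    (h : ∀ a b ζ, inner ℂ (ContinuousMap.toLp 2 (sphMeasure d) ℂ (monoChar hd a b ζ)) F = 0) :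
    F = 0 := by
  have hdense : Dense (monoCharAlgebra hd : Set C(Sph d, ℂ)) := by
    have := ContinuousMap.starSubalgebra_topologicalClosure_eq_top_of_separatesPoints _
      (monoCharAlgebra_separatesPoints hd)
    rw [dense_iff_closure_eq, ← StarSubalgebra.topologicalClosure_coe, this]
    rfl
  have hdense2 := (ContinuousMap.toLp_denseRange ℂ (sphMeasure d) ℂ
    (ENNReal.ofNat_ne_top (n := 2))).dense_image
    (ContinuousMap.toLp 2 (sphMeasure d) ℂ).continuous hdense
  refine Dense.eq_zero_of_inner_right ℂ hdense2 ?_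
  rintro _ ⟨f, hf, rfl⟩
  refine Submodule.span_induction (p := fun f _ =>
    inner ℂ (ContinuousMap.toLp 2 (sphMeasure d) ℂ f) F = 0) ?_ ?_ ?_ ?_
    (monoCharAlgebra_subset hd hf)
  · rintro _ ⟨p, rfl⟩
    exact h _ _ _
  · simp
  · intro x y _ _ hx hy
    rw [map_add, inner_add_left, hx, hy, add_zero]
  · intro a x _ hx
    rw [map_smul, inner_smul_left, hx, mul_zero]

theorem axisSq_sph_le (w : Sph d) : |axisSq hd w| ≤ 1 := by
  rw [abs_of_nonneg (axisSq_nonneg hd _)]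
  have := axisSq_le_norm_sq hd (w : Space d)
  rwa [norm_sph, one_pow] at this

theorem measurable_axisSq_sph : Measurable fun w : Sph d => axisSq hd w :=
  ((contDiff_axisSq hd (n := 0)).continuous.comp continuous_subtype_val).measurable

theorem measurable_linForm_sph (c : Fin d → ℝ) : Measurable fun w : Sph d => linForm c w :=
  ((contDiff_linForm c (n := 0)).continuous.comp continuous_subtype_val).measurable

/-- The monomial z^a (conj z)^b has angular frequency a - b, and comparing moduli gives the
remaining power of ρ. The factor ρ^N makes that power nonnegative for N ≥ |Ψ|/2, hence continuous in
ρ. -/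
theorem axisSq_pow_mul_planeCoord {N a b : ℕ} {x : Space d} (hx : x ∈ offAxis hd) :
    ((axisSq hd x ^ N : ℝ) : ℂ) * (planeCoord hd x ^ a * conj (planeCoord hd x) ^ b) =
      angular hd Ψ (a - b) x *
        ((axisSq hd x ^ ((a + b + 2 * N - |((a - b : ℤ) : ℝ) - Ψ|) / 2) : ℝ) : ℂ) := by
  have hz := planeCoord_ne_zero hx
  have hp := axisSq_pos hx
  have hc : conj (planeCoord hd x) = (axisSq hd x : ℂ) / planeCoord hd x := by
    rw [eq_div_iff hz, ← normSq_planeCoord, Complex.normSq_eq_conj_mul_self]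
  have h1 : axisSq hd x ^ ((|((a - b : ℤ) : ℝ) - Ψ| - (a - b : ℤ)) / 2) *
      axisSq hd x ^ ((a + b + 2 * N - |((a - b : ℤ) : ℝ) - Ψ|) / 2) = axisSq hd x ^ (b + N) := by
    rw [← Real.rpow_add hp, ← Real.rpow_natCast]
    congr 1
    push_cast
    ring
  have h1' := congrArg (Complex.ofReal) h1
  rw [Complex.ofReal_mul] at h1'
  rw [angular, mul_right_comm, h1', hc, zpow_sub₀ hz, zpow_natCast, zpow_natCast, div_pow]
  push_cast
  rw [pow_add]
  ring

theorem abs_sub_le_of_two_mul {N a b : ℕ} (hN : |Ψ| ≤ 2 * N) :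
    0 ≤ ((a + b + 2 * N - |((a - b : ℤ) : ℝ) - Ψ|) / 2 : ℝ) := by
  have h1 : |((a - b : ℤ) : ℝ) - Ψ| ≤ (a + b : ℝ) + |Ψ| := by
    push_cast
    have ha : (0 : ℝ) ≤ a := a.cast_nonneg
    have hb : (0 : ℝ) ≤ b := b.cast_nonneg
    rw [abs_le]
    constructor <;> linarith [le_abs_self Ψ, neg_abs_le Ψ]
  linarith

theorem exists_linForm_bound (c : Fin d → ℝ) : ∃ R, ∀ w : Sph d, |linForm c w| ≤ R := by
  obtain ⟨C, -, hC⟩ := exists_bound_closedBall (f := linForm c)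
    (contDiff_linForm c (n := 0)).continuous 1
  exact ⟨C, fun w => hC _ (norm_sph w).le⟩

/-- The homogeneous functions are complete in the space of square integrable functions. -/
theorem eq_zero_of_inner_indexedVec {F : SphL2 d}
    (h : ∀ i, inner ℂ (indexedVec hd Ψ i) F = 0) : F = 0 := by
  have hF2 : MemLp F 2 (sphMeasure d) := Lp.memLp F
  obtain ⟨N, hN⟩ := exists_nat_ge |Ψ|
  have hN2 : |Ψ| ≤ 2 * (N : ℝ) := by linarith [(N.cast_nonneg : (0 : ℝ) ≤ N)]
  have hcoef : ∀ m ζ (k j : ℕ), ∫ w, ((axisSq hd w ^ j : ℝ) : ℂ) *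
      (((linForm (axialVec hd ζ) w ^ k : ℝ) : ℂ) * (conj (angular hd Ψ m w) * F w))
        ∂(sphMeasure d) = 0 := by
    intro m ζ k j
    have h1 := h ((m, ζ), (k, j))
    rw [L2.inner_def] at h1
    rw [← h1]
    refine integral_congr_ae ?_
    filter_upwards [(memLp_indexedFn (hd := hd) (Ψ := Ψ) ((m, ζ), (k, j)) 2).coeFn_toLp] with w hw
    rw [indexedVec, hw, indexedFn, homFn_apply]
    simp only [RCLike.inner_apply, map_mul, Complex.conj_ofReal]
    push_cast
    ring
  have hang : ∀ m, Integrable (fun w : Sph d => conj (angular hd Ψ m w) * F w) (sphMeasure d) := by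
    intro m
    have h1 := memLp_indexedFn (hd := hd) (Ψ := Ψ) ((m, 0), (0, 0)) 2
    refine (h1.star.integrable_mul hF2).congr (Eventually.of_forall fun w => ?_)
    simp [indexedFn, homFn_apply]
  -- The powers ρ^j are upgraded to continuous functions of ρ, and then the powers X^k to continuous
  -- functions of X.
  have hstep1 : ∀ m ζ (k : ℕ) {q : ℝ → ℝ}, Continuous q →
      ∫ w, ((linForm (axialVec hd ζ) w ^ k : ℝ) : ℂ) * (((q (axisSq hd w) : ℝ) : ℂ) *
        (conj (angular hd Ψ m w) * F w)) ∂(sphMeasure d) = 0 := by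
    intro m ζ k q hq
    obtain ⟨R, hR⟩ := exists_linForm_bound (axialVec hd ζ)
    have hi : Integrable (fun w : Sph d => ((linForm (axialVec hd ζ) w ^ k : ℝ) : ℂ) *
        (conj (angular hd Ψ m w) * F w)) (sphMeasure d) := by
      refine (hang m).bdd_mul (c := R ^ k) (Complex.measurable_ofReal.comp
        ((measurable_linForm_sph _).pow_const k)).aestronglyMeasurable
        (Eventually.of_forall fun w => ?_)
      rw [Complex.norm_real, norm_pow]
      exact pow_le_pow_left₀ (norm_nonneg _) (hR w) k
    rw [← integral_comp_mul_eq_zero hi measurable_axisSq_sph axisSq_sph_le (hcoef m ζ k) hq]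
    exact integral_congr_ae (Eventually.of_forall fun w => by ring)
  have hstep2 : ∀ m ζ {q p : ℝ → ℝ}, Continuous q → Continuous p →
      ∫ w, ((p (linForm (axialVec hd ζ) w) : ℝ) : ℂ) * (((q (axisSq hd w) : ℝ) : ℂ) *
        (conj (angular hd Ψ m w) * F w)) ∂(sphMeasure d) = 0 ∧
      Integrable (fun w : Sph d => ((p (linForm (axialVec hd ζ) w) : ℝ) : ℂ) *
        (((q (axisSq hd w) : ℝ) : ℂ) * (conj (angular hd Ψ m w) * F w))) (sphMeasure d) := by
    intro m ζ q p hq hp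
    obtain ⟨R, hR⟩ := exists_linForm_bound (axialVec hd ζ)
    have hi : Integrable (fun w : Sph d => ((q (axisSq hd w) : ℝ) : ℂ) *
        (conj (angular hd Ψ m w) * F w)) (sphMeasure d) := by
      obtain ⟨C, hC⟩ := (isCompact_Icc (a := (-1 : ℝ)) (b := 1)).exists_bound_of_continuousOn
        hq.continuousOn
      refine (hang m).bdd_mul (c := C) (Complex.measurable_ofReal.comp
        (hq.measurable.comp measurable_axisSq_sph)).aestronglyMeasurable
        (Eventually.of_forall fun w => ?_)
      rw [Complex.norm_real]
      exact hC _ (abs_le.1 (axisSq_sph_le w))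
    refine ⟨integral_comp_mul_eq_zero hi (measurable_linForm_sph _) hR
      (fun k => hstep1 m ζ k hq) hp, ?_⟩
    obtain ⟨C, hC⟩ := (isCompact_Icc (a := -R) (b := R)).exists_bound_of_continuousOn
      hp.continuousOn
    refine hi.bdd_mul (c := C) (Complex.measurable_ofReal.comp
      (hp.measurable.comp (measurable_linForm_sph _))).aestronglyMeasurable
      (Eventually.of_forall fun w => ?_)
    rw [Complex.norm_real]
    exact hC _ (abs_le.1 (hR w))
  have hG2 : MemLp (fun w : Sph d => ((axisSq hd w ^ N : ℝ) : ℂ) * F w) 2 (sphMeasure d) := by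
    refine hF2.of_le_mul (c := 1) ((Complex.measurable_ofReal.comp
      (measurable_axisSq_sph.pow_const N)).aestronglyMeasurable.mul hF2.1)
      (Eventually.of_forall fun w => ?_)
    rw [norm_mul, Complex.norm_real, norm_pow]
    exact mul_le_mul_of_nonneg_right (pow_le_one₀ (norm_nonneg _) (axisSq_sph_le w))
      (norm_nonneg _)
  -- ρ^N F rather than F is tested: against it every monomial times a character reduces to the
  -- previous step, with cos and sin as functions of X. Off the axis ρ^N can be divided out again.
  have hG0 : hG2.toLp = 0 := by
    refine eq_zero_of_inner_monoChar (hd := hd) fun a b ζ => ?_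
    set s : ℝ := (a + b + 2 * N - |((a - b : ℤ) : ℝ) - Ψ|) / 2 with hs
    have hs0 : 0 ≤ s := abs_sub_le_of_two_mul hN2
    have hq : Continuous fun y : ℝ => y ^ s := Real.continuous_rpow_const hs0
    obtain ⟨hcos, icos⟩ := hstep2 (a - b) ζ hq Real.continuous_cos
    obtain ⟨hsin, isin⟩ := hstep2 (a - b) ζ hq Real.continuous_sin
    rw [L2.inner_def]
    have hval : ∀ᵐ w : Sph d ∂(sphMeasure d),
        inner ℂ ((ContinuousMap.toLp 2 (sphMeasure d) ℂ (monoChar hd a b ζ)) w) ((hG2.toLp : SphL2 d) w) =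
        ((Real.cos (linForm (axialVec hd ζ) w) : ℝ) : ℂ) * (((axisSq hd w ^ s : ℝ) : ℂ) *
          (conj (angular hd Ψ (a - b) w) * F w)) -
        Complex.I * (((Real.sin (linForm (axialVec hd ζ) w) : ℝ) : ℂ) *
          (((axisSq hd w ^ s : ℝ) : ℂ) * (conj (angular hd Ψ (a - b) w) * F w))) := by
      filter_upwards [hG2.coeFn_toLp, ContinuousMap.coeFn_toLp (𝕜 := ℂ) (p := 2) (sphMeasure d)
        (monoChar hd a b ζ), ae_sph_mem_offAxis hd] with w h1 h2 h3
      rw [h1, h2, monoChar_apply]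
      have h4 := congrArg conj (axisSq_pow_mul_planeCoord (Ψ := Ψ) (N := N) (a := a) (b := b) h3)
      rw [← hs] at h4
      simp only [map_mul, map_pow, Complex.conj_ofReal, Complex.conj_conj] at h4
      have h5 : Complex.exp (-(Complex.I * (linForm (axialVec hd ζ) w : ℂ))) =
          ((Real.cos (linForm (axialVec hd ζ) w) : ℝ) : ℂ)
            - Complex.I * ((Real.sin (linForm (axialVec hd ζ) w) : ℝ) : ℂ) := by
        rw [show -(Complex.I * (linForm (axialVec hd ζ) w : ℂ)) =
          ((-linForm (axialVec hd ζ) w : ℝ) : ℂ) * Complex.I by push_cast; ring,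
          Complex.exp_mul_I, ← Complex.ofReal_cos, ← Complex.ofReal_sin, Real.cos_neg, Real.sin_neg]
        push_cast
        ring
      simp only [RCLike.inner_apply, map_mul, map_pow, Complex.conj_conj, ← Complex.exp_conj,
        Complex.conj_I, Complex.conj_ofReal, neg_mul, h5]
      linear_combination (F w * (((Real.cos (linForm (axialVec hd ζ) w) : ℝ) : ℂ)
            - Complex.I * ((Real.sin (linForm (axialVec hd ζ) w) : ℝ) : ℂ))) * h4
    rw [integral_congr_ae hval, integral_sub icos (isin.const_mul _), integral_const_mul, hcos,
      hsin, mul_zero, sub_zero]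
  have hae := (Lp.eq_zero_iff_ae_eq_zero.1 hG0)
  rw [Lp.eq_zero_iff_ae_eq_zero]
  filter_upwards [hae, hG2.coeFn_toLp, ae_sph_mem_offAxis hd] with w h1 h2 h3
  rw [h2] at h1
  have hne : ((axisSq hd w ^ N : ℝ) : ℂ) ≠ 0 := by exact_mod_cast pow_ne_zero N h3
  exact (mul_eq_zero.1 h1).resolve_left hne

end Density

end AharonovBohm

namespace AharonovBohm

open MeasureTheory Filter Topology

/-! ### Restriction to spheres and the radial equation for coefficients -/

section Slices

open scoped ComplexConjugate

variable {d : ℕ} {hd : 2 ≤ d} {Ψ : ℝ}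

theorem integrable_fun_sub {X F : Type*} [MeasurableSpace X] {μ : Measure X}
    [NormedAddCommGroup F] {f g : X → F} (hf : Integrable f μ) (hg : Integrable g μ) :
    Integrable (fun x => f x - g x) μ := hf.sub hg

open Classical in
/-- The class of a function in `L²`, and zero if it is not square integrable. -/
noncomputable def toL2 (F : Sph d → ℂ) : SphL2 d :=
  if h : MemLp F 2 (sphMeasure d) then h.toLp else 0

theorem toL2_eq {F : Sph d → ℂ} (h : MemLp F 2 (sphMeasure d)) : toL2 F = h.toLp := dif_pos h

theorem toL2_zero : toL2 (fun _ : Sph d => 0) = 0 := by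
  rw [toL2_eq (MemLp.zero' (p := 2))]
  exact MemLp.toLp_zero _

theorem inner_toL2 {F : Sph d → ℂ} (hF : MemLp F 2 (sphMeasure d)) (Φ : SphL2 d) :
    inner ℂ Φ (toL2 F) = ∫ w, F w * conj (Φ w) ∂(sphMeasure d) := by
  have h := inner_toLp (Lp.memLp Φ) hF
  rwa [Lp.toLp_coeFn, ← toL2_eq hF] at h

theorem inner_toLp_toL2 {F E : Sph d → ℂ} (hE : MemLp E 2 (sphMeasure d))
    (hF : MemLp F 2 (sphMeasure d)) :
    inner ℂ hE.toLp (toL2 F) = ∫ w, F w * conj (E w) ∂(sphMeasure d) := by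
  rw [toL2_eq hF, inner_toLp]

theorem norm_toL2_sq {F : Sph d → ℂ} (hF : MemLp F 2 (sphMeasure d)) :
    ‖toL2 F‖ ^ 2 = ∫ w, ‖F w‖ ^ 2 ∂(sphMeasure d) := by
  have h : inner ℂ (toL2 F) (toL2 F) = ∫ w, F w * conj (F w) ∂(sphMeasure d) := by
    conv_lhs => enter [2]; rw [toL2_eq hF]
    exact inner_toLp_toL2 hF hF
  have h2 : ∫ w, F w * conj (F w) ∂(sphMeasure d) =
      ((∫ w, ‖F w‖ ^ 2 ∂(sphMeasure d) : ℝ) : ℂ) := by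
    rw [← integral_complex_ofReal]
    refine integral_congr_ae (Eventually.of_forall fun w => ?_)
    simp only [Complex.mul_conj, Complex.normSq_eq_norm_sq]
  rw [h2, inner_self_eq_norm_sq_to_K] at h
  apply Complex.ofReal_injective
  rw [← h]
  simp

/-- The restriction of a function to the sphere of radius `e ^ t`, seen on the unit sphere. -/
noncomputable def slice (u : Space d → ℂ) (t : ℝ) : SphL2 d := toL2 fun w => u (logPolar (t, w))

/-- The radial derivative `x · ∇u`. -/
noncomputable def euler (u : Space d → ℂ) (x : Space d) : ℂ := fderiv ℝ u x x

theorem contDiff_euler {u : Space d → ℂ} (hu : ContDiff ℝ ∞ u) : ContDiff ℝ ∞ (euler u) :=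
  (hu.fderiv_right (m := ∞) (by simp)).clm_apply contDiff_id

theorem memLp_slice {u : Space d → ℂ} (hu : Continuous u) (t : ℝ) (p : ℝ≥0∞) :
    MemLp (fun w : Sph d => u (logPolar (t, w))) p (sphMeasure d) := by
  have hc : Continuous fun w : Sph d => u (logPolar (t, w)) :=
    hu.comp (continuous_logPolar.comp (Continuous.prodMk_right t))
  obtain ⟨C, hC⟩ := (isCompact_univ (X := Sph d)).exists_bound_of_continuousOn hc.continuousOn
  exact MemLp.of_bound hc.aestronglyMeasurable C (Eventually.of_forall fun w => hC w (Set.mem_univ _))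

/-- The velocity of t ↦ e^t w is the point itself, so ∂_t acts as x·∇. -/
theorem hasDerivAt_logPolar {u : Space d → ℂ} (hu : Differentiable ℝ u) (t : ℝ) (w : Sph d) :
    HasDerivAt (fun t => u (logPolar (t, w))) (euler u (logPolar (t, w))) t :=
  (hu (logPolar (t, w))).hasFDerivAt.comp_hasDerivAt t
    ((Real.hasDerivAt_exp t).smul_const (w : Space d))

theorem hasDerivAt_inner_slice {u : Space d → ℂ} (hu : ContDiff ℝ ∞ u) (Φ : SphL2 d) (t : ℝ) :
    HasDerivAt (fun t => inner ℂ Φ (slice u t)) (inner ℂ Φ (slice (euler u) t)) t := by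
  have hint : ∀ {v : Space d → ℂ}, Continuous v → ∀ t, Integrable
      (fun w : Sph d => v (logPolar (t, w)) * conj (Φ w)) (sphMeasure d) := fun hv t =>
    (memLp_slice hv t 2).integrable_mul (Lp.memLp Φ).star
  have hin : ∀ {v : Space d → ℂ}, Continuous v → ∀ t, inner ℂ Φ (slice v t) =
      ∫ w, v (logPolar (t, w)) * conj (Φ w) ∂(sphMeasure d) := fun hv t =>
    inner_toL2 (memLp_slice hv t 2) Φ
  have heu := contDiff_euler hu
  obtain ⟨C, hC⟩ := (isCompact_closedBall (0 : Space d)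
    (Real.exp (t + 1))).exists_bound_of_continuousOn heu.continuous.continuousOn
  rw [hin heu.continuous]
  refine HasDerivAt.congr_of_eventuallyEq ?_
    (Eventually.of_forall fun t => hin hu.continuous t)
  refine (hasDerivAt_integral_of_dominated_loc_of_deriv_le (bound := fun w => C * ‖Φ w‖)
    (F' := fun t w => euler u (logPolar (t, w)) * conj (Φ w))
    (Metric.ball_mem_nhds t one_pos)
    (Eventually.of_forall fun s => (hint hu.continuous s).aestronglyMeasurable)
    (hint hu.continuous t) (hint heu.continuous t).aestronglyMeasurable ?_ ?_ ?_).2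
  · refine Eventually.of_forall fun w s hs => ?_
    rw [norm_mul, RCLike.norm_conj]
    refine mul_le_mul_of_nonneg_right (hC _ ?_) (norm_nonneg _)
    rw [mem_closedBall_zero_iff, norm_logPolar, Real.exp_le_exp]
    have := (abs_lt.1 (Real.dist_eq s t ▸ Metric.mem_ball.1 hs)).2
    linarith
  · exact (((Lp.memLp Φ).integrable (by norm_num)).norm).const_mul C
  · exact Eventually.of_forall fun w s _ =>
      (hasDerivAt_logPolar (hu.differentiable (by simp)) s w).mul_const _

theorem continuous_inner_slice {u : Space d → ℂ} (hu : ContDiff ℝ ∞ u) (Φ : SphL2 d) :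
    Continuous fun t => inner ℂ Φ (slice u t) :=
  continuous_iff_continuousAt.2 fun t => (hasDerivAt_inner_slice hu Φ t).continuousAt

theorem slice_eq_zero {u : Space d → ℂ} {t : ℝ} (h : ∀ w : Sph d, u (logPolar (t, w)) = 0) :
    slice u t = 0 := by
  simp only [slice, h, toL2_zero]

/-- The magnetic Laplacian in logarithmic polar coordinates, multiplied by `|x|²`. -/
noncomputable def logLap (hd : 2 ≤ d) (Ψ : ℝ) (ψ : Space d → ℂ) (p : ℝ × Sph d) : ℂ :=
  (Real.exp (2 * p.1) : ℂ) * magLaplacian (potential d hd Ψ) ψ (logPolar p)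

theorem integral_mul_deriv_two {η : ℝ → ℝ} (hη : ContDiff ℝ ∞ η) (hηc : HasCompactSupport η)
    {f f1 f2 : ℝ → ℂ} (h1 : ∀ t, HasDerivAt f (f1 t) t) (h2 : ∀ t, HasDerivAt f1 (f2 t) t)
    (hf2 : Continuous f2) :
    ∫ t, ((deriv η t : ℝ) : ℂ) * f t = -∫ t, (η t : ℂ) * f1 t ∧
      ∫ t, ((deriv (deriv η) t : ℝ) : ℂ) * f t = ∫ t, (η t : ℂ) * f2 t := by
  have cf : Continuous f := continuous_iff_continuousAt.2 fun t => (h1 t).continuousAt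
  have cf1 : Continuous f1 := continuous_iff_continuousAt.2 fun t => (h2 t).continuousAt
  have hder : ∀ {θ : ℝ → ℝ}, ContDiff ℝ ∞ θ → ContDiff ℝ ∞ (deriv θ) := fun h =>
    (contDiff_infty_iff_deriv.1 h).2
  have hi : ∀ {θ : ℝ → ℝ} {g : ℝ → ℂ}, ContDiff ℝ ∞ θ → HasCompactSupport θ → Continuous g →
      Integrable (fun t => (θ t : ℂ) * g t) := fun hθ hc hg =>
    ((Complex.continuous_ofReal.comp hθ.continuous).mul hg).integrable_of_hasCompactSupport
      (HasCompactSupport.mul_right (hc.comp_left (g := Complex.ofReal) rfl))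
  have key : ∀ {θ : ℝ → ℝ} {g g1 : ℝ → ℂ}, ContDiff ℝ ∞ θ → HasCompactSupport θ →
      (∀ t, HasDerivAt g (g1 t) t) → Continuous g → Continuous g1 →
      ∫ t, (θ t : ℂ) * g1 t = -∫ t, ((deriv θ t : ℝ) : ℂ) * g t := by
    intro θ g g1 hθ hc hg cg cg1
    exact integral_mul_deriv_eq_deriv_mul_of_integrable
      (u := fun t => (θ t : ℂ)) (u' := fun t => ((deriv θ t : ℝ) : ℂ))
      (fun t _ => ((hθ.differentiable (by simp) t).hasDerivAt).ofReal_comp) (fun t _ => hg t)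
      (hi hθ hc cg1) (hi (hder hθ) hc.deriv cg) (hi hθ hc cg)
  have k1 := key hη hηc h1 cf cf1
  have k2 := key hη hηc h2 cf1 hf2
  have k3 := key (hder hη) hηc.deriv h1 cf cf1
  refine ⟨by rw [k1, neg_neg], ?_⟩
  rw [k2, k3, neg_neg]

theorem integrable_logLap_mul {ψ : Space d → ℂ}
    (hV : MemLp (logLap hd Ψ ψ) 2 ((volume : Measure ℝ).prod (sphMeasure d)))
    {θ : ℝ → ℝ} (hθ : Continuous θ) (hθc : HasCompactSupport θ) {E : Sph d → ℂ}
    (hE : MemLp E 2 (sphMeasure d)) :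
    Integrable (fun p => logLap hd Ψ ψ p * ((θ p.1 : ℂ) * conj (E p.2)))
      ((volume : Measure ℝ).prod (sphMeasure d)) := by
  have hθ2 : MemLp (fun t => (θ t : ℂ)) 2 (volume : Measure ℝ) :=
    (Complex.continuous_ofReal.comp hθ).memLp_of_hasCompactSupport
      (hθc.comp_left (g := Complex.ofReal) rfl)
  refine hV.integrable_mul (q := 2) ?_
  rw [memLp_two_iff_integrable_sq_norm]
  · have := (hθ2.integrable_norm_pow (by norm_num)).mul_prod (hE.star.integrable_norm_pow (by norm_num))
    refine this.congr (Eventually.of_forall fun p => ?_)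
    simp [mul_pow]
  · exact hθ2.1.comp_fst.mul hE.star.1.comp_snd

theorem exists_cutoff_one (T : ℝ) : ∃ θ : ℝ → ℝ, Continuous θ ∧ HasCompactSupport θ ∧
    ∀ t, |t| ≤ T → θ t = 1 := by
  let f : ContDiffBump (0 : ℝ) := ⟨|T| + 1, |T| + 2, by positivity, by linarith⟩
  refine ⟨f, f.continuous, f.hasCompactSupport, fun t ht => f.one_of_mem_closedBall ?_⟩
  rw [mem_closedBall_zero_iff, Real.norm_eq_abs]
  exact ht.trans (by change T ≤ |T| + 1; linarith [le_abs_self T])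

theorem memLp_slice_logLap {ψ : Space d → ℂ}
    (hV : MemLp (logLap hd Ψ ψ) 2 ((volume : Measure ℝ).prod (sphMeasure d))) :
    ∀ᵐ t : ℝ, MemLp (fun w => logLap hd Ψ ψ (t, w)) 2 (sphMeasure d) := by
  have h1 := ((memLp_two_iff_integrable_sq_norm hV.1).1 hV).prod_right_ae
  filter_upwards [h1, hV.1.prodMk_left] with t h2 h3
  exact (memLp_two_iff_integrable_sq_norm h3).2 h2

theorem integrable_logLap_mul_conj {ψ : Space d → ℂ}
    (hV : MemLp (logLap hd Ψ ψ) 2 ((volume : Measure ℝ).prod (sphMeasure d)))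
    {T : ℝ} (hT : ∀ p, T < |p.1| → logLap hd Ψ ψ p = 0) {θ : ℝ → ℝ} (hθ : Continuous θ)
    {E : Sph d → ℂ} (hE : MemLp E 2 (sphMeasure d)) :
    Integrable (fun p => logLap hd Ψ ψ p * ((θ p.1 : ℂ) * conj (E p.2)))
      ((volume : Measure ℝ).prod (sphMeasure d)) := by
  obtain ⟨χ, hχ, hχc, hχ1⟩ := exists_cutoff_one T
  refine (integrable_logLap_mul hV (hχ.mul hθ) hχc.mul_right hE).congr
    (Eventually.of_forall fun p => ?_)
  by_cases hp : T < |p.1|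
  · simp only [hT p hp, zero_mul]
  · simp [hχ1 _ (not_lt.1 hp)]

/-- Integrability is not automatic, as A is singular on the axis and ψ need not vanish there. It
follows from square integrability and the bounded range of t. -/
theorem integrable_magLaplacian {ψ : Space d → ℂ}
    (hV : MemLp (logLap hd Ψ ψ) 2 ((volume : Measure ℝ).prod (sphMeasure d)))
    {T : ℝ} (hT : ∀ p, T < |p.1| → logLap hd Ψ ψ p = 0) :
    Integrable (magLaplacian (potential d hd Ψ) ψ) := by
  rw [← integrable_logPolar_iff hd]
  refine (integrable_logLap_mul_conj hV hT (θ := fun t => Real.exp ((d - 2) * t)) (by fun_prop)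
    (memLp_const (1 : ℂ))).congr (Eventually.of_forall fun p => ?_)
  have h : Real.exp (2 * p.1) * Real.exp ((d - 2) * p.1) = Real.exp (d * p.1) := by
    rw [← Real.exp_add]; congr 1; ring
  have h' := congrArg Complex.ofReal h
  rw [Complex.ofReal_mul] at h'
  simp only [logLap, map_one, mul_one, Complex.real_smul]
  linear_combination (magLaplacian (potential d hd Ψ) ψ (logPolar p)) * h'

/-- The coefficients of a smooth function satisfy the radial equation. -/
theorem inner_logLap_single {ψ : Space d → ℂ} (hψ : ContDiff ℝ ∞ ψ) (hψc : HasCompactSupport ψ)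
    (hV : MemLp (logLap hd Ψ ψ) 2 ((volume : Measure ℝ).prod (sphMeasure d)))
    {T : ℝ} (hT : ∀ p, T < |p.1| → logLap hd Ψ ψ p = 0) (i : HomIndex d) :
    ∀ᵐ t : ℝ, inner ℂ (toSphL2 hd Ψ (Finsupp.single i 1)) (toL2 fun w => logLap hd Ψ ψ (t, w)) =
      inner ℂ (toSphL2 hd Ψ (Finsupp.single i 1)) (slice (euler (euler ψ)) t)
      + ((d - 2 : ℝ) : ℂ) * inner ℂ (toSphL2 hd Ψ (Finsupp.single i 1)) (slice (euler ψ) t)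
      - inner ℂ (toSphL2 hd Ψ (sphOp hd Ψ (Finsupp.single i 1))) (slice ψ t) := by
  have he2 := memLp_indexedFn (hd := hd) (Ψ := Ψ) i 2
  have hl2 := memLp_indexedLap (hd := hd) (Ψ := Ψ) i 2
  set κ2 := indexedEigenvalue Ψ i with hκ2
  have hop : ∀ t, inner ℂ (toSphL2 hd Ψ (sphOp hd Ψ (Finsupp.single i 1))) (slice ψ t) =
      (κ2 : ℂ) * inner ℂ he2.toLp (slice ψ t) - inner ℂ hl2.toLp (slice ψ t) := fun t => by
    rw [sphOp_single, map_sub, map_smul, toSphL2_formalLap, toSphL2_single, one_smul, indexedVec,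
      inner_sub_left, inner_smul_left, Complex.conj_ofReal]
  have hs1 : toSphL2 hd Ψ (Finsupp.single i 1) = he2.toLp := by
    rw [toSphL2_single, one_smul, indexedVec]
  simp only [hop, hs1]
  have h1e := contDiff_euler hψ
  have h2e := contDiff_euler h1e
  set f : ℝ → ℂ := fun t => inner ℂ he2.toLp (slice ψ t) with hf
  set f1 : ℝ → ℂ := fun t => inner ℂ he2.toLp (slice (euler ψ) t) with hf1
  set f2 : ℝ → ℂ := fun t => inner ℂ he2.toLp (slice (euler (euler ψ)) t) with hf2
  set fl : ℝ → ℂ := fun t => inner ℂ hl2.toLp (slice ψ t) with hfl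
  have cf : Continuous f := continuous_inner_slice hψ _
  have cf1 : Continuous f1 := continuous_inner_slice h1e _
  have cf2 : Continuous f2 := continuous_inner_slice h2e _
  have cfl : Continuous fl := continuous_inner_slice hψ _
  have hKi : Integrable (fun p => logLap hd Ψ ψ p * conj (indexedFn hd Ψ i p.2))
      ((volume : Measure ℝ).prod (sphMeasure d)) :=
    (integrable_logLap_mul_conj hV hT (θ := fun _ => 1) continuous_const he2).congr
      (Eventually.of_forall fun p => by simp)
  have hKae : ∀ᵐ t : ℝ, inner ℂ he2.toLp (toL2 fun w => logLap hd Ψ ψ (t, w)) =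
      ∫ w, logLap hd Ψ ψ (t, w) * conj (indexedFn hd Ψ i w) ∂(sphMeasure d) := by
    filter_upwards [memLp_slice_logLap hV] with t ht using inner_toLp_toL2 he2 ht
  suffices hmain : ∀ᵐ t : ℝ, ∫ w, logLap hd Ψ ψ (t, w) * conj (indexedFn hd Ψ i w) ∂(sphMeasure d)
      = f2 t + ((d - 2 : ℝ) : ℂ) * f1 t - ((κ2 : ℂ) * f t - fl t) by
    filter_upwards [hKae, hmain] with t h1 h2
    rw [h1, h2]
  -- The equation is tested in t against smooth η. The weak identity moves Δ_A onto the explicit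
  -- function, and integration by parts in t returns the derivatives of η to the coefficients, which
  -- are smooth because ψ is.
  refine ae_eq_of_integral_contDiff_smul_eq hKi.integral_prod_left.locallyIntegrable
    (Continuous.locallyIntegrable (by fun_prop)) fun η hη hηc => ?_
  have hη2 : ContDiff ℝ 2 η := by exact_mod_cast contDiff_infty.1 hη 2
  obtain ⟨M, hM⟩ := hψ.continuous.norm.bddAbove_range_of_hasCompactSupport hψc.norm
  have hweak := integral_logPolar_magLaplacian (Ψ := Ψ) (m := i.1.1) (k := i.2.1) (j := i.2.2)
    (axialVec_idxP (hd := hd) i.1.2) (axialVec_idxQ (hd := hd) i.1.2) (u := ψ)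
    (fun x _ => by exact_mod_cast (contDiff_infty.1 hψ 2).contDiffAt)
    (fun a b _ => ⟨M, fun x _ _ => hM ⟨x, rfl⟩⟩)
    (fun a b _ => (integrable_magLaplacian hV hT).integrableOn) hη2 hηc
  have hL : ∫ p, ((η p.1 * Real.exp (2 * p.1) : ℝ) : ℂ) *
        magLaplacian (potential d hd Ψ) ψ (logPolar p) *
        conj (homFn hd Ψ i.1.1 (axialVec hd i.1.2) i.2.1 i.2.2 p.2)
        ∂((volume : Measure ℝ).prod (sphMeasure d)) =
      ∫ t, η t • ∫ w, logLap hd Ψ ψ (t, w) * conj (indexedFn hd Ψ i w) ∂(sphMeasure d) := by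
    have hint := integrable_logLap_mul hV hη.continuous hηc he2
    have := integral_prod _ hint
    convert this using 1
    · refine integral_congr_ae (Eventually.of_forall fun p => ?_)
      simp only [logLap, indexedFn]
      push_cast
      ring
    · refine integral_congr_ae (Eventually.of_forall fun t => ?_)
      simp only [Complex.real_smul]
      rw [← integral_const_mul]
      refine integral_congr_ae (Eventually.of_forall fun w => ?_)
      ring
  have hderiv : ContDiff ℝ ∞ (deriv η) := (contDiff_infty_iff_deriv.1 hη).2
  have hderiv2 : ContDiff ℝ ∞ (deriv (deriv η)) := (contDiff_infty_iff_deriv.1 hderiv).2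
  set θ : ℝ → ℝ := fun t => deriv (deriv η) t - (d - 2) * deriv η t - κ2 * η t with hθ
  have cθ : Continuous θ := by
    have := hderiv2.continuous
    have := hderiv.continuous
    have := hη.continuous
    fun_prop
  have hint : ∀ {χ : ℝ → ℝ} {g : ℝ → ℂ}, Continuous χ → HasCompactSupport χ → Continuous g →
      Integrable (fun t => (χ t : ℂ) * g t) := fun hθ hc hg =>
    ((Complex.continuous_ofReal.comp hθ).mul hg).integrable_of_hasCompactSupport
      (HasCompactSupport.mul_right (hc.comp_left (g := Complex.ofReal) rfl))
  have hθc : HasCompactSupport θ :=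
    (hηc.deriv.deriv.sub (hηc.deriv.mul_left (f := fun _ => ((d : ℝ) - 2)))).sub
      (hηc.mul_left (f := fun _ => κ2))
  have hψint : ∀ {χ : ℝ → ℝ} {E : Sph d → ℂ}, Continuous χ → HasCompactSupport χ →
      MemLp E 2 (sphMeasure d) → Integrable
        (fun p : ℝ × Sph d => (χ p.1 : ℂ) * (ψ (logPolar p) * conj (E p.2)))
        ((volume : Measure ℝ).prod (sphMeasure d)) := by
    intro χ E hχ hχc hE
    have h1 : Integrable (fun t => (χ t : ℂ)) :=
      (Complex.continuous_ofReal.comp hχ).integrable_of_hasCompactSupport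
        (hχc.comp_left (g := Complex.ofReal) rfl)
    have h2 : Integrable (fun w => conj (E w)) (sphMeasure d) :=
      hE.star.integrable (by norm_num)
    refine ((h1.mul_prod h2).bdd_mul (c := M) (f := fun p => ψ (logPolar p))
      (hψ.continuous.comp continuous_logPolar).aestronglyMeasurable
      (Eventually.of_forall fun p => hM ⟨_, rfl⟩)).congr (Eventually.of_forall fun p => ?_)
    ring
  have hslice : ∀ {χ : ℝ → ℝ} {E : Sph d → ℂ} (_ : Continuous χ) (_ : HasCompactSupport χ)
      (hE : MemLp E 2 (sphMeasure d)),
      ∫ p, (χ p.1 : ℂ) * (ψ (logPolar p) * conj (E p.2)) ∂((volume : Measure ℝ).prod (sphMeasure d))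
        = ∫ t, (χ t : ℂ) * inner ℂ hE.toLp (slice ψ t) := by
    intro χ E hχ hχc hE
    rw [integral_prod _ (hψint hχ hχc hE)]
    refine integral_congr_ae (Eventually.of_forall fun t => ?_)
    simp only
    rw [integral_const_mul, slice, inner_toLp_toL2 hE (memLp_slice hψ.continuous t 2)]
  have hR : ∫ p, ψ (logPolar p) * conj (((deriv (deriv η) p.1 - (d - 2) * deriv η p.1
          - homDegree Ψ i.1.1 i.2.1 i.2.2 * (homDegree Ψ i.1.1 i.2.1 i.2.2 + d - 2) * η p.1 : ℝ)
            : ℂ) * homFn hd Ψ i.1.1 (axialVec hd i.1.2) i.2.1 i.2.2 p.2 +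
          (η p.1 : ℂ) * lapHomFn hd Ψ i.1.1 (axialVec hd i.1.2) i.2.1 i.2.2 p.2)
        ∂((volume : Measure ℝ).prod (sphMeasure d)) =
      (∫ t, (θ t : ℂ) * f t) + ∫ t, (η t : ℂ) * fl t := by
    rw [← hslice cθ hθc he2, ← hslice hη.continuous hηc hl2,
      ← integral_add (hψint cθ hθc he2) (hψint hη.continuous hηc hl2)]
    refine integral_congr_ae (Eventually.of_forall fun p => ?_)
    simp only [map_add, map_mul, Complex.conj_ofReal, hθ, hκ2, indexedEigenvalue, indexedDegree,
      indexedFn, indexedLap]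
    ring
  obtain ⟨hp1, hp2⟩ := integral_mul_deriv_two hη hηc
    (fun t => hasDerivAt_inner_slice hψ he2.toLp t)
    (fun t => hasDerivAt_inner_slice h1e he2.toLp t) cf2
  have e0 := hint hη.continuous hηc cf
  have e1 := hint hη.continuous hηc cf1
  have e2 := hint hη.continuous hηc cf2
  have el := hint hη.continuous hηc cfl
  have d1 := hint hderiv.continuous hηc.deriv cf
  have d2 := hint hderiv2.continuous hηc.deriv.deriv cf
  have hθf : ∫ t, (θ t : ℂ) * f t = (∫ t, (η t : ℂ) * f2 t)
      + ((d - 2 : ℝ) : ℂ) * (∫ t, (η t : ℂ) * f1 t) - (κ2 : ℂ) * ∫ t, (η t : ℂ) * f t := by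
    have : (fun t => (θ t : ℂ) * f t) = fun t =>
        (((deriv (deriv η) t : ℝ) : ℂ) * f t - ((d - 2 : ℝ) : ℂ) * (((deriv η t : ℝ) : ℂ) * f t))
          - (κ2 : ℂ) * ((η t : ℂ) * f t) := by
      ext t; rw [hθ]; push_cast; ring
    rw [this, integral_sub (integrable_fun_sub d2 (d1.const_mul _)) (e0.const_mul _),
      integral_sub d2 (d1.const_mul _), integral_const_mul, integral_const_mul, hp1, hp2]
    ring
  have hright : ∫ t, η t • (f2 t + ((d - 2 : ℝ) : ℂ) * f1 t - ((κ2 : ℂ) * f t - fl t)) =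
      (∫ t, (η t : ℂ) * f2 t) + ((d - 2 : ℝ) : ℂ) * (∫ t, (η t : ℂ) * f1 t)
        - ((κ2 : ℂ) * (∫ t, (η t : ℂ) * f t) - ∫ t, (η t : ℂ) * fl t) := by
    rw [← integral_const_mul, ← integral_const_mul, ← integral_add e2 (e1.const_mul _),
      ← integral_sub (e0.const_mul _) el, ← integral_sub (e2.fun_add (e1.const_mul _))
        (integrable_fun_sub (e0.const_mul _) el)]
    refine integral_congr_ae (Eventually.of_forall fun t => ?_)
    simp only [Complex.real_smul]
    ring
  rw [hright, ← hL, hweak, hR, hθf]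
  ring

theorem inner_logLap {ψ : Space d → ℂ} (hψ : ContDiff ℝ ∞ ψ) (hψc : HasCompactSupport ψ)
    (hV : MemLp (logLap hd Ψ ψ) 2 ((volume : Measure ℝ).prod (sphMeasure d)))
    {T : ℝ} (hT : ∀ p, T < |p.1| → logLap hd Ψ ψ p = 0) (v : HomIndex d →₀ ℂ) :
    ∀ᵐ t : ℝ, inner ℂ (toSphL2 hd Ψ v) (toL2 fun w => logLap hd Ψ ψ (t, w)) =
      inner ℂ (toSphL2 hd Ψ v) (slice (euler (euler ψ)) t)
      + ((d - 2 : ℝ) : ℂ) * inner ℂ (toSphL2 hd Ψ v) (slice (euler ψ) t)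
      - inner ℂ (toSphL2 hd Ψ (sphOp hd Ψ v)) (slice ψ t) := by
  induction v using Finsupp.induction_linear with
  | zero => simp
  | add f g hf hg =>
    filter_upwards [hf, hg] with t h1 h2
    simp only [map_add, inner_add_left, h1, h2]
    ring
  | single i a =>
    have e1 : Finsupp.single i a = a • Finsupp.single i (1 : ℂ) := by simp
    filter_upwards [inner_logLap_single hψ hψc hV hT i] with t h1
    rw [e1]
    simp only [map_smul, inner_smul_left, h1]
    ring

end Slices

end AharonovBohm

namespace AharonovBohm

open MeasureTheory Filter Topology

/-! ### The one-dimensional inequality -/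

section OneDimensional

open scoped ComplexConjugate

theorem integral_eq_zero_of_hasDerivAt_of_compact {H H' : ℝ → ℝ} (h : ∀ t, HasDerivAt H (H' t) t)
    (hH' : Continuous H') (hc : HasCompactSupport H) : ∫ t, H' t = 0 := by
  have hH : Continuous H := continuous_iff_continuousAt.2 fun t => (h t).continuousAt
  have hd : deriv H = H' := funext fun t => (h t).deriv
  exact integral_eq_zero_of_hasDerivAt_of_integrable h
    (hH'.integrable_of_hasCompactSupport (hd ▸ hc.deriv)) (hH.integrable_of_hasCompactSupport hc)

/-- Integrating by parts, ∫ (g'' + bg' - cg)² = ∫ g''² + (b² + 2c)g'² + c²g² and ∫ (ag² - g(g'' +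
bg' - cg)) = ∫ g'² + (c + a)g². The two hypotheses say that the resulting coefficients of g'² and g²
are nonnegative. -/
theorem one_dimensional_inequality {g g1 g2 : ℝ → ℝ} (h1 : ∀ t, HasDerivAt g (g1 t) t)
    (h2 : ∀ t, HasDerivAt g1 (g2 t) t) (hg2 : Continuous g2) (hc : HasCompactSupport g)
    {a b c C : ℝ} (hC1 : C ≤ b ^ 2 + 2 * c) (hC2 : C * (c + a) ≤ c ^ 2) :
    0 ≤ ∫ t, ((g2 t + b * g1 t - c * g t) ^ 2
      - C * (a * g t ^ 2 - g t * (g2 t + b * g1 t - c * g t))) := by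
  have cg : Continuous g := continuous_iff_continuousAt.2 fun t => (h1 t).continuousAt
  have cg1 : Continuous g1 := continuous_iff_continuousAt.2 fun t => (h2 t).continuousAt
  have d1 : deriv g = g1 := funext fun t => (h1 t).deriv
  have d2 : deriv g1 = g2 := funext fun t => (h2 t).deriv
  have hc1 : HasCompactSupport g1 := d1 ▸ hc.deriv
  have hc2 : HasCompactSupport g2 := d2 ▸ hc1.deriv
  -- All boundary terms of these integrations by parts, collected into one compactly supported
  -- function.
  obtain ⟨H, hH⟩ : ∃ H : ℝ → ℝ, H = fun t => b * g1 t ^ 2 - 2 * c * (g t * g1 t)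
      - b * c * g t ^ 2 + C * (g t * g1 t) + C * b / 2 * g t ^ 2 := ⟨_, rfl⟩
  obtain ⟨H', hH'⟩ : ∃ H' : ℝ → ℝ, H' = fun t => 2 * b * g1 t * g2 t - 2 * c * g1 t ^ 2
      - 2 * c * g t * g2 t - 2 * b * c * g t * g1 t + C * g1 t ^ 2 + C * g t * g2 t
      + C * b * g t * g1 t := ⟨_, rfl⟩
  have hder : ∀ t, HasDerivAt H (H' t) t := fun t => by
    have e1 := (h1 t).fun_pow 2
    have e2 := (h2 t).fun_pow 2
    have e3 := (h1 t).fun_mul (h2 t)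
    have e4 := ((((e2.const_mul b).fun_sub (e3.const_mul (2 * c))).fun_sub
      (e1.const_mul (b * c))).fun_add (e3.const_mul C)).fun_add (e1.const_mul (C * b / 2))
    rw [← hH] at e4
    refine e4.congr_deriv ?_
    simp only [hH']
    push_cast
    ring
  have hHc : HasCompactSupport H := by
    refine HasCompactSupport.intro (hc.union hc1) fun t ht => ?_
    simp only [Set.mem_union, not_or] at ht
    simp only [hH, image_eq_zero_of_notMem_tsupport ht.1, image_eq_zero_of_notMem_tsupport ht.2]
    ring
  have cH' : Continuous H' := by rw [hH']; fun_prop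
  have hzero := integral_eq_zero_of_hasDerivAt_of_compact hder cH' hHc
  have hHi : Integrable H' := by
    have h : deriv H = H' := funext fun t => (hder t).deriv
    exact cH'.integrable_of_hasCompactSupport (h ▸ hHc.deriv)
  obtain ⟨P, hP⟩ : ∃ P : ℝ → ℝ, P = fun t => g2 t ^ 2 + (b ^ 2 + 2 * c - C) * g1 t ^ 2
    + (c ^ 2 - C * (c + a)) * g t ^ 2 := ⟨_, rfl⟩
  have hsq : ∀ {u : ℝ → ℝ}, Continuous u → HasCompactSupport u → Integrable fun t => u t ^ 2 :=
    fun hu huc => (hu.fun_pow 2).integrable_of_hasCompactSupport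
      (HasCompactSupport.intro huc fun t ht => by
        rw [image_eq_zero_of_notMem_tsupport ht]; norm_num)
  have hPi : Integrable P := hP ▸ ((hsq hg2 hc2).add ((hsq cg1 hc1).const_mul _)).add
    ((hsq cg hc).const_mul _)
  have hexpr : (fun t => (g2 t + b * g1 t - c * g t) ^ 2
      - C * (a * g t ^ 2 - g t * (g2 t + b * g1 t - c * g t))) = fun t => H' t + P t := by
    ext t
    simp only [hH', hP]
    ring
  rw [hexpr, integral_add hHi hPi, hzero, zero_add]
  refine integral_nonneg fun t => ?_
  have k1 : 0 ≤ b ^ 2 + 2 * c - C := by linarith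
  have k2 : 0 ≤ c ^ 2 - C * (c + a) := by linarith
  simp only [hP, Pi.zero_apply]
  positivity

/-- Substituting g = e^{-γt} f removes the weight and gives b = 2γ + D, c = μ - γ(γ + D), a = γ(2γ +
D), hence c + a = μ + γ². -/
theorem weighted_inequality {f f1 f2 : ℝ → ℝ} (h1 : ∀ t, HasDerivAt f (f1 t) t)
    (h2 : ∀ t, HasDerivAt f1 (f2 t) t) (hf2 : Continuous f2) (hc : HasCompactSupport f)
    {D γ μ C : ℝ} (hC1 : C ≤ (2 * γ + D) ^ 2 + 2 * (μ - γ * (γ + D)))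
    (hC2 : C * (μ + γ ^ 2) ≤ (μ - γ * (γ + D)) ^ 2) :
    0 ≤ ∫ t, Real.exp (-(2 * γ * t)) * ((f2 t + D * f1 t - μ * f t) ^ 2
      - C * (γ * (2 * γ + D) * f t ^ 2 - f t * (f2 t + D * f1 t - μ * f t))) := by
  have hE : ∀ t, HasDerivAt (fun t => Real.exp (-(γ * t))) (-γ * Real.exp (-(γ * t))) t :=
    fun t => by
    have := (((hasDerivAt_id t).const_mul γ).neg).exp
    refine this.congr_deriv ?_
    simp; ring
  have hsq : ∀ t, Real.exp (-(2 * γ * t)) = Real.exp (-(γ * t)) ^ 2 := fun t => by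
    rw [← Real.exp_nat_mul]; congr 1; push_cast; ring
  have key := one_dimensional_inequality (g := fun t => Real.exp (-(γ * t)) * f t)
    (g1 := fun t => Real.exp (-(γ * t)) * (f1 t - γ * f t))
    (g2 := fun t => Real.exp (-(γ * t)) * (f2 t - 2 * γ * f1 t + γ ^ 2 * f t))
    (fun t => ((hE t).fun_mul (h1 t)).congr_deriv (by ring))
    (fun t => ((hE t).fun_mul ((h2 t).fun_sub ((h1 t).const_mul γ))).congr_deriv (by ring))
    (by
      have cf : Continuous f := continuous_iff_continuousAt.2 fun t => (h1 t).continuousAt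
      have cf1 : Continuous f1 := continuous_iff_continuousAt.2 fun t => (h2 t).continuousAt
      fun_prop) hc.mul_left (a := γ * (2 * γ + D)) hC1
    (by rwa [show μ - γ * (γ + D) + γ * (2 * γ + D) = μ + γ ^ 2 by ring])
  refine key.trans_eq (integral_congr_ae (Eventually.of_forall fun t => ?_))
  simp only [hsq]
  ring

/-- All coefficients are real, so real and imaginary parts separate. -/
theorem weighted_inequality_complex {f f1 f2 : ℝ → ℂ} (h1 : ∀ t, HasDerivAt f (f1 t) t)
    (h2 : ∀ t, HasDerivAt f1 (f2 t) t) (hf2 : Continuous f2) (hc : HasCompactSupport f)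
    {D γ μ C : ℝ} (hC1 : C ≤ (2 * γ + D) ^ 2 + 2 * (μ - γ * (γ + D)))
    (hC2 : C * (μ + γ ^ 2) ≤ (μ - γ * (γ + D)) ^ 2) :
    Integrable (fun t => Real.exp (-(2 * γ * t)) * (‖f2 t + D * f1 t - μ * f t‖ ^ 2
      - C * (γ * (2 * γ + D) * ‖f t‖ ^ 2 - (conj (f t) * (f2 t + D * f1 t - μ * f t)).re))) ∧
    0 ≤ ∫ t, Real.exp (-(2 * γ * t)) * (‖f2 t + D * f1 t - μ * f t‖ ^ 2
      - C * (γ * (2 * γ + D) * ‖f t‖ ^ 2 - (conj (f t) * (f2 t + D * f1 t - μ * f t)).re)) := by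
  have cf : Continuous f := continuous_iff_continuousAt.2 fun t => (h1 t).continuousAt
  have cf1 : Continuous f1 := continuous_iff_continuousAt.2 fun t => (h2 t).continuousAt
  have d1 : deriv f = f1 := funext fun t => (h1 t).deriv
  have d2 : deriv f1 = f2 := funext fun t => (h2 t).deriv
  have hc1 : HasCompactSupport f1 := d1 ▸ hc.deriv
  have hc2 : HasCompactSupport f2 := d2 ▸ hc1.deriv
  have part : ∀ L : ℂ →L[ℝ] ℝ,
      Integrable (fun t => Real.exp (-(2 * γ * t)) * ((L (f2 t) + D * L (f1 t) - μ * L (f t)) ^ 2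
      - C * (γ * (2 * γ + D) * L (f t) ^ 2 - L (f t) *
        (L (f2 t) + D * L (f1 t) - μ * L (f t))))) ∧
      0 ≤ ∫ t, Real.exp (-(2 * γ * t)) * ((L (f2 t) + D * L (f1 t) - μ * L (f t)) ^ 2
      - C * (γ * (2 * γ + D) * L (f t) ^ 2 - L (f t) *
        (L (f2 t) + D * L (f1 t) - μ * L (f t)))) := by
    intro L
    refine ⟨Continuous.integrable_of_hasCompactSupport (by fun_prop) ?_,
      weighted_inequality (fun t => L.hasFDerivAt.comp_hasDerivAt t (h1 t))
        (fun t => L.hasFDerivAt.comp_hasDerivAt t (h2 t)) (L.continuous.comp hf2)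
        (hc.comp_left (map_zero L)) hC1 hC2⟩
    refine HasCompactSupport.mul_left ?_
    refine HasCompactSupport.intro ((hc.union hc1).union hc2) fun t ht => ?_
    simp only [Set.mem_union, not_or] at ht
    rw [image_eq_zero_of_notMem_tsupport ht.1.1, image_eq_zero_of_notMem_tsupport ht.1.2,
      image_eq_zero_of_notMem_tsupport ht.2]
    simp
  obtain ⟨i1, p1⟩ := part Complex.reCLM
  obtain ⟨i2, p2⟩ := part Complex.imCLM
  have hsum : (fun t => Real.exp (-(2 * γ * t)) * (‖f2 t + D * f1 t - μ * f t‖ ^ 2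
      - C * (γ * (2 * γ + D) * ‖f t‖ ^ 2 - (conj (f t) * (f2 t + D * f1 t - μ * f t)).re))) =
      fun t => Real.exp (-(2 * γ * t)) * ((Complex.reCLM (f2 t) + D * Complex.reCLM (f1 t)
        - μ * Complex.reCLM (f t)) ^ 2 - C * (γ * (2 * γ + D) * Complex.reCLM (f t) ^ 2
        - Complex.reCLM (f t) *
        (Complex.reCLM (f2 t) + D * Complex.reCLM (f1 t) - μ * Complex.reCLM (f t)))) +
      Real.exp (-(2 * γ * t)) * ((Complex.imCLM (f2 t) + D * Complex.imCLM (f1 t)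
        - μ * Complex.imCLM (f t)) ^ 2 - C * (γ * (2 * γ + D) * Complex.imCLM (f t) ^ 2
        - Complex.imCLM (f t) *
        (Complex.imCLM (f2 t) + D * Complex.imCLM (f1 t) - μ * Complex.imCLM (f t)))) := by
    ext t
    simp only [← Complex.normSq_eq_norm_sq, Complex.normSq_apply, Complex.add_re, Complex.sub_re,
      Complex.add_im, Complex.sub_im, Complex.mul_re, Complex.mul_im, Complex.ofReal_re,
      Complex.ofReal_im, Complex.conj_re, Complex.conj_im, Complex.reCLM_apply, Complex.imCLM_apply]
    ring
  rw [hsum]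
  exact ⟨i1.add i2, by rw [integral_add i1 i2]; exact add_nonneg p1 p2⟩

end OneDimensional

end AharonovBohm

namespace AharonovBohm

open MeasureTheory Filter Topology

/-! ### Orthogonal projections in an orthonormal basis -/

section Projection

open scoped ComplexConjugate

variable {H : Type*} [NormedAddCommGroup H] [InnerProductSpace ℂ H] {n : ℕ} {b : Fin n → H}

theorem starProjection_eq_sum (hb : Orthonormal ℂ b) {K : Submodule ℂ H}
    [K.HasOrthogonalProjection] (hK : Submodule.span ℂ (Set.range b) = K) (x : H) :
    K.starProjection x = ∑ i, inner ℂ (b i) x • b i := by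
  refine Submodule.eq_starProjection_of_mem_of_inner_eq_zero ?_ ?_
  · rw [← hK]
    exact Submodule.sum_mem _ fun i _ => Submodule.smul_mem _ _ (Submodule.subset_span ⟨i, rfl⟩)
  · intro w hw
    rw [← hK] at hw
    refine Submodule.span_induction (p := fun w _ =>
      inner ℂ (x - ∑ i, inner ℂ (b i) x • b i) w = 0) ?_ ?_ ?_ ?_ hw
    · rintro _ ⟨j, rfl⟩
      rw [inner_sub_left, hb.inner_left_fintype, inner_conj_symm, sub_self]
    · simp
    · intro u v _ _ hu hv
      rw [inner_add_right, hu, hv, add_zero]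
    · intro a u _ hu
      rw [inner_smul_right, hu, mul_zero]

theorem inner_sum_smul (x y : H) :
    inner ℂ (∑ i, inner ℂ (b i) x • b i) y = ∑ i, conj (inner ℂ (b i) x) * inner ℂ (b i) y := by
  rw [sum_inner]
  simp only [inner_smul_left]

theorem norm_sum_smul_sq (hb : Orthonormal ℂ b) (x : H) :
    ‖∑ i, inner ℂ (b i) x • b i‖ ^ 2 = ∑ i, ‖inner ℂ (b i) x‖ ^ 2 := by
  have h := inner_self_eq_norm_sq_to_K (𝕜 := ℂ) (∑ i, inner ℂ (b i) x • b i)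
  rw [inner_sum_smul] at h
  simp only [hb.inner_right_fintype] at h
  apply Complex.ofReal_injective
  push_cast
  refine h.symm.trans (Finset.sum_congr rfl fun i _ => ?_)
  rw [← Complex.normSq_eq_conj_mul_self, Complex.normSq_eq_norm_sq]
  push_cast
  rfl

end Projection

/-! ### Strong convergence of the projections onto finite families -/

section Completeness

variable {d : ℕ} {hd : 2 ≤ d} {Ψ : ℝ}

/-- The span of finitely many homogeneous functions on the sphere. -/
noncomputable def harmonicSpan (hd : 2 ≤ d) (Ψ : ℝ) (I : Finset (ℤ × (Fin d → ℤ)) × ℕ) :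
    Submodule ℂ (SphL2 d) :=
  (Finsupp.supported ℂ ℂ (boundedIndex I.1 I.2)).map (toSphL2 hd Ψ)

instance (I : Finset (ℤ × (Fin d → ℤ)) × ℕ) : FiniteDimensional ℂ (harmonicSpan hd Ψ I) := by
  rw [harmonicSpan, Finsupp.supported_eq_span_single, Submodule.map_span]
  exact FiniteDimensional.span_of_finite ℂ (((finite_boundedIndex I.1 I.2).image _).image _)

theorem monotone_harmonicSpan : Monotone (harmonicSpan hd Ψ) := fun _ _ h =>
  Submodule.map_mono (Finsupp.supported_mono fun _ hi => ⟨h.1 hi.1, hi.2.trans h.2⟩)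

theorem indexedVec_mem_harmonicSpan (i : HomIndex d) :
    indexedVec hd Ψ i ∈ harmonicSpan hd Ψ ({i.1}, i.2.1 + 2 * i.2.2) :=
  ⟨Finsupp.single i 1, Finsupp.single_mem_supported ℂ 1
    ⟨Finset.mem_singleton_self _, le_rfl⟩, by rw [toSphL2_single, one_smul]⟩

theorem tendsto_starProjection_harmonicSpan (x : SphL2 d) :
    Tendsto (fun I => (harmonicSpan hd Ψ I).starProjection x) atTop (𝓝 x) := by
  refine Submodule.starProjection_tendsto_self _ monotone_harmonicSpan x (le_of_eq ?_)
  refine (Submodule.topologicalClosure_eq_top_iff.2 ?_).symm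
  rw [eq_bot_iff]
  intro F hF
  rw [Submodule.mem_bot]
  refine eq_zero_of_inner_indexedVec (hd := hd) (Ψ := Ψ) fun i => ?_
  exact hF _ (Submodule.mem_iSup_of_mem _ (indexedVec_mem_harmonicSpan i))

end Completeness

/-! ### Summation over the spherical modes -/

section SphereInequality

open scoped ComplexConjugate

variable {d : ℕ} {hd : 2 ≤ d} {Ψ : ℝ}

/-- The domination for the limit over finite families: `p` is the norm of a projection, `u` and `v`
the norms of the full vectors, and the bound does not involve `p`. -/
theorem abs_defect_le {C a u v p x : ℝ} (hp : p ^ 2 ≤ u ^ 2) (hx : |x| ≤ p * v) :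
    |v ^ 2 - C * (a * p ^ 2 - x)| ≤ (1 + |C|) * v ^ 2 + |C| * (|a| + 1) * u ^ 2 := by
  have h1 : |x| ≤ u ^ 2 + v ^ 2 := by nlinarith [sq_nonneg (p - v), sq_nonneg p, sq_nonneg v]
  have h2 : |a * p ^ 2 - x| ≤ |a| * u ^ 2 + (u ^ 2 + v ^ 2) := by
    refine (abs_sub _ _).trans (add_le_add ?_ h1)
    rw [abs_mul, abs_of_nonneg (sq_nonneg p)]
    exact mul_le_mul_of_nonneg_left hp (abs_nonneg a)
  have h3 : |v ^ 2 - C * (a * p ^ 2 - x)| ≤ v ^ 2 + |C| * (|a| * u ^ 2 + (u ^ 2 + v ^ 2)) := by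
    refine (abs_sub _ _).trans (add_le_add (abs_of_nonneg (sq_nonneg v)).le ?_)
    rw [abs_mul]
    exact mul_le_mul_of_nonneg_left h2 (abs_nonneg C)
  linarith

/-- The conditions under which `C` is admissible for the eigenvalue `μ` of the spherical
operator. -/
def Admissible (D γ C μ : ℝ) : Prop :=
  C ≤ (2 * γ + D) ^ 2 + 2 * (μ - γ * (γ + D)) ∧ C * (μ + γ ^ 2) ≤ (μ - γ * (γ + D)) ^ 2

/-- Each coefficient along an eigenbasis of a finite family satisfies the one-dimensional
inequality. Summing, replacing the projected norm of V by the full one with Bessel, and letting the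
family grow gives the inequality for the whole slice. -/
theorem slice_inequality {ψ : Space d → ℂ} (hψ : ContDiff ℝ ∞ ψ) (hψc : HasCompactSupport ψ)
    (hV : MemLp (logLap hd Ψ ψ) 2 ((volume : Measure ℝ).prod (sphMeasure d)))
    {T : ℝ} (hT : ∀ p, T < |p.1| → logLap hd Ψ ψ p = 0)
    (hTψ : ∀ p, T < |p.1| → ψ (logPolar p) = 0) {γ C : ℝ}
    (hC : ∀ m ∈ indexSet d Ψ, Admissible (d - 2) γ C (eigenvalue d Ψ m))
    (hVi : Integrable fun t => Real.exp (-(2 * γ * t)) *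
      ‖toL2 fun w => logLap hd Ψ ψ (t, w)‖ ^ 2)
    (hUi : Integrable fun t => Real.exp (-(2 * γ * t)) * ‖slice ψ t‖ ^ 2) :
    0 ≤ ∫ t, Real.exp (-(2 * γ * t)) * (‖toL2 fun w => logLap hd Ψ ψ (t, w)‖ ^ 2
      - C * (γ * (2 * γ + (d - 2)) * ‖slice ψ t‖ ^ 2
        - (inner ℂ (slice ψ t) (toL2 fun w => logLap hd Ψ ψ (t, w))).re)) := by
  set V : ℝ → SphL2 d := fun t => toL2 fun w => logLap hd Ψ ψ (t, w) with hVdef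
  set a : ℝ := γ * (2 * γ + (d - 2)) with ha
  -- Only ψ is projected. The inner product with V then involves V through its projection alone, and
  -- the squared norm of V can only help.
  set F : (Finset (ℤ × (Fin d → ℤ)) × ℕ) → ℝ → ℝ := fun I t => Real.exp (-(2 * γ * t)) *
    (‖V t‖ ^ 2 - C * (a * ‖(harmonicSpan hd Ψ I).starProjection (slice ψ t)‖ ^ 2
      - (inner ℂ ((harmonicSpan hd Ψ I).starProjection (slice ψ t)) (V t)).re)) with hF
  set B : ℝ → ℝ := fun t => (1 + |C|) * (Real.exp (-(2 * γ * t)) * ‖V t‖ ^ 2)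
    + |C| * (|a| + 1) * (Real.exp (-(2 * γ * t)) * ‖slice ψ t‖ ^ 2) with hB
  have hBi : Integrable B := (hVi.const_mul _).add (hUi.const_mul _)
  have hbound : ∀ I t, ‖F I t‖ ≤ B t := by
    intro I t
    rw [hF, hB]
    simp only [Real.norm_eq_abs]
    rw [abs_mul, abs_of_pos (Real.exp_pos _)]
    have := abs_defect_le (C := C) (a := a) (u := ‖slice ψ t‖) (v := ‖V t‖)
      (pow_le_pow_left₀ (norm_nonneg _)
        (Submodule.norm_starProjection_apply_le (harmonicSpan hd Ψ I) (slice ψ t)) 2)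
      ((Complex.abs_re_le_norm _).trans (norm_inner_le_norm
        ((harmonicSpan hd Ψ I).starProjection (slice ψ t)) (V t)))
    refine (mul_le_mul_of_nonneg_left this (Real.exp_pos _).le).trans_eq ?_
    ring
  have hstep : ∀ I, AEStronglyMeasurable (F I) volume ∧ 0 ≤ ∫ t, F I t := by
    intro I
    obtain ⟨n, u, μ, hon, hspan, heig, hμ⟩ := exists_eigenbasis hd Ψ I.1 I.2
    set b : Fin n → SphL2 d := fun i => toSphL2 hd Ψ (u i) with hb
    have hode : ∀ i, ∀ᵐ t : ℝ, inner ℂ (b i) (V t) = inner ℂ (b i) (slice (euler (euler ψ)) t)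
        + ((d - 2 : ℝ) : ℂ) * inner ℂ (b i) (slice (euler ψ) t)
        - (μ i : ℂ) * inner ℂ (b i) (slice ψ t) := by
      intro i
      filter_upwards [inner_logLap hψ hψc hV hT (u i)] with t ht
      rw [hb, hVdef, ht, heig, inner_smul_left, Complex.conj_ofReal]
    have hall : ∀ᵐ t : ℝ, ∀ i, inner ℂ (b i) (V t) = inner ℂ (b i) (slice (euler (euler ψ)) t)
        + ((d - 2 : ℝ) : ℂ) * inner ℂ (b i) (slice (euler ψ) t)
        - (μ i : ℂ) * inner ℂ (b i) (slice ψ t) := ae_all_iff.2 hode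
    have hproj : ∀ x, (harmonicSpan hd Ψ I).starProjection x = ∑ i, inner ℂ (b i) x • b i :=
      starProjection_eq_sum hon hspan
    have h1e := contDiff_euler hψ
    have h2e := contDiff_euler h1e
    have hone := fun i => weighted_inequality_complex
      (fun t => hasDerivAt_inner_slice hψ (b i) t) (fun t => hasDerivAt_inner_slice h1e (b i) t)
      (continuous_inner_slice h2e (b i))
      (HasCompactSupport.intro (isCompact_Icc (a := -T) (b := T)) fun t ht => by
        rw [slice_eq_zero, inner_zero_right]
        intro w
        refine hTψ (t, w) ?_
        by_contra hcon
        exact ht (abs_le.1 (not_lt.1 hcon)))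
      (D := d - 2) (γ := γ) (μ := μ i) (C := C)
      (by obtain ⟨m, hm, h⟩ := hμ i; rw [h]; exact (hC m hm).1)
      (by obtain ⟨m, hm, h⟩ := hμ i; rw [h]; exact (hC m hm).2)
    have hform : ∀ᵐ t : ℝ, F I t = Real.exp (-(2 * γ * t)) * ‖V t‖ ^ 2
        - Real.exp (-(2 * γ * t)) * ∑ i, C * (a * ‖inner ℂ (b i) (slice ψ t)‖ ^ 2 -
          (conj (inner ℂ (b i) (slice ψ t)) * (inner ℂ (b i) (slice (euler (euler ψ)) t)
        + ((d - 2 : ℝ) : ℂ) * inner ℂ (b i) (slice (euler ψ) t)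
        - (μ i : ℂ) * inner ℂ (b i) (slice ψ t))).re) := by
      filter_upwards [hall] with t ht
      simp only [hF, hproj, norm_sum_smul_sq hon, inner_sum_smul, ht, Complex.re_sum,
        ← Finset.mul_sum, Finset.sum_sub_distrib]
      ring
    have cU : ∀ i, Continuous fun t => inner ℂ (b i) (slice ψ t) :=
      fun i => continuous_inner_slice hψ (b i)
    have cU1 : ∀ i, Continuous fun t => inner ℂ (b i) (slice (euler ψ) t) :=
      fun i => continuous_inner_slice h1e (b i)
    have cU2 : ∀ i, Continuous fun t => inner ℂ (b i) (slice (euler (euler ψ)) t) :=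
      fun i => continuous_inner_slice h2e (b i)
    have hmeas : AEStronglyMeasurable (F I) volume := by
      refine AEStronglyMeasurable.congr ?_ (EventuallyEq.symm hform)
      refine hVi.aestronglyMeasurable.sub (Continuous.aestronglyMeasurable ?_)
      fun_prop
    refine ⟨hmeas, ?_⟩
    have hsum := Finset.sum_nonneg fun (i : Fin n) (_ : i ∈ Finset.univ) => (hone i).2
    rw [← integral_finsetSum _ fun i _ => (hone i).1] at hsum
    refine hsum.trans (integral_mono_ae (integrable_finsetSum _ fun i _ => (hone i).1)
      (hBi.mono' hmeas (Eventually.of_forall (hbound I))) ?_)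
    filter_upwards [hform, hall] with t h1 h2
    rw [h1]
    -- Bessel's inequality for V, whose coefficients are given by the radial equation.
    have hbes := hon.sum_inner_products_le (V t) (s := Finset.univ)
    simp only [h2] at hbes
    rw [← Finset.mul_sum, Finset.sum_sub_distrib, ← mul_sub]
    refine mul_le_mul_of_nonneg_left ?_ (Real.exp_pos _).le
    exact sub_le_sub_right hbes _
  -- Dominated convergence along `atTop` needs a countably generated filter, which the integer
  -- vectors ζ in the indices provide.
  refine ge_of_tendsto' (tendsto_integral_filter_of_dominated_convergence (l := atTop) B
    (Eventually.of_forall fun I => (hstep I).1)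
    (Eventually.of_forall fun I => Eventually.of_forall (hbound I)) hBi
    (Eventually.of_forall fun t => ?_)) fun I => (hstep I).2
  have hlim := tendsto_starProjection_harmonicSpan (hd := hd) (Ψ := Ψ) (slice ψ t)
  refine Tendsto.const_mul _ (Tendsto.const_sub _ (Tendsto.const_mul _ (Tendsto.sub
    ((hlim.norm.pow 2).const_mul _) ?_)))
  exact (Complex.continuous_re.tendsto _).comp (hlim.inner tendsto_const_nhds)

end SphereInequality

end AharonovBohm

namespace AharonovBohm

open MeasureTheory Filter Topology

/-! ### Attainment of the minima and admissibility of the constant -/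

section Constants

variable {d : ℕ} {α Ψ : ℝ} {m : ℤ}

theorem eigenvalue_nonneg (hd : 2 ≤ d) (hm : m ∈ indexSet d Ψ) : 0 ≤ eigenvalue d Ψ m := by
  have h2 : (2 : ℝ) ≤ d := by exact_mod_cast hd
  rw [eigenvalue]
  rcases hm with h | h
  · exact mul_nonneg_of_nonpos_of_nonpos (by linarith) (by linarith)
  · exact mul_nonneg (by linarith) (by linarith)

/-- Quadratic growth in m, in both directions; with it, minima over infinite index sets are
attained. -/
theorem tendsto_eigenvalue (d : ℕ) (Ψ : ℝ) :
    Tendsto (fun m : ℤ => eigenvalue d Ψ m) cofinite atTop := by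
  have h1 : Tendsto (fun m : ℤ => |(m : ℝ)|) cofinite atTop :=
    (tendsto_norm_cocompact_atTop (E := ℝ)).comp Int.tendsto_coe_cofinite
  have h2 : Tendsto (fun m : ℤ => |(m : ℝ)| * (|(m : ℝ)| - |2 * Ψ + d - 2|) + Ψ * (Ψ + d - 2))
      cofinite atTop :=
    tendsto_atTop_add_const_right _ _ (h1.atTop_mul_atTop₀ (tendsto_atTop_add_const_right _ _ h1))
  refine tendsto_atTop_mono (fun m => ?_) h2
  have h3 : |(m : ℝ) * (2 * Ψ + d - 2)| = |(m : ℝ)| * |2 * Ψ + d - 2| := abs_mul _ _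
  have h4 := neg_abs_le ((m : ℝ) * (2 * Ψ + d - 2))
  have h5 := abs_mul_abs_self (m : ℝ)
  rw [eigenvalue]
  nlinarith

/-- With γ = (4 + α - d)/2 one has d - 4 - α = -2γ and d + α = 2(γ + d - 2), so a common factor 16
cancels and the quotient is c²/(μ + γ²). -/
theorem ratio_eq (d : ℕ) (α Ψ : ℝ) (m : ℤ) : ratio d α Ψ m =
    (eigenvalue d Ψ m - (4 + α - d) / 2 * ((4 + α - d) / 2 + (d - 2))) ^ 2 /
      (eigenvalue d Ψ m + ((4 + α - d) / 2) ^ 2) := by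
  rw [ratio, ← mul_div_mul_left (_ ^ 2) (_ + _) (by norm_num : (16 : ℝ) ≠ 0)]
  congr 1 <;> ring

/-- With s = μ + γ² and a = γ(2γ + d - 2) the quotient is (s - a)²/s ≥ s - 2a. -/
theorem tendsto_ratio (d : ℕ) (α Ψ : ℝ) :
    Tendsto (fun m : ℤ => ratio d α Ψ m) cofinite atTop := by
  set γ : ℝ := (4 + α - d) / 2 with hγ
  have h1 : Tendsto (fun m : ℤ => eigenvalue d Ψ m + (γ ^ 2 - 2 * (γ * (2 * γ + (d - 2)))))
      cofinite atTop := tendsto_atTop_add_const_right _ _ (tendsto_eigenvalue d Ψ)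
  refine tendsto_atTop_mono' _ ?_ h1
  filter_upwards [(tendsto_eigenvalue d Ψ).eventually_gt_atTop 0] with m hm
  have hs : 0 < eigenvalue d Ψ m + γ ^ 2 := by positivity
  rw [ratio_eq, ← hγ, le_div_iff₀ hs]
  nlinarith [sq_nonneg (γ * (2 * γ + (d - 2)))]

theorem indexSet_nonempty (d : ℕ) (Ψ : ℝ) : (indexSet d Ψ).Nonempty :=
  ⟨⌈-Ψ⌉, Or.inr (Int.le_ceil _)⟩

theorem isLeast_image_sInf {s : Set ℤ} (hs : s.Nonempty) {f : ℤ → ℝ}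
    (hf : Tendsto f cofinite atTop) : IsLeast (f '' s) (sInf (f '' s)) := by
  obtain ⟨a, ha, hmin⟩ := hf.exists_within_forall_le hs
  have h : IsLeast (f '' s) (f a) := ⟨⟨a, ha, rfl⟩, Set.forall_mem_image.2 hmin⟩
  rwa [h.csInf_eq]

theorem isLeast_ratioSet (h : (d : ℝ) - α - 4 ≠ 0) :
    IsLeast (ratioSet d α Ψ) (constant d α Ψ) := by
  rw [constant, if_pos h]
  exact isLeast_image_sInf (indexSet_nonempty d Ψ) (tendsto_ratio d α Ψ)

theorem isLeast_nonzeroEigenvalueSet (hd : 2 ≤ d) (Ψ : ℝ) :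
    IsLeast (nonzeroEigenvalueSet d Ψ) (sInf (nonzeroEigenvalueSet d Ψ)) := by
  have hne : {m : ℤ | m ∈ indexSet d Ψ ∧ (m : ℝ) + Ψ ≠ 0 ∧ (m : ℝ) + Ψ ≠ 2 - d}.Nonempty := by
    have h1 := Int.le_ceil (-Ψ)
    have h2 : (2 : ℝ) ≤ d := by exact_mod_cast hd
    refine ⟨⌈-Ψ⌉ + 1, Or.inr ?_, ?_, ?_⟩
    all_goals push_cast
    · linarith
    · exact (by linarith : 0 < (⌈-Ψ⌉ : ℝ) + 1 + Ψ).ne'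
    · exact (by linarith : (2 - d : ℝ) < (⌈-Ψ⌉ : ℝ) + 1 + Ψ).ne'
  exact isLeast_image_sInf hne (tendsto_eigenvalue d Ψ)

/-- The constant is admissible for all eigenvalues. -/
theorem admissible_constant (hd : 2 ≤ d) (hm : m ∈ indexSet d Ψ) :
    Admissible (d - 2) ((4 + α - d) / 2) (constant d α Ψ) (eigenvalue d Ψ m) := by
  have hμ := eigenvalue_nonneg hd hm
  by_cases h : (d : ℝ) - α - 4 ≠ 0
  · have hle : constant d α Ψ ≤ ratio d α Ψ m := (isLeast_ratioSet h).2 ⟨m, hm, rfl⟩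
    rw [ratio_eq] at hle
    set γ : ℝ := (4 + α - d) / 2 with hγ
    set μ := eigenvalue d Ψ m
    have hγ0 : γ ≠ 0 := fun h0 => h (by linarith)
    have hs : 0 < μ + γ ^ 2 := by positivity
    have hle' := (le_div_iff₀ hs).1 hle
    refine ⟨hle.trans ?_, hle'⟩
    rw [div_le_iff₀ hs]
    -- With s = μ + γ², b = 2γ + d - 2 and c = s - γb, the difference (b² + 2c)s - c² equals s² +
    -- b²μ.
    nlinarith [sq_nonneg (μ + γ ^ 2), mul_nonneg (sq_nonneg (2 * γ + (d - 2))) hμ]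
  · rw [not_not] at h
    have hγ : (4 + α - d) / 2 = 0 := by linarith
    rw [hγ, constant, if_neg (not_not.2 h)]
    -- For γ = 0 the conditions are C ≤ (d - 2)² + 2μ and Cμ ≤ μ². The second is void for μ = 0,
    -- which is why vanishing eigenvalues are left out of the minimum.
    refine ⟨(min_le_left _ _).trans (by nlinarith), ?_⟩
    by_cases h0 : (m : ℝ) + Ψ ≠ 0 ∧ (m : ℝ) + Ψ ≠ 2 - d
    · have hle := (min_le_right ((d - 2 : ℝ) ^ 2) _).trans
        ((isLeast_nonzeroEigenvalueSet hd Ψ).2 ⟨m, ⟨hm, h0⟩, rfl⟩)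
      nlinarith
    · have hz : eigenvalue d Ψ m = 0 := by
        rw [eigenvalue]
        by_cases h1 : (m : ℝ) + Ψ = 0
        · rw [h1, zero_mul]
        · have h2 : (m : ℝ) + Ψ = 2 - d := by
            by_contra h2
            exact h0 ⟨h1, h2⟩
          rw [show (m : ℝ) + Ψ + d - 2 = 0 by linarith, mul_zero]
      simp [hz]

end Constants

end AharonovBohm

namespace AharonovBohm

open MeasureTheory Filter Topology

/-! ### The weighted norm of the magnetic gradient -/

section GradientIdentity

open scoped ComplexConjugate

variable {d : ℕ} {A : Space d → Space d} {u v : Space d → ℂ} {x : Space d}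

theorem differentiableAt_conj (hu : DifferentiableAt ℝ u x) :
    DifferentiableAt ℝ (fun y => conj (u y)) x :=
  Complex.conjCLE.toContinuousLinearMap.differentiableAt.comp x hu

/-- For real A the two potential terms cancel, so the Leibniz rule for u · conj v holds with
magnetic derivatives on both factors. -/
theorem partialDeriv_mul_conj (hu : DifferentiableAt ℝ u x) (hv : DifferentiableAt ℝ v x)
    (j : Fin d) : partialDeriv j (fun y => u y * conj (v y)) x =
      magDeriv A j u x * conj (v x) + u x * conj (magDeriv A j v x) := by
  rw [partialDeriv_mul hu (differentiableAt_conj hv), partialDeriv_conj j hv, magDeriv_eq,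
    magDeriv_eq]
  simp only [map_sub, map_mul, Complex.conj_I, Complex.conj_ofReal]
  ring

/-- The magnetic Leibniz rule applied twice gives Δ|u|² = 2|∇_A u|² + 2 Re(conj u Δ_A u), an
identity free of A on the left. -/
theorem laplacian_mul_conj_self (hA : ContDiffAt ℝ 1 A x) (hu : ContDiffAt ℝ 2 u x) :
    laplacian (fun y => u y * conj (u y)) x =
      ((2 * ‖magGradient A u x‖ ^ 2 + 2 * (conj (u x) * magLaplacian A u x).re : ℝ) : ℂ) := by
  have hj : ∀ j, partialDeriv j (partialDeriv j fun y => u y * conj (u y)) x =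
      2 * ((‖magDeriv A j u x‖ ^ 2 : ℝ) : ℂ) +
        (conj (u x) * magDeriv A j (magDeriv A j u) x +
          conj (conj (u x) * magDeriv A j (magDeriv A j u) x)) := by
    intro j
    have h1 : partialDeriv j (fun y => u y * conj (u y)) =ᶠ[𝓝 x] fun y =>
        magDeriv A j u y * conj (u y) + u y * conj (magDeriv A j u y) := by
      filter_upwards [eventually_contDiffAt_two hu] with y hy
      have := hy.differentiableAt (by simp)
      exact partialDeriv_mul_conj this this j
    have d1 : DifferentiableAt ℝ (magDeriv A j u) x :=
      (contDiffAt_magDeriv hA hu (by norm_num) j).differentiableAt (by simp)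
    have d0 : DifferentiableAt ℝ u x := hu.differentiableAt (by simp)
    rw [partialDeriv_congr h1, ← magDeriv_zero,
      magDeriv_add (u := fun y => magDeriv A j u y * conj (u y))
        (d1.fun_mul (differentiableAt_conj d0)) (d0.fun_mul (differentiableAt_conj d1)),
      magDeriv_zero, magDeriv_zero, partialDeriv_mul_conj (A := A) d1 d0,
      partialDeriv_mul_conj (A := A) d0 d1]
    have h2 : magDeriv A j u x * conj (magDeriv A j u x) = ((‖magDeriv A j u x‖ ^ 2 : ℝ) : ℂ) := by
      rw [Complex.mul_conj, Complex.normSq_eq_norm_sq]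
    rw [h2, map_mul, Complex.conj_conj]
    ring
  rw [laplacian, Finset.sum_congr rfl fun j _ => hj j, Finset.sum_add_distrib, ← Finset.mul_sum]
  have h3 : ‖magGradient A u x‖ ^ 2 = ∑ j, ‖magDeriv A j u x‖ ^ 2 := EuclideanSpace.norm_sq_eq _
  rw [h3, Finset.sum_add_distrib, ← map_sum, ← Finset.mul_sum, Complex.add_conj]
  push_cast
  rfl

theorem laplacian_rpow_norm_sq (hx : x ≠ 0) (p : ℝ) :
    laplacian (fun y => (((‖y‖ ^ 2) ^ p : ℝ) : ℂ)) x =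
      ((2 * p * (2 * p - 2 + d) * (‖x‖ ^ 2) ^ (p - 1) : ℝ) : ℂ) := by
  have hs : 0 < ‖x‖ ^ 2 := by positivity
  have h1 : ∀ {q s : ℝ}, 0 < s → deriv (fun s : ℝ => s ^ q) s = q * s ^ (q - 1) := fun hs =>
    (Real.hasDerivAt_rpow_const (Or.inl hs.ne')).deriv
  have h2 : deriv (deriv fun s : ℝ => s ^ p) (‖x‖ ^ 2) =
      p * ((p - 1) * (‖x‖ ^ 2) ^ (p - 1 - 1)) := by
    have : deriv (fun s : ℝ => s ^ p) =ᶠ[𝓝 (‖x‖ ^ 2)] fun s => p * s ^ (p - 1) := by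
      filter_upwards [lt_mem_nhds hs] with s hs using h1 hs
    rw [this.deriv_eq, deriv_const_mul _
      (Real.hasDerivAt_rpow_const (Or.inl hs.ne')).differentiableAt, h1 hs]
  have h3 : (‖x‖ ^ 2) ^ (p - 1) = (‖x‖ ^ 2) ^ (p - 1 - 1) * ‖x‖ ^ 2 := by
    conv_rhs => rw [← Real.rpow_one (‖x‖ ^ 2)]
    rw [← Real.rpow_mul hs.le, one_mul, ← Real.rpow_add hs]
    congr 1; ring
  rw [laplacian_comp (β := fun s => s ^ p) (Real.contDiffAt_rpow_const_of_ne hs.ne')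
    contDiffAt_normSq, h1 hs, h2, gradInner_normSq_normSq, laplacian_normSq, h3]
  push_cast
  ring

variable {hd : 2 ≤ d} {Ψ : ℝ} {ψ : Space d → ℂ}

theorem continuous_mul_of_notMem_tsupport {f : Space d → ℂ} {g : Space d → ℝ} (hf : Continuous f)
    (h0 : 0 ∉ tsupport f) (hg : ∀ x ≠ 0, ContinuousAt g x) :
    Continuous fun x => f x * (g x : ℂ) := by
  refine continuous_of_tsupport fun x hx => ?_
  have hx' : x ∈ tsupport f := tsupport_mul_subset_left hx
  exact hf.continuousAt.mul (Complex.continuous_ofReal.continuousAt.comp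
    (hg x fun h => h0 (h ▸ hx')))

theorem continuousAt_rpow_norm_sq (p : ℝ) (x : Space d) (hx : x ≠ 0) :
    ContinuousAt (fun y : Space d => (‖y‖ ^ 2) ^ p) x :=
  (continuous_norm.pow 2).continuousAt.rpow_const
    (Or.inl (pow_ne_zero 2 (norm_ne_zero_iff.2 hx)))

theorem integrable_of_continuous_of_tsupport {f : Space d → ℂ} (hf : Continuous f)
    (hc : HasCompactSupport f) (h0 : 0 ∉ tsupport f) (p : ℝ) :
    Integrable fun x => f x * (((‖x‖ ^ 2) ^ p : ℝ) : ℂ) :=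
  (continuous_mul_of_notMem_tsupport hf h0
    (continuousAt_rpow_norm_sq p)).integrable_of_hasCompactSupport hc.mul_right

/-- The weighted integral of `|∇_A ψ|²` by means of `|ψ|²` and `conj ψ Δ_A ψ`. -/
theorem integral_norm_magGradient_sq (hψ : ContDiff ℝ ∞ ψ) (hψc : HasCompactSupport ψ)
    (h0 : 0 ∉ tsupport ψ) (hL : Integrable (magLaplacian (potential d hd Ψ) ψ)) (p : ℝ) :
    Integrable (fun x => (conj (ψ x) * magLaplacian (potential d hd Ψ) ψ x).re * (‖x‖ ^ 2) ^ p) ∧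
    Integrable (fun x => ‖ψ x‖ ^ 2 * (‖x‖ ^ 2) ^ (p - 1)) ∧
    Integrable (fun x => ‖magGradient (potential d hd Ψ) ψ x‖ ^ 2 * (‖x‖ ^ 2) ^ p) ∧
    ∫ x, ‖magGradient (potential d hd Ψ) ψ x‖ ^ 2 * (‖x‖ ^ 2) ^ p =
      p * (2 * p - 2 + d) * (∫ x, ‖ψ x‖ ^ 2 * (‖x‖ ^ 2) ^ (p - 1))
        - ∫ x, (conj (ψ x) * magLaplacian (potential d hd Ψ) ψ x).re * (‖x‖ ^ 2) ^ p := by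
  set L := magLaplacian (potential d hd Ψ) ψ with hLdef
  have hψ2 : ContDiff ℝ 2 ψ := by exact_mod_cast contDiff_infty.1 hψ 2
  set Φ : Space d → ℂ := fun y => ψ y * conj (ψ y) with hΦ
  have hΦC : ContDiff ℝ 2 Φ := hψ2.mul
    (Complex.conjCLE.toContinuousLinearMap.contDiff.comp hψ2)
  have hΦc : HasCompactSupport Φ := hψc.mul_right
  have hΦs : tsupport Φ ⊆ tsupport ψ := tsupport_mul_subset_left
  have hΦ0 : 0 ∉ tsupport Φ := fun h => h0 (hΦs h)
  have hΦn : ∀ x, Φ x = ((‖ψ x‖ ^ 2 : ℝ) : ℂ) := fun x => by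
    rw [hΦ]; simp only; rw [Complex.mul_conj, Complex.normSq_eq_norm_sq]
  have hlapC : Continuous (laplacian Φ) := continuous_iff_continuousAt.2 fun x => by
    rw [← magLaplacian_zero]
    exact (contDiffAt_magLaplacian (n := 0) contDiffAt_const hΦC.contDiffAt
      (by norm_num)).continuousAt
  have hlap0 : ∀ x ∉ tsupport Φ, laplacian Φ x = 0 := fun x hx => by
    rw [← magLaplacian_zero]
    exact magLaplacian_eq_zero_of_notMem hx
  have hlaps : tsupport (laplacian Φ) ⊆ tsupport Φ :=
    closure_minimal (fun x hx => by_contra fun h => hx (hlap0 x h)) (isClosed_tsupport Φ)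
  have hlapc : HasCompactSupport (laplacian Φ) := hΦc.of_isClosed_subset (isClosed_tsupport _) hlaps
  have i1 : Integrable (fun x => laplacian Φ x * (((‖x‖ ^ 2) ^ p : ℝ) : ℂ)) :=
    integrable_of_continuous_of_tsupport hlapC hlapc (fun h => hΦ0 (hlaps h)) p
  have i2 : Integrable (fun x => ‖ψ x‖ ^ 2 * (‖x‖ ^ 2) ^ (p - 1)) := by
    have := integrable_of_continuous_of_tsupport hΦC.continuous hΦc hΦ0 (p - 1)
    refine this.re.congr (Eventually.of_forall fun x => ?_)
    simp only [hΦn, ← Complex.ofReal_mul]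
    exact Complex.ofReal_re _
  have i3 : Integrable (fun x => (conj (ψ x) * L x).re * (‖x‖ ^ 2) ^ p) := by
    have hcont := continuous_mul_of_notMem_tsupport hψ.continuous h0 (continuousAt_rpow_norm_sq p)
    obtain ⟨C, hC⟩ := hcont.norm.bddAbove_range_of_hasCompactSupport
      (HasCompactSupport.norm (hψc.mul_right))
    have := hL.bdd_mul (c := C) (f := fun x => conj (ψ x * (((‖x‖ ^ 2) ^ p : ℝ) : ℂ)))
      (Complex.continuous_conj.comp hcont).aestronglyMeasurable
      (Eventually.of_forall fun x => by rw [RCLike.norm_conj]; exact hC ⟨x, rfl⟩)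
    refine this.re.congr (Eventually.of_forall fun x => ?_)
    simp only [map_mul, Complex.conj_ofReal]
    rw [mul_right_comm]
    exact Complex.re_mul_ofReal _ _
  -- Although ∇_A ψ may be singular on the axis, |ψ|² is smooth there, so this identity off the axis
  -- also yields the integrability of the gradient term.
  have hpt : ∀ᵐ x : Space d, ‖magGradient (potential d hd Ψ) ψ x‖ ^ 2 * (‖x‖ ^ 2) ^ p =
      (1 / 2) * (laplacian Φ x * (((‖x‖ ^ 2) ^ p : ℝ) : ℂ)).re
        - (conj (ψ x) * L x).re * (‖x‖ ^ 2) ^ p := by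
    filter_upwards [ae_mem_offAxis hd] with x hx
    rw [hΦ, laplacian_mul_conj_self (contDiffAt_potential hd Ψ hx) hψ2.contDiffAt,
      ← Complex.ofReal_mul, Complex.ofReal_re]
    ring
  have i1' : Integrable fun x => (laplacian Φ x * (((‖x‖ ^ 2) ^ p : ℝ) : ℂ)).re := i1.re
  have i4 := (i1'.const_mul (1 / 2)).sub i3
  refine ⟨i3, i2, i4.congr (EventuallyEq.symm hpt), ?_⟩
  -- Green's formula with zero potential for |x|^{2p} and |ψ|²; both are regular away from the
  -- origin, so the axis plays no role.
  have hgreen := integral_magLaplacian_mul_conj (A := (0 : Space d → Space d)) (U := {0}ᶜ)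
    (u := fun y => (((‖y‖ ^ 2) ^ p : ℝ) : ℂ)) (Φ := Φ) (fun x _ => contDiffAt_const)
    (fun x hx => contDiffAt_ofReal (contDiffAt_normSq.rpow_const_of_ne
      (pow_ne_zero 2 (norm_ne_zero_iff.2 hx)))) (fun x _ => hΦC.contDiffAt) hΦc
    (fun x hx h => hΦ0 (h ▸ hx))
  rw [magLaplacian_zero, magLaplacian_zero] at hgreen
  have hval : ∫ x, (laplacian Φ x * (((‖x‖ ^ 2) ^ p : ℝ) : ℂ)).re =
      2 * p * (2 * p - 2 + d) * ∫ x, ‖ψ x‖ ^ 2 * (‖x‖ ^ 2) ^ (p - 1) := by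
    have e1 : ∫ x, (laplacian Φ x * (((‖x‖ ^ 2) ^ p : ℝ) : ℂ)).re =
        (∫ x, (((‖x‖ ^ 2) ^ p : ℝ) : ℂ) * conj (laplacian Φ x)).re := by
      have e2 : ∫ x, (((‖x‖ ^ 2) ^ p : ℝ) : ℂ) * conj (laplacian Φ x) =
          conj (∫ x, laplacian Φ x * (((‖x‖ ^ 2) ^ p : ℝ) : ℂ)) := by
        rw [← integral_conj]
        refine integral_congr_ae (Eventually.of_forall fun x => ?_)
        simp only [map_mul, Complex.conj_ofReal]
        ring
      rw [e2, Complex.conj_re]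
      exact integral_re i1
    have e3 : ∫ x, laplacian (fun y => (((‖y‖ ^ 2) ^ p : ℝ) : ℂ)) x * conj (Φ x) =
        ((2 * p * (2 * p - 2 + d) * ∫ x, ‖ψ x‖ ^ 2 * (‖x‖ ^ 2) ^ (p - 1) : ℝ) : ℂ) := by
      rw [← integral_const_mul, ← integral_complex_ofReal]
      refine integral_congr_ae (Eventually.of_forall fun x => ?_)
      by_cases hx : x = 0
      · have h1 : Φ x = 0 := image_eq_zero_of_notMem_tsupport (hx ▸ hΦ0)
        have h2 := hΦn x
        rw [h1] at h2
        have h3 : ‖ψ x‖ ^ 2 = 0 := by exact_mod_cast h2.symm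
        simp only [h1, h3, map_zero, mul_zero, zero_mul, Complex.ofReal_zero]
      · simp only [laplacian_rpow_norm_sq hx, hΦn, Complex.conj_ofReal]
        push_cast
        ring
    rw [e1, ← hgreen, e3, Complex.ofReal_re]
  rw [integral_congr_ae hpt, integral_sub (i1'.const_mul _) i3, integral_const_mul, hval]
  ring

end GradientIdentity

end AharonovBohm

namespace AharonovBohm

open MeasureTheory Filter Topology

/-! ### Assembly of the inequality -/

section Rellich

open scoped ComplexConjugate

variable {d : ℕ} {hd : 2 ≤ d} {Ψ : ℝ} {ψ : Space d → ℂ}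

theorem measurable_potential_apply (j : Fin d) :
    Measurable fun x : Space d => potential d hd Ψ x j := by
  have hx : ∀ l, Measurable fun x : Space d => x l := fun l =>
    (contDiff_coord l (n := 0)).continuous.measurable
  have hρ : Measurable (axisSq hd) := (contDiff_axisSq hd (n := 0)).continuous.measurable
  have h1 : Measurable fun x : Space d => Ψ * (-(x (idxQ hd)) / axisSq hd x) :=
    Measurable.const_mul (Measurable.div (hx (idxQ hd)).neg hρ) Ψ
  have h2 : Measurable fun x : Space d => Ψ * (x (idxP hd) / axisSq hd x) :=
    Measurable.const_mul (Measurable.div (hx (idxP hd)) hρ) Ψ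
  simp only [potential_apply]
  split_ifs
  · exact h1
  · exact h2
  · exact measurable_const

theorem measurable_magDeriv (j : Fin d) (hψ : Measurable ψ) :
    Measurable (magDeriv (potential d hd Ψ) j ψ) :=
  (measurable_fderiv_apply_const ℝ ψ _).sub ((measurable_const.mul
    (Complex.measurable_ofReal.comp (measurable_potential_apply j))).mul hψ)

theorem measurable_magLaplacian (hψ : Measurable ψ) :
    Measurable (magLaplacian (potential d hd Ψ) ψ) :=
  Finset.measurable_fun_sum _ fun j _ => measurable_magDeriv j (measurable_magDeriv j hψ)

theorem measurable_logLap (hψ : Measurable ψ) : Measurable (logLap hd Ψ ψ) :=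
  (Complex.measurable_ofReal.comp (Real.measurable_exp.comp (measurable_fst.const_mul 2))).mul
    ((measurable_magLaplacian hψ).comp continuous_logPolar.measurable)

theorem exists_logPolar_notMem_tsupport (hψc : HasCompactSupport ψ) (h0 : 0 ∉ tsupport ψ) :
    ∃ T : ℝ, ∀ p : ℝ × Sph d, T < |p.1| → logPolar p ∉ tsupport ψ := by
  obtain ⟨r, hr, hball⟩ := Metric.isOpen_iff.1 (isClosed_tsupport ψ).isOpen_compl 0 h0
  obtain ⟨R, hR⟩ := hψc.isCompact.isBounded.exists_norm_le
  refine ⟨max |Real.log r| |Real.log (max R 1)|, fun p hp hmem => ?_⟩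
  have h1 : r ≤ Real.exp p.1 := by
    rw [← norm_logPolar p]
    by_contra hcon
    exact hball (mem_ball_zero_iff.2 (not_le.1 hcon)) hmem
  have h2 : Real.exp p.1 ≤ max R 1 := by
    rw [← norm_logPolar p]
    exact (hR _ hmem).trans (le_max_left _ _)
  have h3 : Real.log r ≤ p.1 := (Real.log_le_iff_le_exp hr).2 h1
  have h4 : p.1 ≤ Real.log (max R 1) := (Real.le_log_iff_exp_le (by positivity)).2 h2
  refine absurd hp (not_lt.2 (abs_le.2 ⟨?_, ?_⟩))
  · have := neg_abs_le (Real.log r)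
    have := le_max_left |Real.log r| |Real.log (max R 1)|
    linarith
  · exact (h4.trans (le_abs_self _)).trans (le_max_right _ _)

theorem norm_sq_rpow (x : Space d) (q : ℝ) : (‖x‖ ^ 2) ^ q = ‖x‖ ^ (2 * q) := by
  rw [← Real.rpow_natCast, ← Real.rpow_mul (norm_nonneg x)]
  norm_num

theorem norm_logPolar_rpow (p : ℝ × Sph d) (q : ℝ) :
    ‖logPolar p‖ ^ q = Real.exp (q * p.1) := by
  rw [norm_logPolar, ← Real.exp_mul, mul_comm]

theorem norm_logLap_sq (p : ℝ × Sph d) : ‖logLap hd Ψ ψ p‖ ^ 2 =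
    Real.exp (4 * p.1) * ‖magLaplacian (potential d hd Ψ) ψ (logPolar p)‖ ^ 2 := by
  rw [logLap, norm_mul, mul_pow, Complex.norm_real, Real.norm_eq_abs, Real.abs_exp,
    ← Real.exp_nat_mul]
  congr 2
  push_cast
  ring

/-- The volume e^{dt}, the weight e^{-αt} and the factor e^{4t} absorbed in |`logLap`|² leave
e^{-2γt} with γ = (4 + α - d)/2. -/
theorem lintegral_magLaplacian (hψ : Continuous ψ) (α : ℝ) :
    ∫⁻ x, ENNReal.ofReal (‖magLaplacian (potential d hd Ψ) ψ x‖ ^ 2 / ‖x‖ ^ α) =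
      ∫⁻ p, ENNReal.ofReal (Real.exp (-(2 * ((4 + α - d) / 2) * p.1)) * ‖logLap hd Ψ ψ p‖ ^ 2)
        ∂((volume : Measure ℝ).prod (sphMeasure d)) := by
  rw [lintegral_logPolar hd]
  · refine lintegral_congr fun p => ?_
    rw [← ENNReal.ofReal_mul (Real.exp_pos _).le, norm_logPolar_rpow, norm_logLap_sq, div_eq_mul_inv,
      ← Real.exp_neg]
    congr 1
    have h : Real.exp (-(2 * ((4 + α - d) / 2) * p.1)) * Real.exp (4 * p.1) =
        Real.exp (d * p.1) * Real.exp (-(α * p.1)) := by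
      rw [← Real.exp_add, ← Real.exp_add]; congr 1; ring
    linear_combination (-‖magLaplacian (potential d hd Ψ) ψ (logPolar p)‖ ^ 2) * h
  · exact (((measurable_magLaplacian hψ.measurable).norm.pow_const 2).div
      (measurable_norm.pow_const α)).ennreal_ofReal

/-- On the bounded range |t| ≤ T the inverse of the exponential weight is bounded. -/
theorem memLp_logLap {γ T : ℝ} (hψ : Continuous ψ)
    (hT : ∀ p, T < |p.1| → logLap hd Ψ ψ p = 0)
    (h : Integrable (fun p => Real.exp (-(2 * γ * p.1)) * ‖logLap hd Ψ ψ p‖ ^ 2)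
      ((volume : Measure ℝ).prod (sphMeasure d))) :
    MemLp (logLap hd Ψ ψ) 2 ((volume : Measure ℝ).prod (sphMeasure d)) := by
  rw [memLp_two_iff_integrable_sq_norm (measurable_logLap hψ.measurable).aestronglyMeasurable]
  obtain ⟨χ, hχ, hχc, hχ1⟩ := exists_cutoff_one T
  have hcont : Continuous fun t => χ t * Real.exp (2 * γ * t) := by fun_prop
  obtain ⟨M, hM⟩ := hcont.norm.bddAbove_range_of_hasCompactSupport
    (HasCompactSupport.norm hχc.mul_right)
  refine (h.bdd_mul (c := M) (f := fun p : ℝ × Sph d => χ p.1 * Real.exp (2 * γ * p.1))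
    (hcont.comp continuous_fst).aestronglyMeasurable
    (Eventually.of_forall fun p => hM ⟨p.1, rfl⟩)).congr (Eventually.of_forall fun p => ?_)
  by_cases hp : T < |p.1|
  · simp [hT p hp]
  · simp only [hχ1 _ (not_lt.1 hp), one_mul]
    rw [← mul_assoc, ← Real.exp_add, add_neg_cancel, Real.exp_zero, one_mul]

/-- The Rellich inequality in logarithmic polar coordinates. -/
theorem logPolar_inequality (hψ : ContDiff ℝ ∞ ψ) (hψc : HasCompactSupport ψ)
    {T : ℝ} (hT : ∀ p, T < |p.1| → logLap hd Ψ ψ p = 0)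
    (hTψ : ∀ p, T < |p.1| → ψ (logPolar p) = 0) {γ C : ℝ}
    (hC : ∀ m ∈ indexSet d Ψ, Admissible (d - 2) γ C (eigenvalue d Ψ m))
    (hV : Integrable (fun p => Real.exp (-(2 * γ * p.1)) * ‖logLap hd Ψ ψ p‖ ^ 2)
      ((volume : Measure ℝ).prod (sphMeasure d)))
    (hU : Integrable (fun p => Real.exp (-(2 * γ * p.1)) * ‖ψ (logPolar p)‖ ^ 2)
      ((volume : Measure ℝ).prod (sphMeasure d)))
    (hUV : Integrable (fun p => Real.exp (-(2 * γ * p.1)) *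
      (conj (ψ (logPolar p)) * logLap hd Ψ ψ p).re) ((volume : Measure ℝ).prod (sphMeasure d))) :
    C * (γ * (2 * γ + (d - 2)) * (∫ p, Real.exp (-(2 * γ * p.1)) * ‖ψ (logPolar p)‖ ^ 2
        ∂((volume : Measure ℝ).prod (sphMeasure d)))
      - ∫ p, Real.exp (-(2 * γ * p.1)) * (conj (ψ (logPolar p)) * logLap hd Ψ ψ p).re
        ∂((volume : Measure ℝ).prod (sphMeasure d))) ≤
      ∫ p, Real.exp (-(2 * γ * p.1)) * ‖logLap hd Ψ ψ p‖ ^ 2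
        ∂((volume : Measure ℝ).prod (sphMeasure d)) := by
  have hV2 := memLp_logLap hψ.continuous hT hV
  have hVs := memLp_slice_logLap hV2
  have hUs := fun t => memLp_slice (d := d) hψ.continuous t 2
  have e1 : ∀ᵐ t : ℝ, ∫ w, Real.exp (-(2 * γ * t)) * ‖logLap hd Ψ ψ (t, w)‖ ^ 2 ∂(sphMeasure d) =
      Real.exp (-(2 * γ * t)) * ‖toL2 fun w => logLap hd Ψ ψ (t, w)‖ ^ 2 := by
    filter_upwards [hVs] with t ht
    rw [integral_const_mul, norm_toL2_sq ht]
  have e2 : ∀ᵐ t : ℝ, ∫ w, Real.exp (-(2 * γ * t)) * ‖ψ (logPolar (t, w))‖ ^ 2 ∂(sphMeasure d) =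
      Real.exp (-(2 * γ * t)) * ‖slice ψ t‖ ^ 2 :=
    Eventually.of_forall fun t => by rw [integral_const_mul, slice, norm_toL2_sq (hUs t)]
  have e3 : ∀ᵐ t : ℝ, ∫ w, Real.exp (-(2 * γ * t)) *
      (conj (ψ (logPolar (t, w))) * logLap hd Ψ ψ (t, w)).re ∂(sphMeasure d) =
      Real.exp (-(2 * γ * t)) *
        (inner ℂ (slice ψ t) (toL2 fun w => logLap hd Ψ ψ (t, w))).re := by
    filter_upwards [hVs] with t ht
    have hi : Integrable (fun w => conj (ψ (logPolar (t, w))) * logLap hd Ψ ψ (t, w))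
        (sphMeasure d) := (hUs t).star.integrable_mul ht
    have h2 : ∫ w, (conj (ψ (logPolar (t, w))) * logLap hd Ψ ψ (t, w)).re ∂(sphMeasure d) =
        (∫ w, conj (ψ (logPolar (t, w))) * logLap hd Ψ ψ (t, w) ∂(sphMeasure d)).re :=
      integral_re hi
    rw [integral_const_mul, h2, slice, toL2_eq (hUs t), inner_toLp_toL2 (hUs t) ht]
    simp only [mul_comm]
  have i1 := hV.integral_prod_left.congr e1
  have i2 := hU.integral_prod_left.congr e2
  have i3 := hUV.integral_prod_left.congr e3
  have hmain := slice_inequality hψ hψc hV2 hT hTψ hC i1 i2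
  rw [integral_prod _ hV, integral_prod _ hU, integral_prod _ hUV, integral_congr_ae e1,
    integral_congr_ae e2, integral_congr_ae e3]
  have hsplit : ∫ t, Real.exp (-(2 * γ * t)) * (‖toL2 fun w => logLap hd Ψ ψ (t, w)‖ ^ 2
      - C * (γ * (2 * γ + (d - 2)) * ‖slice ψ t‖ ^ 2
        - (inner ℂ (slice ψ t) (toL2 fun w => logLap hd Ψ ψ (t, w))).re)) =
      (∫ t, Real.exp (-(2 * γ * t)) * ‖toL2 fun w => logLap hd Ψ ψ (t, w)‖ ^ 2) -
      C * (γ * (2 * γ + (d - 2)) * (∫ t, Real.exp (-(2 * γ * t)) * ‖slice ψ t‖ ^ 2) -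
        ∫ t, Real.exp (-(2 * γ * t)) *
          (inner ℂ (slice ψ t) (toL2 fun w => logLap hd Ψ ψ (t, w))).re) := by
    rw [← integral_const_mul, ← integral_sub (i2.const_mul _) i3, ← integral_const_mul,
      ← integral_sub i1 ((integrable_fun_sub (i2.const_mul _) i3).const_mul _)]
    refine integral_congr_ae (Eventually.of_forall fun t => ?_)
    ring
  rw [hsplit] at hmain
  exact sub_nonneg.1 hmain

/-- A finite left side provides all the integrability needed. The gradient identity then turns the
right side into the quantity bounded by `logPolar_inequality`. -/
theorem rellich_inequality (hd : 2 ≤ d) (α Ψ : ℝ) (hψ : ContDiff ℝ ∞ ψ)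
    (hψc : HasCompactSupport ψ) (h0 : 0 ∉ tsupport ψ) :
    ENNReal.ofReal (constant d α Ψ) *
        ∫⁻ x, ENNReal.ofReal (‖magGradient (potential d hd Ψ) ψ x‖ ^ 2 / ‖x‖ ^ (α + 2)) ≤
      ∫⁻ x, ENNReal.ofReal (‖magLaplacian (potential d hd Ψ) ψ x‖ ^ 2 / ‖x‖ ^ α) := by
  by_cases hfin : ∫⁻ x, ENNReal.ofReal
      (‖magLaplacian (potential d hd Ψ) ψ x‖ ^ 2 / ‖x‖ ^ α) = ⊤
  · rw [hfin]; exact le_top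
  have heq := lintegral_magLaplacian (hd := hd) (Ψ := Ψ) hψ.continuous α
  set γ : ℝ := (4 + α - d) / 2 with hγ
  -- The power of |x|² that produces the weight |x|^{-(α + 2)} of the gradient term.
  set q : ℝ := -((α + 2) / 2) with hq
  obtain ⟨T, hT⟩ := exists_logPolar_notMem_tsupport hψc h0
  have hTψ : ∀ p, T < |p.1| → ψ (logPolar p) = 0 := fun p hp =>
    image_eq_zero_of_notMem_tsupport (hT p hp)
  have hTL : ∀ p, T < |p.1| → logLap hd Ψ ψ p = 0 := fun p hp => by
    rw [logLap, magLaplacian_eq_zero_of_notMem (hT p hp), mul_zero]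
  have hpos : ∀ p : ℝ × Sph d, 0 ≤ Real.exp (-(2 * γ * p.1)) * ‖logLap hd Ψ ψ p‖ ^ 2 :=
    fun p => by positivity
  have hVi : Integrable (fun p => Real.exp (-(2 * γ * p.1)) * ‖logLap hd Ψ ψ p‖ ^ 2)
      ((volume : Measure ℝ).prod (sphMeasure d)) := by
    refine ⟨Measurable.aestronglyMeasurable ?_, ?_⟩
    · exact (Real.measurable_exp.comp (measurable_fst.const_mul (2 * γ)).neg).mul
        ((measurable_logLap hψ.continuous.measurable).norm.pow_const 2)
    · rw [hasFiniteIntegral_iff_ofReal (Eventually.of_forall hpos), ← heq]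
      exact lt_top_iff_ne_top.2 hfin
  obtain ⟨i3, i2, i4, hgrad⟩ := integral_norm_magGradient_sq hψ hψc h0
    (integrable_magLaplacian (memLp_logLap hψ.continuous hTL hVi) hTL) q
  have c2 : ∀ p : ℝ × Sph d, Real.exp (d * p.1) •
      (‖ψ (logPolar p)‖ ^ 2 * (‖logPolar p‖ ^ 2) ^ (q - 1)) =
      Real.exp (-(2 * γ * p.1)) * ‖ψ (logPolar p)‖ ^ 2 := fun p => by
    have h : Real.exp (d * p.1) * Real.exp (2 * (q - 1) * p.1) = Real.exp (-(2 * γ * p.1)) := by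
      rw [← Real.exp_add]; congr 1; rw [hγ, hq]; ring
    rw [norm_sq_rpow, norm_logPolar_rpow, ← h, smul_eq_mul]
    ring
  have c3 : ∀ p : ℝ × Sph d, Real.exp (d * p.1) •
      ((conj (ψ (logPolar p)) * magLaplacian (potential d hd Ψ) ψ (logPolar p)).re *
        (‖logPolar p‖ ^ 2) ^ q) =
      Real.exp (-(2 * γ * p.1)) * (conj (ψ (logPolar p)) * logLap hd Ψ ψ p).re := fun p => by
    have h : Real.exp (d * p.1) * Real.exp (2 * q * p.1) =
        Real.exp (-(2 * γ * p.1)) * Real.exp (2 * p.1) := by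
      rw [← Real.exp_add, ← Real.exp_add]; congr 1; rw [hγ, hq]; ring
    rw [norm_sq_rpow, norm_logPolar_rpow, logLap, mul_left_comm, Complex.re_ofReal_mul, smul_eq_mul]
    linear_combination
      (conj (ψ (logPolar p)) * magLaplacian (potential d hd Ψ) ψ (logPolar p)).re * h
  have j2 := (integrable_logPolar_iff hd).2 i2
  have j3 := (integrable_logPolar_iff hd).2 i3
  have k2 := integral_logPolar hd fun x => ‖ψ x‖ ^ 2 * (‖x‖ ^ 2) ^ (q - 1)
  have k3 := integral_logPolar hd fun x =>
    (conj (ψ x) * magLaplacian (potential d hd Ψ) ψ x).re * (‖x‖ ^ 2) ^ q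
  simp only [c2] at j2 k2
  simp only [c3] at j3 k3
  have hmain := logPolar_inequality hψ hψc hTL hTψ
    (fun m hm => admissible_constant (α := α) hd hm) hVi j2 j3
  -- The coefficient of |ψ|² in the gradient identity is the number a = γ(2γ + d - 2) of the
  -- one-dimensional inequality.
  have hcoef : q * (2 * q - 2 + d) = γ * (2 * γ + (d - 2)) := by rw [hγ, hq]; ring
  rw [← hγ, ← k2, ← k3, ← hcoef, ← hgrad] at hmain
  have hgradl : ∫⁻ x, ENNReal.ofReal (‖magGradient (potential d hd Ψ) ψ x‖ ^ 2 / ‖x‖ ^ (α + 2)) =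
      ENNReal.ofReal (∫ x, ‖magGradient (potential d hd Ψ) ψ x‖ ^ 2 * (‖x‖ ^ 2) ^ q) := by
    rw [ofReal_integral_eq_lintegral_ofReal i4 (Eventually.of_forall fun x => by positivity)]
    refine lintegral_congr fun x => ?_
    rw [norm_sq_rpow, div_eq_mul_inv, ← Real.rpow_neg (norm_nonneg x), hq]
    congr 3
    ring
  rw [hgradl, heq, ← ofReal_integral_eq_lintegral_ofReal hVi (Eventually.of_forall hpos),
    ← ENNReal.ofReal_mul' (integral_nonneg fun x => by positivity)]
  exact ENNReal.ofReal_le_ofReal hmain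

end Rellich

end AharonovBohm

/-! ### The theorem -/

theorem theorem1p6 (d : ℕ) (hd : 2 ≤ d) (α Ψ : ℝ) :
    ((d : ℝ) - α - 4 ≠ 0 →
      IsLeast (AharonovBohm.ratioSet d α Ψ) (AharonovBohm.constant d α Ψ)) ∧
    ((d : ℝ) - α - 4 = 0 →
      ∃ μ : ℝ, IsLeast (AharonovBohm.nonzeroEigenvalueSet d Ψ) μ ∧
        AharonovBohm.constant d α Ψ = min (((d : ℝ) - 2) ^ 2) μ) ∧
    ∀ ψ : EuclideanSpace ℝ (Fin d) → ℂ,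
      ContDiff ℝ ∞ ψ → HasCompactSupport ψ → 0 ∉ tsupport ψ →
      ENNReal.ofReal (AharonovBohm.constant d α Ψ) *
          ∫⁻ x, ENNReal.ofReal
            (‖AharonovBohm.magGradient (AharonovBohm.potential d hd Ψ) ψ x‖ ^ 2 /
              ‖x‖ ^ (α + 2)) ≤
        ∫⁻ x, ENNReal.ofReal
            (‖AharonovBohm.magLaplacian (AharonovBohm.potential d hd Ψ) ψ x‖ ^ 2 /
              ‖x‖ ^ α) := by
  refine ⟨AharonovBohm.isLeast_ratioSet, fun h => ?_, fun ψ hψ hψc h0 =>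
    AharonovBohm.rellich_inequality hd α Ψ hψ hψc h0⟩
  exact ⟨_, AharonovBohm.isLeast_nonzeroEigenvalueSet hd Ψ, by
    rw [AharonovBohm.constant, if_neg (not_not.2 h)]⟩
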